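/- Let $M$ be a compact smooth Riemannian manifold (without boundary) of dimension $n$, with metric $\langle\cdot,\cdot\rangle$ and Riemannian volume $\mu$, let $N$ be an $n$-dimensional smooth manifold with a volume form $\nu$, and let $\lambda\colon(0,\infty)\to(0,\infty)$ be smooth. Put $\varphi(r)=\tfrac12\big(\lambda(r)-r\lambda'(r)\big)$. For a diffeomorphism $\eta\colon N\to M$ let the density $\rho>0$ on $M$ be defined by $(\rho\circ\eta)\,\eta^*\mu=\nu$ (with $M$ oriented so that $\eta$ preserves orientation). On the open set of pairs $(\eta,F)$ in $C^\infty(N,M\times\mathbb R)$ with $\eta$ a diffeomorphism, consider the Riemannian metric $$\langle\!\langle (u\circ\eta,f\circ\eta),(v\circ\eta,g\circ\eta)\rangle\!\rangle_{(\eta,F)}=\int_M\big[\lambda(\rho)\,fg+\rho\,\langle u,v\rangle\big]\,d\mu ,$$ where $u,v$ are vector fields and $f,g$ functions on $M$. A geodesic is a smooth curve that is a critical point of the energy $\tfrac12\int_a^b\langle\!\langle\dot\gamma,\dot\gamma\rangle\!\rangle\,dt$ on every compact time interval $[a,b]$ under smooth variations with fixed end points. Let $(\eta(t),F(t))$, $t\in(-T,T)$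 with $T>0$, be a geodesic of this metric with every $\eta(t)$ a diffeomorphism. Let $\rho(t)$ be the density of $\eta(t)$, let $u(t)$ and $f(t)$ be given by $\partial_t\eta=u\circ\eta$ and $\partial_tF=f\circ\eta$, and set $q=\lambda(\rho)f$. Then $u$, $q$ and $\rho>0$ are smooth on $(-T,T)\times M$, and there $$u_t+\nabla_uu+\frac1\rho\,\operatorname{grad}\Big(\frac{q^2\varphi(\rho)}{\lambda(\rho)^2}\Big)=0,\qquad q_t+\operatorname{div}(qu)=0 .$$ If moreover the initial velocity of the geodesic is $\big(u_0\circ\eta(0),\ \tfrac{\rho_0}{\lambda(\rho_0)}\circ\eta(0)\big)$ for some vector field $u_0$ on $M$, where $\rho_0=\rho(0)$, then $u(0)=u_0$, for all $t\in(-T,T)$ one has $f=\rho/\lambda(\rho)$, and $u,\rho$ solve the barotropic Euler equations $$u_t+\nabla_uu=-\frac1\rho\operatorname{grad}p(\rho),\qquad \rho_t+\operatorname{div}(\rho u)=0,\qquad p(\rho)=\frac{\rho^2\varphi(\rho)}{\lambda(\rho)^2}.$$ -/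

import Mathlib

open Set MeasureTheory
open scoped Manifold ContDiff

noncomputable section

namespace BarotropicFlow

/-- The model space of an `n`-dimensional manifold. -/
abbrev Model (n : ℕ) := EuclideanSpace ℝ (Fin n)

/-- A smooth Riemannian metric on the `n`-dimensional manifold `M`. -/
abbrev Metric (n : ℕ) (M : Type*) [TopologicalSpace M] [ChartedSpace (Model n) M]
    [IsManifold (𝓡 n) ∞ M] :=
  Bundle.ContMDiffRiemannianMetric (𝓡 n) ∞ (Model n) (fun x : M => TangentSpace (𝓡 n) x)

section Calculus

variable {n : ℕ} {M : Type*} [TopologicalSpace M] [ChartedSpace (Model n) M]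

/-- The coordinate vector `∂ᵢ` of the chart at `x₀`, at the point with coordinates `y`. -/
def coordVec (x₀ : M) (y : Model n) (i : Fin n) :
    TangentSpace (𝓡 n) ((extChartAt (𝓡 n) x₀).symm y) :=
  mfderiv 𝓘(ℝ, Model n) (𝓡 n) (extChartAt (𝓡 n) x₀).symm y (EuclideanSpace.single i (1 : ℝ))

/-- The components, in the chart at `x₀`, of the vector field `u` at the point with
coordinates `y`. -/
def fieldCoord (x₀ : M) (u : ∀ x : M, TangentSpace (𝓡 n) x) (y : Model n) : Model n :=
  mfderiv (𝓡 n) 𝓘(ℝ, Model n) (extChartAt (𝓡 n) x₀) ((extChartAt (𝓡 n) x₀).symm y)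
    (u ((extChartAt (𝓡 n) x₀).symm y))

/-- Partial derivative `∂ᵢ h` of a function on the model space. -/
def pderiv (i : Fin n) (h : Model n → ℝ) (y : Model n) : ℝ :=
  fderiv ℝ h y (EuclideanSpace.single i (1 : ℝ))

/-- The tangent vector at `x` with components `a` in the chart at `x`. (In Mathlib the tangent
space at `x` is a copy of the model space, identified with it through the chart at `x`.) -/
def ofCoord (x : M) (a : Fin n → ℝ) : TangentSpace (𝓡 n) x :=
  (WithLp.toLp 2 a : Model n)

variable [IsManifold (𝓡 n) ∞ M]

/-- The metric coefficients `gᵢⱼ` in the chart at `x₀`, at the point with coordinates `y`. -/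
def gram (g : Metric n M) (x₀ : M) (y : Model n) : Matrix (Fin n) (Fin n) ℝ :=
  Matrix.of fun i j =>
    g.inner ((extChartAt (𝓡 n) x₀).symm y) (coordVec x₀ y i) (coordVec x₀ y j)

/-- The Christoffel symbols `Γᵏᵢⱼ = ½ ∑ₗ gᵏˡ (∂ᵢ gⱼₗ + ∂ⱼ gᵢₗ - ∂ₗ gᵢⱼ)` in the chart at `x₀`. -/
def christoffel (g : Metric n M) (x₀ : M) (k i j : Fin n) (y : Model n) : ℝ :=
  (1 / 2) * ∑ l, (gram g x₀ y)⁻¹ k l *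
    (pderiv i (fun z => gram g x₀ z j l) y + pderiv j (fun z => gram g x₀ z i l) y
      - pderiv l (fun z => gram g x₀ z i j) y)

/-- The gradient of `h : M → ℝ`, with components `∑ⱼ gᵏʲ ∂ⱼ h`. -/
def grad (g : Metric n M) (h : M → ℝ) (x : M) : TangentSpace (𝓡 n) x :=
  let y := extChartAt (𝓡 n) x x
  ofCoord x fun k =>
    ∑ j, (gram g x y)⁻¹ k j * pderiv j (fun z => h ((extChartAt (𝓡 n) x).symm z)) y

/-- The divergence `(1 / √det g) ∑ᵢ ∂ᵢ (√det g · uⁱ)` of the vector field `u`. -/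
def div (g : Metric n M) (u : ∀ x : M, TangentSpace (𝓡 n) x) (x : M) : ℝ :=
  let y := extChartAt (𝓡 n) x x
  (1 / √(gram g x y).det) *
    ∑ i, pderiv i (fun z => √(gram g x z).det * fieldCoord x u z i) y

/-- The Levi-Civita covariant derivative `∇_u v`, with components
`∑ᵢ uⁱ ∂ᵢ vᵏ + ∑ᵢⱼ Γᵏᵢⱼ uⁱ vʲ`. -/
def covDeriv (g : Metric n M) (u v : ∀ x : M, TangentSpace (𝓡 n) x) (x : M) :
    TangentSpace (𝓡 n) x :=
  let y := extChartAt (𝓡 n) x x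
  ofCoord x fun k =>
    (∑ i, fieldCoord x u y i * pderiv i (fun z => fieldCoord x v z k) y) +
      ∑ i, ∑ j, christoffel g x k i j y * fieldCoord x u y i * fieldCoord x v y j

/-- The measure `√det g dy` of the chart at `x₀`, transported to the domain of that chart. -/
def chartVolume [MeasurableSpace M] (g : Metric n M) (x₀ : M) : Measure M :=
  ((volume.restrict (extChartAt (𝓡 n) x₀).target).withDensity
    (fun y => ENNReal.ofReal √(gram g x₀ y).det)).map (extChartAt (𝓡 n) x₀).symm

/-- The Riemannian measure `μ`. The measures of two charts agree on the overlap of their domains,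
so their supremum is the measure that restricts to `√det g dy` on each chart domain. -/
def riemannianVolume [MeasurableSpace M] (g : Metric n M) : Measure M :=
  ⨆ x₀ : M, chartVolume g x₀

end Calculus

/-- A volume form on the `n`-dimensional manifold `N`: a smooth nowhere vanishing `n`-form. -/
structure VolumeForm (n : ℕ) (N : Type*) [TopologicalSpace N] [ChartedSpace (Model n) N] where
  form : ∀ p : N, TangentSpace (𝓡 n) p [⋀^Fin n]→ₗ[ℝ] ℝ
  smooth : ∀ p₀ : N, ContDiffOn ℝ ∞
    (fun y : Model n => form ((extChartAt (𝓡 n) p₀).symm y) (fun i => coordVec p₀ y i))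
    (extChartAt (𝓡 n) p₀).target
  ne_zero : ∀ p, form p ≠ 0

section Configurations

variable {n : ℕ}
  {N : Type*} [TopologicalSpace N] [ChartedSpace (Model n) N]
  {M : Type*} [TopologicalSpace M] [ChartedSpace (Model n) M]

/-- The Eulerian velocity `u` of a curve `η` of diffeomorphisms: `∂η/∂t (t, p) = u (t, η (t, p))`
(see `eulerVelocity_apply`). -/
def eulerVelocity (η : ℝ → N ≃ₘ⟮𝓡 n, 𝓡 n⟯ M) (t : ℝ) (x : M) : TangentSpace (𝓡 n) x :=
  (η t).apply_symm_apply x ▸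
    (mfderiv 𝓘(ℝ, ℝ) (𝓡 n) (fun τ => η τ ((η t).symm x)) t (1 : ℝ) :
      TangentSpace (𝓡 n) (η t ((η t).symm x)))

theorem eulerVelocity_apply (η : ℝ → N ≃ₘ⟮𝓡 n, 𝓡 n⟯ M) (t : ℝ) (p : N) :
    eulerVelocity η t (η t p) = mfderiv 𝓘(ℝ, ℝ) (𝓡 n) (fun τ => η τ p) t (1 : ℝ) := by
  have key : ∀ (p' : N) (_ : p' = p) (h : η t p' = η t p),
      (h ▸ (mfderiv 𝓘(ℝ, ℝ) (𝓡 n) (fun τ => η τ p') t (1 : ℝ) :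
        TangentSpace (𝓡 n) (η t p')) : TangentSpace (𝓡 n) (η t p))
      = mfderiv 𝓘(ℝ, ℝ) (𝓡 n) (fun τ => η τ p) t (1 : ℝ) := by
    intro p' hp h
    subst hp
    rfl
  exact key _ ((η t).symm_apply_apply p) _

/-- The function `f` with `∂F/∂t (t, p) = f (t, η (t, p))`. -/
def eulerRate (η : ℝ → N ≃ₘ⟮𝓡 n, 𝓡 n⟯ M) (F : ℝ → C^∞⟮𝓡 n, N; 𝓘(ℝ, ℝ), ℝ⟯) (t : ℝ) (x : M) :
    ℝ :=
  deriv (fun τ => F τ ((η t).symm x)) t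

variable [IsManifold (𝓡 n) ∞ M]

/-- The density `ρ` of `Φ : N → M`, defined by `(ρ ∘ Φ) Φ^*μ = ν`: at `x = Φ p` it is the quotient
of `ν` and of the Riemannian volume of the image under `dΦ`, both evaluated on the same frame of
`T_pN`. The Riemannian volume of `v₁, …, vₙ` is `√det ⟨vᵢ, vⱼ⟩`; the absolute value means that `M`
carries the orientation for which `Φ` preserves orientation. -/
def density (g : Metric n M) (ν : VolumeForm n N) (Φ : N ≃ₘ⟮𝓡 n, 𝓡 n⟯ M) (x : M) : ℝ :=
  let p := Φ.symm x
  let e : Fin n → TangentSpace (𝓡 n) p := fun i => ofCoord p (Pi.single i 1)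
  |ν.form p e| /
    √(Matrix.of fun i j : Fin n =>
      g.inner (Φ p) (mfderiv (𝓡 n) (𝓡 n) Φ p (e i)) (mfderiv (𝓡 n) (𝓡 n) Φ p (e j))).det

variable [MeasurableSpace M]

/-- The Riemannian metric
`⟪(u ∘ Φ, f ∘ Φ), (v ∘ Φ, h ∘ Φ)⟫ = ∫_M (lam(ρ) f h + ρ ⟨u, v⟩) dμ`
at a configuration whose first component is `Φ`; it does not depend on the second one. -/
def configMetric (g : Metric n M) (ν : VolumeForm n N) (lam : ℝ → ℝ) (Φ : N ≃ₘ⟮𝓡 n, 𝓡 n⟯ M)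
    (u : ∀ x : M, TangentSpace (𝓡 n) x) (f : M → ℝ)
    (v : ∀ x : M, TangentSpace (𝓡 n) x) (h : M → ℝ) : ℝ :=
  ∫ x, (lam (density g ν Φ x) * (f x * h x) + density g ν Φ x * g.inner x (u x) (v x))
    ∂(riemannianVolume g)

/-- The energy `½ ∫_a^b ⟪γ', γ'⟫ dt` of the curve `γ = (η, F)`. -/
def energy (g : Metric n M) (ν : VolumeForm n N) (lam : ℝ → ℝ)
    (η : ℝ → N ≃ₘ⟮𝓡 n, 𝓡 n⟯ M) (F : ℝ → C^∞⟮𝓡 n, N; 𝓘(ℝ, ℝ), ℝ⟯) (a b : ℝ) : ℝ :=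
  (1 / 2) * ∫ t in a..b, configMetric g ν lam (η t)
    (eulerVelocity η t) (eulerRate η F t) (eulerVelocity η t) (eulerRate η F t)

/-- `(H, K)` is a smooth variation, over the open time interval `J` and with parameter
`s ∈ (-ε, ε)`, of the curve `(η, F)`, with the end points at times `a` and `b` held fixed. -/
structure IsProperVariation (η : ℝ → N ≃ₘ⟮𝓡 n, 𝓡 n⟯ M) (F : ℝ → C^∞⟮𝓡 n, N; 𝓘(ℝ, ℝ), ℝ⟯)
    (J : Set ℝ) (a b ε : ℝ)
    (H : ℝ → ℝ → N ≃ₘ⟮𝓡 n, 𝓡 n⟯ M) (K : ℝ → ℝ → C^∞⟮𝓡 n, N; 𝓘(ℝ, ℝ), ℝ⟯) : Prop where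
  smooth_fst : ContMDiffOn (𝓘(ℝ, ℝ).prod (𝓘(ℝ, ℝ).prod (𝓡 n))) (𝓡 n) ∞
    (fun z : ℝ × ℝ × N => H z.1 z.2.1 z.2.2) (Ioo (-ε) ε ×ˢ J ×ˢ univ)
  smooth_snd : ContMDiffOn (𝓘(ℝ, ℝ).prod (𝓘(ℝ, ℝ).prod (𝓡 n))) 𝓘(ℝ, ℝ) ∞
    (fun z : ℝ × ℝ × N => K z.1 z.2.1 z.2.2) (Ioo (-ε) ε ×ˢ J ×ˢ univ)
  base : ∀ t ∈ J, H 0 t = η t ∧ K 0 t = F t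
  left : ∀ s ∈ Ioo (-ε) ε, H s a = η a ∧ K s a = F a
  right : ∀ s ∈ Ioo (-ε) ε, H s b = η b ∧ K s b = F b

/-- The curve `(η, F)` in `C^∞(N, M × ℝ)`, running through pairs whose first component is a
diffeomorphism, is a geodesic on the open interval `J`: it is smooth, and on every compact
subinterval it is a critical point of the energy under variations with fixed end points. (The
diffeomorphisms form an open subset of `C^∞(N, M)`, so it suffices to vary within it. Values
of `η` and `F` at times outside `J` play no role.) -/
structure IsGeodesicOn (g : Metric n M) (ν : VolumeForm n N) (lam : ℝ → ℝ)
    (η : ℝ → N ≃ₘ⟮𝓡 n, 𝓡 n⟯ M) (F : ℝ → C^∞⟮𝓡 n, N; 𝓘(ℝ, ℝ), ℝ⟯) (J : Set ℝ) : Prop where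
  smooth_fst : ContMDiffOn (𝓘(ℝ, ℝ).prod (𝓡 n)) (𝓡 n) ∞
    (fun z : ℝ × N => η z.1 z.2) (J ×ˢ univ)
  smooth_snd : ContMDiffOn (𝓘(ℝ, ℝ).prod (𝓡 n)) 𝓘(ℝ, ℝ) ∞
    (fun z : ℝ × N => F z.1 z.2) (J ×ˢ univ)
  critical : ∀ a b : ℝ, a < b → Icc a b ⊆ J → ∀ ε > 0,
    ∀ (H : ℝ → ℝ → N ≃ₘ⟮𝓡 n, 𝓡 n⟯ M) (K : ℝ → ℝ → C^∞⟮𝓡 n, N; 𝓘(ℝ, ℝ), ℝ⟯),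
      IsProperVariation η F J a b ε H K →
        HasDerivAt (fun s => energy g ν lam (H s) (K s) a b) 0 0

end Configurations

/-- The function `φ(r) = ½ (lam(r) - r lam'(r))`. -/
def phi (lam : ℝ → ℝ) (r : ℝ) : ℝ := (1 / 2) * (lam r - r * deriv lam r)

/-- The pressure `p(r) = r² φ(r) / lam(r)²`. -/
def pressure (lam : ℝ → ℝ) (r : ℝ) : ℝ := r ^ 2 * phi lam r / lam r ^ 2

end BarotropicFlow

end

/-! The geodesic equation is the Euler-Lagrange equation of the energy, obtained by testing
criticality with variations supported in a single chart. After `η` the chart displacement `y ↦ y + s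
χ₁(t, y) v` is applied, and `F` is shifted by `s χ₂(t, η)`. For small `s` the displacement is a
diffeomorphism of the model space (`exists_equiv_add_smul`) that extends to `M` by the identity, so
these are admissible variations through diffeomorphisms (`exists_variation`).

The energy of the varied curve is pulled back to the original configuration by the displacement. The
mass `m = ρ √det g` per coordinate volume is then independent of `s`. The kinetic term keeps the
weight `m`, and the other term becomes `λ(m/w) w (f + s Dχ₂)²`, where `w` is the displaced volume
and `D` the material derivative. Since `d/dw (λ(m/w) w) = λ(ρ) - ρ λ'(ρ) = 2 φ(ρ)`, the function `φ`
appears as a pressure coefficient (`hasDerivAt_pulledEnergy`). Criticality and differentiation under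
the integral give the weak form (`IsGeodesicOn.weak_form`), and the fundamental lemma of the
calculus of variations gives pointwise equations (`eq_sum_fderiv_of_forall_integral_eq_zero`).
Taking `χ₁ = 0` yields conservation of `q = λ(ρ) f`; taking `χ₂ = 0` yields the momentum balance
with pressure `φ(ρ) f² = q² φ(ρ) / λ(ρ)²`.

Conservation of mass holds for every smooth curve of diffeomorphisms: mass times the Jacobian of the
flow is constant, and Jacobi's formula differentiates this relation (`continuity_advective`). It
brings the momentum balance into advective form, and raising an index turns the derivatives of the
metric into Christoffel symbols (`eq_neg_covDeriv_sub_grad`).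

For the last claim, `q` and `ρ` satisfy the same continuity equation, so `q / ρ` is constant along
particle paths (`IsGeodesicOn.hasDerivAt_charge_div_density`). It equals `1` initially, hence
always, and with `q = ρ` the pressure becomes `p(ρ)`. -/

namespace BarotropicFlow

/-! ### Analysis on vector spaces: weak equations, small displacements, Jacobi's formula. -/

section EuclideanAnalysis

open Filter Topology

theorem integrable_mul_of_tsupport_subset {V : Type*} [NormedAddCommGroup V]
    [NormedSpace ℝ V] [MeasurableSpace V] [BorelSpace V] {μ : Measure V}
    [IsFiniteMeasureOnCompacts μ] {U : Set V} {h k : V → ℝ}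
    (hh : Continuous h) (hc : HasCompactSupport h) (hs : tsupport h ⊆ U)
    (hk : ContinuousOn k U) : Integrable (fun x => h x * k x) μ := by
  rw [← integrableOn_iff_integrable_of_support_subset (s := tsupport h)]
  · exact (hh.continuousOn.mul (hk.mono hs)).integrableOn_compact hc
  · intro x hx
    apply subset_tsupport h
    simp only [Function.mem_support] at hx ⊢
    exact left_ne_zero_of_mul hx

/-- The strong form of a weak divergence equation on an open set. -/
theorem eq_sum_fderiv_of_forall_integral_eq_zero {V : Type*} [NormedAddCommGroup V]
    [NormedSpace ℝ V] [FiniteDimensional ℝ V] [MeasurableSpace V] [BorelSpace V] {μ : Measure V}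
    [μ.IsAddHaarMeasure] {U : Set V} (hU : IsOpen U) {ι : Type*} [Fintype ι]
    {A : V → ℝ} {B : ι → V → ℝ} {v : ι → V}
    (hA : ContinuousOn A U) (hB : ∀ a, ContDiffOn ℝ 1 (B a) U)
    (h : ∀ χ : V → ℝ, ContDiff ℝ ∞ χ → HasCompactSupport χ → tsupport χ ⊆ U →
      ∫ x, (χ x * A x + ∑ a, fderiv ℝ χ x (v a) * B a x) ∂μ = 0) :
    ∀ x ∈ U, A x = ∑ a, fderiv ℝ (B a) x (v a) := by
  have hdB : ∀ a, ContinuousOn (fun x => fderiv ℝ (B a) x (v a)) U := fun a =>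
    ((hB a).continuousOn_fderiv_of_isOpen hU le_rfl).clm_apply continuousOn_const
  set R : V → ℝ := fun x => A x - ∑ a, fderiv ℝ (B a) x (v a) with hR
  have hRc : ContinuousOn R U := hA.sub (continuousOn_finsetSum _ fun a _ => hdB a)
  have key : ∀ χ : V → ℝ, ContDiff ℝ ∞ χ → HasCompactSupport χ → tsupport χ ⊆ U →
      ∫ x, χ x • R x ∂μ = 0 := by
    intro χ hχ hc hs
    have hd : ∀ a, Continuous (fun x => fderiv ℝ χ x (v a)) := fun a =>
      (hχ.continuous_fderiv (by simp)).clm_apply continuous_const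
    have hdc : ∀ a, HasCompactSupport (fun x => fderiv ℝ χ x (v a)) := fun a =>
      hc.fderiv_apply (𝕜 := ℝ) (v a)
    have hds : ∀ a, tsupport (fun x => fderiv ℝ χ x (v a)) ⊆ U := fun a =>
      (tsupport_fderiv_apply_subset ℝ (v a)).trans hs
    have i1 := integrable_mul_of_tsupport_subset (μ := μ) hχ.continuous hc hs hA
    have i2 : ∀ a, Integrable (fun x => fderiv ℝ χ x (v a) * B a x) μ := fun a =>
      integrable_mul_of_tsupport_subset (hd a) (hdc a) (hds a) (hB a).continuousOn
    have i3 : ∀ a, Integrable (fun x => χ x * fderiv ℝ (B a) x (v a)) μ := fun a =>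
      integrable_mul_of_tsupport_subset hχ.continuous hc hs (hdB a)
    have i4 : ∀ a, Integrable (fun x => χ x * B a x) μ := fun a =>
      integrable_mul_of_tsupport_subset hχ.continuous hc hs (hB a).continuousOn
    -- Integration by parts over the whole space needs differentiability of `B a` only on the
    -- support of `χ`, so nothing is required of `B a` outside `U`.
    have ibp : ∀ a, ∫ x, χ x * fderiv ℝ (B a) x (v a) ∂μ
        = - ∫ x, fderiv ℝ χ x (v a) * B a x ∂μ := fun a =>
      integral_mul_fderiv_eq_neg_fderiv_mul_of_integrable (i2 a) (i3 a) (i4 a)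
        (fun x _ => (hχ.differentiable (by simp)) x)
        (fun x hx => ((hB a).differentiableOn (by simp) x (hs hx)).differentiableAt
          (hU.mem_nhds (hs hx)))
    have h0 := h χ hχ hc hs
    rw [integral_add i1 (integrable_finsetSum _ fun a _ => i2 a),
      integral_finsetSum _ fun a _ => i2 a] at h0
    have : ∀ x, χ x • R x = χ x * A x - ∑ a, χ x * fderiv ℝ (B a) x (v a) := by
      intro x; simp [hR, mul_sub, Finset.mul_sum]
    simp_rw [this]
    rw [integral_sub i1 (integrable_finsetSum _ fun a _ => i3 a),
      integral_finsetSum _ fun a _ => i3 a]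
    simp_rw [ibp]
    rw [Finset.sum_neg_distrib]
    linarith
  -- The fundamental lemma gives vanishing almost everywhere; continuity of `R` makes this hold
  -- everywhere, since Haar measure charges nonempty open sets.
  have hae := hU.ae_eq_zero_of_integral_contDiff_smul_eq_zero
    (hRc.locallyIntegrableOn hU.measurableSet) key
  have := Measure.eqOn_open_of_ae_eq (μ := μ) (f := R) (g := fun _ => 0)
    ((ae_restrict_iff' hU.measurableSet).2 hae) hU hRc continuousOn_const
  intro x hx
  have := this hx
  simp only [hR] at this
  linarith

/-- Differentiation under the integral sign for a family with uniform compact support. -/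
theorem hasDerivAt_integral_of_contDiffOn {Z : Type*} [NormedAddCommGroup Z] [NormedSpace ℝ Z]
    [FiniteDimensional ℝ Z] [MeasurableSpace Z] [BorelSpace Z] {μ : Measure Z}
    [IsFiniteMeasureOnCompacts μ] {ε : ℝ} (hε : 0 < ε) {D : ℝ → Z → ℝ} {K : Set Z}
    (hK : IsCompact K)
    (hD : ContDiffOn ℝ 1 (fun q : ℝ × Z => D q.1 q.2) (Ioo (-ε) ε ×ˢ univ))
    (hz : ∀ s, ∀ z ∉ K, D s z = 0) :
    HasDerivAt (fun s => ∫ z, D s z ∂μ) (∫ z, deriv (fun s => D s z) 0 ∂μ) 0 := by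
  have ho : IsOpen (Ioo (-ε) ε ×ˢ (univ : Set Z)) := isOpen_Ioo.prod isOpen_univ
  set F' : ℝ → Z → ℝ := fun s z => fderiv ℝ (fun q : ℝ × Z => D q.1 q.2) (s, z) (1, 0)
  have hF'c : ContinuousOn (fun q : ℝ × Z => F' q.1 q.2) (Ioo (-ε) ε ×ˢ univ) :=
    (hD.continuousOn_fderiv_of_isOpen ho le_rfl).clm_apply continuousOn_const
  have hder : ∀ s ∈ Ioo (-ε) ε, ∀ z, HasDerivAt (fun s => D s z) (F' s z) s := by
    intro s hs z
    have h1 := ((hD.differentiableOn (by simp) (s, z) ⟨hs, mem_univ _⟩).differentiableAt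
      (ho.mem_nhds ⟨hs, mem_univ _⟩)).hasFDerivAt
    have h2 : HasDerivAt (fun s : ℝ => (s, z)) ((1 : ℝ), (0 : Z)) s :=
      (hasDerivAt_id s).prodMk (hasDerivAt_const s z)
    exact h1.comp_hasDerivAt s h2
  have hcs : ∀ s ∈ Ioo (-ε) ε, Continuous (D s) := fun s hs =>
    hD.continuousOn.comp_continuous (f := fun z => (s, z)) (by fun_prop) fun z => ⟨hs, mem_univ _⟩
  have hcs' : ∀ s ∈ Ioo (-ε) ε, Continuous (F' s) := fun s hs =>
    hF'c.comp_continuous (f := fun z => (s, z)) (by fun_prop) fun z => ⟨hs, mem_univ _⟩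
  have h0 : (0 : ℝ) ∈ Ioo (-ε) ε := ⟨by linarith, hε⟩
  have hz' : ∀ s ∈ Ioo (-ε) ε, ∀ z ∉ K, F' s z = 0 := by
    intro s hs z hzK
    rw [← (hder s hs z).deriv]
    have : (fun s => D s z) = fun _ => 0 := funext fun s => hz s z hzK
    rw [this]; simp
  have hsub : Icc (-(ε / 2)) (ε / 2) ⊆ Ioo (-ε) ε := fun x hx =>
    ⟨by linarith [hx.1], by linarith [hx.2]⟩
  obtain ⟨C, hC⟩ := (isCompact_Icc.prod hK).exists_bound_of_continuousOn
    (hF'c.mono (prod_mono hsub (subset_univ K)))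
  have hnhds : Icc (-(ε / 2)) (ε / 2) ∈ 𝓝 (0 : ℝ) := Icc_mem_nhds (by linarith) (by linarith)
  have := hasDerivAt_integral_of_dominated_loc_of_deriv_le (μ := μ) (F := D) (F' := F') (x₀ := 0)
    (bound := K.indicator fun _ => C) hnhds
    (by filter_upwards [isOpen_Ioo.mem_nhds h0] with s hs
        exact (hcs s hs).aestronglyMeasurable)
    ((hcs 0 h0).integrable_of_hasCompactSupport (HasCompactSupport.intro hK fun z hz' => hz 0 z hz'))
    (hcs' 0 h0).aestronglyMeasurable
    (Eventually.of_forall fun z s hs => by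
      by_cases hzK : z ∈ K
      · simpa [hzK] using hC (s, z) ⟨hs, hzK⟩
      · simp [hzK, hz' s (hsub hs) z hzK])
    ((integrable_indicator_iff hK.measurableSet).2
      (integrableOn_const (hs := hK.measure_lt_top.ne)))
    (Eventually.of_forall fun z s hs => hder s (hsub hs) z)
  rw [integral_congr_ae (Eventually.of_forall fun z => (hder 0 h0 z).deriv)]
  exact this.2

/-- The map is a transvection. It occurs as the derivative of a displacement in the fixed direction
`v`, so this is the Jacobian of such a displacement. -/
theorem det_id_add_smulRight {E : Type*} [NormedAddCommGroup E] [NormedSpace ℝ E]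
    [FiniteDimensional ℝ E] (l : E →L[ℝ] ℝ) (v : E) :
    (ContinuousLinearMap.id ℝ E + l.smulRight v).det = 1 + l v := by
  have : ((ContinuousLinearMap.id ℝ E + l.smulRight v : E →L[ℝ] E) : E →ₗ[ℝ] E)
      = LinearMap.transvection (l : E →ₗ[ℝ] ℝ) v := by
    ext w; simp [LinearMap.transvection]
  rw [ContinuousLinearMap.det, this, LinearMap.transvection.det]
  rfl

/-- Small compactly supported displacements of a vector space in a fixed direction are
diffeomorphisms. -/
theorem exists_equiv_add_smul {E : Type*} [NormedAddCommGroup E] [NormedSpace ℝ E]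
    [FiniteDimensional ℝ E] {χ : ℝ × E → ℝ} (hχ : ContDiff ℝ ∞ χ) (hc : HasCompactSupport χ)
    (v : E) : ∃ ε > 0, ∀ s ∈ Ioo (-ε) ε, ∀ t,
      (∀ y, 0 < 1 + s * fderiv ℝ χ (t, y) (0, v)) ∧
      ∃ e : E ≃ E, (∀ y, e y = y + (s * χ (t, y)) • v) ∧ ContDiff ℝ ∞ e ∧
        ContDiff ℝ ∞ e.symm := by
  obtain ⟨C, hC⟩ := hχ.lipschitzWith_of_hasCompactSupport hc (by simp)
  obtain ⟨C', hC'⟩ := (hc.fderiv_apply (𝕜 := ℝ) ((0 : ℝ), v)).exists_bound_of_continuous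
    ((hχ.continuous_fderiv (by simp)).clm_apply continuous_const)
  -- `L` dominates both the Lipschitz constant of `y ↦ χ (t, y) • v` and the derivative of `χ` along
  -- `v`, uniformly in `t`; the summand `1` keeps it positive. Then `|s| L < 1` gives invertibility
  -- and positivity of the Jacobian at once.
  set L : ℝ := C * ‖v‖ + |C'| + 1 with hL
  have hLpos : 0 < L := by positivity
  refine ⟨1 / (2 * L), by positivity, fun s hs t => ?_⟩
  have hsL : |s| * L < 1 := by
    have h1 : |s| < 1 / (2 * L) := abs_lt.2 hs
    calc |s| * L < 1 / (2 * L) * L := by gcongr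
      _ = 1 / 2 := by field_simp
      _ < 1 := by norm_num
  have hpos : ∀ y, 0 < 1 + s * fderiv ℝ χ (t, y) (0, v) := by
    intro y
    have h1 : |s * fderiv ℝ χ (t, y) (0, v)| < 1 := by
      rw [abs_mul]
      refine lt_of_le_of_lt ?_ hsL
      gcongr
      have := hC' (t, y)
      rw [Real.norm_eq_abs] at this
      have h3 : 0 ≤ C * ‖v‖ := by positivity
      linarith [le_abs_self C']
    linarith [(abs_lt.1 h1).1]
  refine ⟨hpos, ?_⟩
  set G : E → E := fun y => y + (s * χ (t, y)) • v with hG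
  have hGs : ContDiff ℝ ∞ G := by
    have : ContDiff ℝ ∞ fun y : E => χ (t, y) := hχ.comp (contDiff_const.prodMk contDiff_id)
    exact contDiff_id.add ((contDiff_const.mul this).smul contDiff_const)
  set c : NNReal := Real.toNNReal (|s| * (C * ‖v‖)) with hcdef
  -- `G` differs from the identity by a map of Lipschitz constant less than `1`, hence is a global
  -- homeomorphism. The zero-dimensional space is treated apart because the identity has norm `0`
  -- there.
  have happ : ApproximatesLinearOn G ((ContinuousLinearEquiv.refl ℝ E : E ≃L[ℝ] E) : E →L[ℝ] E)
      univ c := by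
    refine ApproximatesLinearOn.approximatesLinearOn_iff_lipschitzOnWith.2 ?_
    rw [lipschitzOnWith_univ]
    refine LipschitzWith.of_dist_le_mul fun y z => ?_
    have hd := hC.dist_le_mul (t, y) (t, z)
    have e1 : dist (t, y) (t, z) = dist y z := by simp [Prod.dist_eq]
    rw [e1, Real.dist_eq] at hd
    have e2 : (G - ⇑((ContinuousLinearEquiv.refl ℝ E : E ≃L[ℝ] E) : E →L[ℝ] E)) y
        - (G - ⇑((ContinuousLinearEquiv.refl ℝ E : E ≃L[ℝ] E) : E →L[ℝ] E)) z
        = (s * (χ (t, y) - χ (t, z))) • v := by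
      simp [hG]; module
    rw [dist_eq_norm, e2, norm_smul, norm_mul, Real.norm_eq_abs, Real.norm_eq_abs, hcdef,
      Real.coe_toNNReal _ (by positivity)]
    calc |s| * |χ (t, y) - χ (t, z)| * ‖v‖ ≤ |s| * (C * dist y z) * ‖v‖ := by gcongr
      _ = _ := by ring
  have hcN : Subsingleton E ∨
      c < ‖((ContinuousLinearEquiv.refl ℝ E).symm : E →L[ℝ] E)‖₊⁻¹ := by
    rcases subsingleton_or_nontrivial E with h | h
    · exact Or.inl h
    · right
      have : ‖((ContinuousLinearEquiv.refl ℝ E).symm : E →L[ℝ] E)‖₊ = 1 := by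
        ext; simp
      rw [this, inv_one, ← NNReal.coe_lt_coe, hcdef, Real.coe_toNNReal _ (by positivity)]
      refine lt_of_le_of_lt ?_ hsL
      gcongr
      rw [hL]
      have := abs_nonneg C'
      linarith
  set Φ := happ.toHomeomorph G hcN
  have hΦ : ∀ y, Φ y = G y := fun y => rfl
  refine ⟨Φ.toEquiv, fun y => rfl, hGs, ?_⟩
  rw [contDiff_iff_contDiffAt]
  intro y
  have hder : ∀ z, HasFDerivAt G (ContinuousLinearMap.id ℝ E +
      (s • (fderiv ℝ χ (t, z)).comp (ContinuousLinearMap.inr ℝ ℝ E)).smulRight v) z := by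
    intro z
    have h1 : HasFDerivAt (fun y : E => χ (t, y))
        ((fderiv ℝ χ (t, z)).comp (ContinuousLinearMap.inr ℝ ℝ E)) z :=
      ((hχ.differentiable (by simp)) (t, z)).hasFDerivAt.comp z (hasFDerivAt_prodMk_right t z)
    exact (hasFDerivAt_id z).add ((h1.const_mul s).smul_const v)
  have hdet : ∀ z, (ContinuousLinearMap.id ℝ E +
      (s • (fderiv ℝ χ (t, z)).comp (ContinuousLinearMap.inr ℝ ℝ E)).smulRight v).det ≠ 0 := by
    intro z
    rw [det_id_add_smulRight]
    simpa using (hpos z).ne'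
  exact Φ.toOpenPartialHomeomorph.contDiffAt_symm (f₀' :=
    ContinuousLinearMap.toContinuousLinearEquivOfDetNeZero _ (hdet (Φ.symm y))) (mem_univ y)
    (hder (Φ.symm y)) hGs.contDiffAt

/-- Jacobi's formula for the derivative of the determinant at the identity matrix. -/
theorem hasDerivAt_det_of_eq_one {ι : Type*} [Fintype ι] [DecidableEq ι]
    {A : ℝ → Matrix ι ι ℝ} {A' : Matrix ι ι ℝ} {t : ℝ}
    (hA : ∀ i j, HasDerivAt (fun τ => A τ i j) (A' i j) t) (h1 : A t = 1) :
    HasDerivAt (fun τ => (A τ).det) A'.trace t := by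
  set f : (ι → ι → ℝ) → ℝ := fun B => (Matrix.of B).det with hf
  have hfd : Differentiable ℝ f := by
    have : f = fun B => ∑ σ : Equiv.Perm ι, ((Equiv.Perm.sign σ : ℤ) : ℝ) * ∏ i, B (σ i) i := by
      ext B; simp [hf, Matrix.det_apply']
    rw [this]
    fun_prop
  have key : ∀ {B : ℝ → ι → ι → ℝ} {B' : ι → ι → ℝ} {r : ℝ}, HasDerivAt B B' r →
      HasDerivAt (fun τ => f (B τ)) (fderiv ℝ f (B r) B') r := fun h =>
    (hfd _).hasFDerivAt.comp_hasDerivAt _ h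
  have hA1 : HasDerivAt (fun τ => (fun i j => A τ i j : ι → ι → ℝ)) (fun i j => A' i j) t :=
    hasDerivAt_pi.2 fun i => hasDerivAt_pi.2 fun j => hA i j
  have e1 := key hA1
  -- The derivative of the determinant at `1` depends only on the direction `A'`, so it may be
  -- computed along the line `1 + r A'`, where the determinant is a polynomial in `r` with linear
  -- part `1 + r tr A'`.
  have hL : HasDerivAt (fun r : ℝ => (fun i j => (1 : Matrix ι ι ℝ) i j + r * A' i j :
      ι → ι → ℝ)) (fun i j => A' i j) 0 :=
    hasDerivAt_pi.2 fun i => hasDerivAt_pi.2 fun j => by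
      simpa using ((hasDerivAt_id (0 : ℝ)).mul_const (A' i j)).const_add ((1 : Matrix ι ι ℝ) i j)
  have e2 := key hL
  have e3 : HasDerivAt (fun r : ℝ => f (fun i j => (1 : Matrix ι ι ℝ) i j + r * A' i j))
      A'.trace 0 := by
    have : (fun r : ℝ => f (fun i j => (1 : Matrix ι ι ℝ) i j + r * A' i j)) = fun r =>
        1 + A'.trace * r + (Matrix.det (1 + (Polynomial.X : Polynomial ℝ) •
          A'.map Polynomial.C)).divX.divX.eval r * r ^ 2 := by
      ext r
      rw [← Matrix.det_one_add_smul]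
      rfl
    rw [this]
    have h2 := ((Matrix.det (1 + (Polynomial.X : Polynomial ℝ) •
          A'.map Polynomial.C)).divX.divX.hasDerivAt 0).mul (hasDerivAt_pow 2 (0 : ℝ))
    have h3 := (((hasDerivAt_id (0 : ℝ)).const_mul A'.trace).const_add 1).add h2
    have e : A'.trace * 1 + ((Matrix.det (1 + (Polynomial.X : Polynomial ℝ) •
          A'.map Polynomial.C)).divX.divX.derivative.eval 0 * 0 ^ 2 +
          (Matrix.det (1 + (Polynomial.X : Polynomial ℝ) •
          A'.map Polynomial.C)).divX.divX.eval 0 * (((2 : ℕ) : ℝ) * 0 ^ (2 - 1))) = A'.trace := by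
      simp
    rw [e] at h3
    exact h3
  have e4 := e2.unique e3
  have e5 : (fun i j => (1 : Matrix ι ι ℝ) i j + 0 * A' i j) = fun i j => A t i j := by
    ext i j; simp [h1]
  rw [e5] at e4
  rw [e4] at e1
  exact e1

end EuclideanAnalysis

end BarotropicFlow

/-! ### Coordinate frames, metric coefficients and transition maps. -/

namespace BarotropicFlow

section Charts

variable {n : ℕ} {M : Type*} [TopologicalSpace M] [ChartedSpace (Model n) M]

/-- The derivative at `x` of the chart at `x₀`. -/
noncomputable def chartDeriv (x₀ x : M) : TangentSpace (𝓡 n) x →L[ℝ] Model n :=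
  mfderiv (𝓡 n) 𝓘(ℝ, Model n) (extChartAt (𝓡 n) x₀) x

/-- The derivative at `y` of the inverse of the chart at `x₀`. -/
noncomputable def chartSymmDeriv (x₀ : M) (y : Model n) :
    Model n →L[ℝ] TangentSpace (𝓡 n) ((extChartAt (𝓡 n) x₀).symm y) :=
  mfderiv 𝓘(ℝ, Model n) (𝓡 n) (extChartAt (𝓡 n) x₀).symm y

theorem coordVec_eq (x₀ : M) (y : Model n) (i : Fin n) :
    coordVec x₀ y i = chartSymmDeriv x₀ y (EuclideanSpace.single i 1) := rfl

theorem fieldCoord_eq (x₀ : M) (u : ∀ x : M, TangentSpace (𝓡 n) x) (y : Model n) :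
    fieldCoord x₀ u y = chartDeriv x₀ ((extChartAt (𝓡 n) x₀).symm y)
      (u ((extChartAt (𝓡 n) x₀).symm y)) := rfl

theorem fieldCoord_extChartAt {x₀ x : M} (hx : x ∈ (extChartAt (𝓡 n) x₀).source)
    (u : ∀ x : M, TangentSpace (𝓡 n) x) :
    fieldCoord x₀ u (extChartAt (𝓡 n) x₀ x) = chartDeriv x₀ x (u x) := by
  rw [fieldCoord_eq, (extChartAt (𝓡 n) x₀).left_inv hx]

variable [IsManifold (𝓡 n) ∞ M]

theorem chartDeriv_self (x : M) (v : TangentSpace (𝓡 n) x) : chartDeriv x x v = v := by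
  rw [chartDeriv, mfderiv_extChartAt_self]; rfl

theorem chartDeriv_chartSymmDeriv {x₀ : M} {y : Model n}
    (hy : y ∈ (extChartAt (𝓡 n) x₀).target) (v : Model n) :
    chartDeriv x₀ ((extChartAt (𝓡 n) x₀).symm y) (chartSymmDeriv x₀ y v) = v := by
  have h := mfderiv_extChartAt_comp_mfderivWithin_extChartAt_symm (I := 𝓡 n) hy
  rw [ModelWithCorners.range_eq_univ, mfderivWithin_univ] at h
  exact congrArg (fun L : Model n →L[ℝ] Model n => L v) h

theorem chartSymmDeriv_chartDeriv {x₀ : M} {y : Model n}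
    (hy : y ∈ (extChartAt (𝓡 n) x₀).target)
    (v : TangentSpace (𝓡 n) ((extChartAt (𝓡 n) x₀).symm y)) :
    chartSymmDeriv x₀ y (chartDeriv x₀ ((extChartAt (𝓡 n) x₀).symm y) v) = v := by
  have h := mfderivWithin_extChartAt_symm_comp_mfderiv_extChartAt (I := 𝓡 n) hy
  rw [ModelWithCorners.range_eq_univ, mfderivWithin_univ] at h
  exact congrArg (fun L : TangentSpace (𝓡 n) ((extChartAt (𝓡 n) x₀).symm y) →L[ℝ]
    TangentSpace (𝓡 n) ((extChartAt (𝓡 n) x₀).symm y) => L v) h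

theorem chartDeriv_injective {x₀ x : M} (hx : x ∈ (extChartAt (𝓡 n) x₀).source) :
    Function.Injective (chartDeriv (n := n) x₀ x) := by
  obtain ⟨y, hy, rfl⟩ : ∃ y ∈ (extChartAt (𝓡 n) x₀).target, (extChartAt (𝓡 n) x₀).symm y = x :=
    ⟨_, (extChartAt (𝓡 n) x₀).map_source hx, (extChartAt (𝓡 n) x₀).left_inv hx⟩
  exact Function.LeftInverse.injective (chartSymmDeriv_chartDeriv hy)

theorem model_sum_single (v : Model n) :
    v = ∑ i, v i • (EuclideanSpace.single i (1 : ℝ) : Model n) := by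
  ext j; simp [Finset.sum_apply, Pi.single_apply]

theorem inner_eq_sum (g : Metric n M) {x₀ x : M} (hx : x ∈ (extChartAt (𝓡 n) x₀).source)
    (v w : TangentSpace (𝓡 n) x) :
    g.inner x v w = ∑ i, ∑ j, gram g x₀ (extChartAt (𝓡 n) x₀ x) i j *
      (chartDeriv x₀ x v) i * (chartDeriv x₀ x w) j := by
  obtain ⟨y, hy, rfl⟩ : ∃ y ∈ (extChartAt (𝓡 n) x₀).target, (extChartAt (𝓡 n) x₀).symm y = x :=
    ⟨_, (extChartAt (𝓡 n) x₀).map_source hx, (extChartAt (𝓡 n) x₀).left_inv hx⟩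
  rw [(extChartAt (𝓡 n) x₀).right_inv hy]
  have key : ∀ v : TangentSpace (𝓡 n) ((extChartAt (𝓡 n) x₀).symm y),
      v = ∑ i, (chartDeriv x₀ ((extChartAt (𝓡 n) x₀).symm y) v) i • coordVec x₀ y i := by
    intro v
    conv_lhs => rw [← chartSymmDeriv_chartDeriv hy v, model_sum_single (chartDeriv x₀ _ v),
      map_sum]
    exact Finset.sum_congr rfl fun i _ => by rw [map_smul, coordVec_eq]
  conv_lhs => rw [key v, key w]
  simp only [map_sum, map_smul, FunLike.coe_sum, FunLike.coe_smul, Finset.sum_apply,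
    Pi.smul_apply, smul_eq_mul, gram, Matrix.of_apply, Finset.mul_sum]
  rw [Finset.sum_comm]
  exact Finset.sum_congr rfl fun i _ => Finset.sum_congr rfl fun j _ => by ring

theorem gram_symm (g : Metric n M) (x₀ : M) (y : Model n) (i j : Fin n) :
    gram g x₀ y i j = gram g x₀ y j i := g.symm _ _ _

theorem gram_posDef (g : Metric n M) {x₀ : M} {y : Model n}
    (hy : y ∈ (extChartAt (𝓡 n) x₀).target) : (gram g x₀ y).PosDef := by
  refine Matrix.PosDef.of_dotProduct_mulVec_pos (Matrix.IsHermitian.ext fun i j => by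
    simpa using gram_symm g x₀ y j i) fun a ha => ?_
  set v := chartSymmDeriv x₀ y (WithLp.toLp 2 a) with hv
  have hv0 : v ≠ 0 := by
    intro h0
    have := chartDeriv_chartSymmDeriv hy (WithLp.toLp 2 a)
    rw [← hv, h0, map_zero] at this
    exact ha (by simpa using this.symm)
  have h1 := g.pos _ v hv0
  rw [inner_eq_sum g ((extChartAt (𝓡 n) x₀).map_target hy),
    (extChartAt (𝓡 n) x₀).right_inv hy, hv, chartDeriv_chartSymmDeriv hy] at h1
  convert! h1 using 1
  simp only [dotProduct, Matrix.mulVec, star_trivial, Finset.mul_sum]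
  exact Finset.sum_congr rfl fun i _ => Finset.sum_congr rfl fun j _ => by ring

theorem gram_det_pos (g : Metric n M) {x₀ : M} {y : Model n}
    (hy : y ∈ (extChartAt (𝓡 n) x₀).target) : 0 < (gram g x₀ y).det :=
  (gram_posDef g hy).det_pos

/-- In the trivialization of the tangent bundle over the chart at `x₀` the coordinate frame is
constant. -/
theorem contMDiffOn_coordVec (x₀ : M) (i : Fin n) :
    ContMDiffOn 𝓘(ℝ, Model n) (𝓡 n).tangent ∞
      (fun y => (⟨(extChartAt (𝓡 n) x₀).symm y, coordVec x₀ y i⟩ : TangentBundle (𝓡 n) M))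
      (extChartAt (𝓡 n) x₀).target := by
  have hm : MapsTo (fun y => (⟨(extChartAt (𝓡 n) x₀).symm y, coordVec x₀ y i⟩ :
      TangentBundle (𝓡 n) M)) (extChartAt (𝓡 n) x₀).target
      (trivializationAt (Model n) (TangentSpace (𝓡 n)) x₀).source := by
    intro y hy
    have := (extChartAt (𝓡 n) x₀).map_target hy
    rw [extChartAt_source] at this
    rw [TangentBundle.trivializationAt_source]
    exact this
  rw [Bundle.Trivialization.contMDiffOn_iff hm]
  refine ⟨contMDiffOn_extChartAt_symm x₀, ?_⟩
  refine (contMDiffOn_const (c := (EuclideanSpace.single i (1 : ℝ) : Model n))).congr ?_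
  intro y hy
  have hs : (extChartAt (𝓡 n) x₀).symm y ∈ (chartAt (Model n) x₀).source := by
    have := (extChartAt (𝓡 n) x₀).map_target hy
    rwa [extChartAt_source] at this
  rw [← Bundle.Trivialization.continuousLinearMapAt_apply_of_mem (R := ℝ) _ hs,
    TangentBundle.continuousLinearMapAt_trivializationAt hs]
  exact chartDeriv_chartSymmDeriv hy _

/-- The metric is smooth as a section of a bundle of bilinear forms; pairing it with the smooth
coordinate frame gives a smooth section of the trivial line bundle, whose fibre component is the
coefficient. -/
theorem contDiffOn_gram (g : Metric n M) (x₀ : M) (i j : Fin n) :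
    ContDiffOn ℝ ∞ (fun y => gram g x₀ y i j) (extChartAt (𝓡 n) x₀).target := by
  rw [← contMDiffOn_iff_contDiffOn]
  have h : ContMDiffOn 𝓘(ℝ, Model n) ((𝓡 n).prod 𝓘(ℝ, ℝ)) ∞
      (fun y => Bundle.TotalSpace.mk' ℝ (E := Bundle.Trivial M ℝ) ((extChartAt (𝓡 n) x₀).symm y)
        (g.inner ((extChartAt (𝓡 n) x₀).symm y) (coordVec x₀ y i) (coordVec x₀ y j)))
      (extChartAt (𝓡 n) x₀).target := by
    apply ContMDiffOn.clm_bundle_apply₂ (F₁ := Model n) (F₂ := Model n)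
    · exact g.contMDiff.comp_contMDiffOn (contMDiffOn_extChartAt_symm x₀)
    · exact contMDiffOn_coordVec x₀ i
    · exact contMDiffOn_coordVec x₀ j
  intro y hy
  have := h y hy
  rw [Bundle.contMDiffWithinAt_totalSpace] at this
  exact this.2

theorem contDiffOn_gram_det (g : Metric n M) (x₀ : M) :
    ContDiffOn ℝ ∞ (fun y => (gram g x₀ y).det) (extChartAt (𝓡 n) x₀).target := by
  simp only [Matrix.det_apply']
  refine ContDiffOn.sum fun σ _ => contDiffOn_const.mul (contDiffOn_prod fun i _ => ?_)
  exact contDiffOn_gram g x₀ _ _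

/-- The density `√det g` of the Riemannian volume in the chart at `x₀`. -/
noncomputable def volDensity (g : Metric n M) (x₀ : M) (y : Model n) : ℝ := √(gram g x₀ y).det

theorem volDensity_pos (g : Metric n M) {x₀ : M} {y : Model n}
    (hy : y ∈ (extChartAt (𝓡 n) x₀).target) : 0 < volDensity g x₀ y :=
  Real.sqrt_pos.2 (gram_det_pos g hy)

theorem contDiffOn_volDensity (g : Metric n M) (x₀ : M) :
    ContDiffOn ℝ ∞ (volDensity g x₀) (extChartAt (𝓡 n) x₀).target :=
  (contDiffOn_gram_det g x₀).sqrt fun _ hy => (gram_det_pos g hy).ne'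

/-- The Gram determinant of the images of the standard basis under a linear map to `T_xM`. -/
theorem sqrt_det_inner_eq (g : Metric n M) {x₀ x : M} (hx : x ∈ (extChartAt (𝓡 n) x₀).source)
    (L : Model n →L[ℝ] TangentSpace (𝓡 n) x) :
    √(Matrix.of fun i j : Fin n => g.inner x (L (EuclideanSpace.single i 1))
      (L (EuclideanSpace.single j 1))).det =
      volDensity g x₀ (extChartAt (𝓡 n) x₀ x) * |((chartDeriv x₀ x).comp L).det| := by
  set P : Model n →L[ℝ] Model n := (chartDeriv x₀ x).comp L with hP
  set b := (EuclideanSpace.basisFun (Fin n) ℝ).toBasis with hb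
  set Q : Matrix (Fin n) (Fin n) ℝ := LinearMap.toMatrix b b (P : Model n →ₗ[ℝ] Model n) with hQ
  have hQa : ∀ i j, Q i j = P (EuclideanSpace.single j 1) i := by
    intro i j
    rw [hQ, LinearMap.toMatrix_apply]
    simp [hb]
  have hQd : Q.det = P.det := by rw [hQ, LinearMap.det_toMatrix]
  have : (Matrix.of fun i j : Fin n => g.inner x (L (EuclideanSpace.single i 1))
      (L (EuclideanSpace.single j 1))) = Q.transpose * gram g x₀ (extChartAt (𝓡 n) x₀ x) * Q := by
    ext i j
    rw [Matrix.of_apply, inner_eq_sum g hx, Matrix.mul_apply]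
    simp only [Matrix.mul_apply, Matrix.transpose_apply, Finset.sum_mul, hQa]
    rw [Finset.sum_comm]
    refine Finset.sum_congr rfl fun a _ => Finset.sum_congr rfl fun b _ => ?_
    simp only [hP, ContinuousLinearMap.comp_apply]
    ring
  rw [this, Matrix.det_mul, Matrix.det_mul, Matrix.det_transpose, hQd,
    show P.det * (gram g x₀ (extChartAt (𝓡 n) x₀ x)).det * P.det
      = (gram g x₀ (extChartAt (𝓡 n) x₀ x)).det * P.det ^ 2 by ring,
    Real.sqrt_mul (gram_det_pos g ((extChartAt (𝓡 n) x₀).map_source hx)).le, Real.sqrt_sq_eq_abs]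
  rfl

/-- The transition map between two charts. -/
noncomputable def transition (x₁ x₀ : M) (y : Model n) : Model n :=
  extChartAt (𝓡 n) x₀ ((extChartAt (𝓡 n) x₁).symm y)

theorem hasFDerivAt_transition {x₁ x₀ : M} {y : Model n} (hy : y ∈ (extChartAt (𝓡 n) x₁).target)
    (hy' : (extChartAt (𝓡 n) x₁).symm y ∈ (extChartAt (𝓡 n) x₀).source) :
    HasFDerivAt (transition x₁ x₀) ((chartDeriv x₀ ((extChartAt (𝓡 n) x₁).symm y)).comp
      (chartSymmDeriv x₁ y)) y := by
  have h1 : MDifferentiableAt (𝓡 n) 𝓘(ℝ, Model n) (extChartAt (𝓡 n) x₀)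
      ((extChartAt (𝓡 n) x₁).symm y) := mdifferentiableAt_extChartAt (by
    rwa [extChartAt_source] at hy')
  have h2 : MDifferentiableAt 𝓘(ℝ, Model n) (𝓡 n) (extChartAt (𝓡 n) x₁).symm y := by
    have := mdifferentiableWithinAt_extChartAt_symm (I := 𝓡 n) hy
    rwa [ModelWithCorners.range_eq_univ, mdifferentiableWithinAt_univ] at this
  exact (h1.hasMFDerivAt.comp y h2.hasMFDerivAt).hasFDerivAt

/-- The coordinate frame of the chart at `x₁` is the image of the standard basis under
`chartSymmDeriv x₁ y`, so `sqrt_det_inner_eq` applies. With `hasFDerivAt_transition` this makes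
`√det g dy` independent of the chart. -/
theorem volDensity_transition (g : Metric n M) {x₁ x₀ : M} {y : Model n}
    (hy' : (extChartAt (𝓡 n) x₁).symm y ∈ (extChartAt (𝓡 n) x₀).source) :
    volDensity g x₁ y = volDensity g x₀ (transition x₁ x₀ y) *
      |(show Model n →L[ℝ] Model n from (chartDeriv x₀ ((extChartAt (𝓡 n) x₁).symm y)).comp
        (chartSymmDeriv x₁ y)).det| :=
  sqrt_det_inner_eq g hy' (chartSymmDeriv x₁ y)

end Charts

end BarotropicFlow

/-! ### The Riemannian measure in a chart. -/

namespace BarotropicFlow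

section Volume

open Filter Topology

variable {n : ℕ} {M : Type*} [TopologicalSpace M] [ChartedSpace (Model n) M]

theorem mem_chart_source_iff {x₀ x : M} :
    x ∈ (chartAt (Model n) x₀).source ↔ x ∈ (extChartAt (𝓡 n) x₀).source := by
  rw [extChartAt_source]

theorem isOpen_chart_source (x₀ : M) : IsOpen (extChartAt (𝓡 n) x₀).source :=
  isOpen_extChartAt_source x₀

theorem isOpen_chart_target (x₀ : M) : IsOpen (extChartAt (𝓡 n) x₀).target :=
  isOpen_extChartAt_target x₀

variable [MeasurableSpace M] [BorelSpace M]

theorem measurableSet_chart_preimage (x₀ : M) {A : Set M} (hA : MeasurableSet A) :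
    MeasurableSet ((extChartAt (𝓡 n) x₀).target ∩ (extChartAt (𝓡 n) x₀).symm ⁻¹' A) := by
  have h : Measurable ((extChartAt (𝓡 n) x₀).target.domRestrict (extChartAt (𝓡 n) x₀).symm) :=
    (continuousOn_extChartAt_symm x₀).domRestrict.measurable
  have := (isOpen_chart_target x₀).measurableSet.subtype_image (h hA)
  convert! this using 1
  ext y
  constructor
  · rintro ⟨h1, h2⟩
    exact ⟨⟨y, h1⟩, h2, rfl⟩
  · rintro ⟨⟨z, h1⟩, h2, rfl⟩
    exact ⟨h1, h2⟩

theorem aemeasurable_chart_symm (x₀ : M) {m : Measure (Model n)} :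
    AEMeasurable (extChartAt (𝓡 n) x₀).symm (m.restrict (extChartAt (𝓡 n) x₀).target) :=
  (continuousOn_extChartAt_symm x₀).aemeasurable (isOpen_chart_target x₀).measurableSet

theorem aemeasurable_chart_symm_withDensity (x₀ : M) {h : Model n → ENNReal} :
    AEMeasurable (extChartAt (𝓡 n) x₀).symm
      ((volume.restrict (extChartAt (𝓡 n) x₀).target).withDensity h) :=
  (aemeasurable_chart_symm x₀).mono_ac (withDensity_absolutelyContinuous _ _)

variable [IsManifold (𝓡 n) ∞ M]

theorem chartVolume_apply (g : Metric n M) (x₀ : M) {A : Set M} (hA : MeasurableSet A) :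
    chartVolume g x₀ A =
      ∫⁻ y in (extChartAt (𝓡 n) x₀).target ∩ (extChartAt (𝓡 n) x₀).symm ⁻¹' A,
        ENNReal.ofReal (volDensity g x₀ y) := by
  have hT := (isOpen_chart_target (n := n) x₀).measurableSet
  have hB := measurableSet_chart_preimage (n := n) x₀ hA
  rw [chartVolume, Measure.map_apply_of_aemeasurable (aemeasurable_chart_symm_withDensity x₀) hA]
  have h0 : ((volume.restrict (extChartAt (𝓡 n) x₀).target).withDensity
      (fun y => ENNReal.ofReal √(gram g x₀ y).det)) (extChartAt (𝓡 n) x₀).targetᶜ = 0 := by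
    apply withDensity_absolutelyContinuous
    rw [Measure.restrict_apply hT.compl]
    simp
  rw [← measure_inter_add_sdiff ((extChartAt (𝓡 n) x₀).symm ⁻¹' A) hT,
    measure_mono_null (s := _ \ (extChartAt (𝓡 n) x₀).target) (fun x hx => hx.2) h0, add_zero, inter_comm, withDensity_apply _ hB,
    Measure.restrict_restrict hB, inter_assoc, inter_comm _ (extChartAt (𝓡 n) x₀).target,
    ← inter_assoc, inter_self]
  rfl

theorem chartVolume_compl_source (g : Metric n M) (x₀ : M) :
    chartVolume g x₀ (extChartAt (𝓡 n) x₀).sourceᶜ = 0 := by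
  rw [chartVolume_apply g x₀ (isOpen_chart_source x₀).measurableSet.compl]
  have : (extChartAt (𝓡 n) x₀).target ∩ (extChartAt (𝓡 n) x₀).symm ⁻¹'
      (extChartAt (𝓡 n) x₀).sourceᶜ = ∅ := by
    ext y
    simp only [mem_inter_iff, mem_preimage, mem_compl_iff, mem_empty_iff_false, iff_false, not_and,
      not_not]
    exact fun hy => (extChartAt (𝓡 n) x₀).map_target hy
  rw [this]
  simp

/-- Change of variables by the transition map. Only an inequality holds, because `A` need not lie in
the domain of the chart at `x₁`. -/
theorem chartVolume_le (g : Metric n M) (x₁ x₀ : M) {A : Set M} (hA : MeasurableSet A)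
    (hs : A ⊆ (extChartAt (𝓡 n) x₀).source) : chartVolume g x₁ A ≤ chartVolume g x₀ A := by
  rw [chartVolume_apply g x₁ hA, chartVolume_apply g x₀ hA]
  set B₁ := (extChartAt (𝓡 n) x₁).target ∩ (extChartAt (𝓡 n) x₁).symm ⁻¹' A with hB₁
  have hd : ∀ y ∈ B₁, HasFDerivWithinAt (transition x₁ x₀)
      ((chartDeriv x₀ ((extChartAt (𝓡 n) x₁).symm y)).comp (chartSymmDeriv x₁ y)) B₁ y :=
    fun y hy => (hasFDerivAt_transition hy.1 (hs hy.2)).hasFDerivWithinAt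
  have hinj : InjOn (transition (n := n) x₁ x₀) B₁ := by
    intro y hy z hz h
    have := (extChartAt (𝓡 n) x₀).injOn (hs hy.2) (hs hz.2) h
    exact (extChartAt (𝓡 n) x₁).symm.injOn hy.1 hz.1 this
  have himg : transition (n := n) x₁ x₀ '' B₁ ⊆
      (extChartAt (𝓡 n) x₀).target ∩ (extChartAt (𝓡 n) x₀).symm ⁻¹' A := by
    rintro _ ⟨y, hy, rfl⟩
    refine ⟨(extChartAt (𝓡 n) x₀).map_source (hs hy.2), ?_⟩
    rw [mem_preimage, transition, (extChartAt (𝓡 n) x₀).left_inv (hs hy.2)]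
    exact hy.2
  refine le_trans (le_of_eq ?_) (lintegral_mono_set himg)
  rw [lintegral_image_eq_lintegral_abs_det_fderiv_mul volume
    (measurableSet_chart_preimage x₁ hA) hd hinj]
  refine setLIntegral_congr_fun (measurableSet_chart_preimage x₁ hA) fun y hy => ?_
  rw [← ENNReal.ofReal_mul (abs_nonneg _), volDensity_transition g (hs hy.2), mul_comm]

theorem riemannianVolume_restrict (g : Metric n M) (x₀ : M) :
    (riemannianVolume g).restrict (extChartAt (𝓡 n) x₀).source = chartVolume g x₀ := by
  have hS := (isOpen_chart_source (n := n) x₀).measurableSet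
  set S := (extChartAt (𝓡 n) x₀).source with hSdef
  -- A supremum of measures is not computed set by set. It is bounded instead by one measure that
  -- dominates every chart measure and whose second summand gives no mass to `S`.
  have hle : riemannianVolume g ≤ chartVolume g x₀ + (riemannianVolume g).restrict Sᶜ := by
    refine iSup_le fun x₁ => Measure.le_iff.2 fun A hA => ?_
    rw [← measure_inter_add_sdiff A hS, Measure.add_apply, Measure.restrict_apply hA]
    exact add_le_add ((chartVolume_le g x₁ x₀ (hA.inter hS) inter_subset_right).trans
      (measure_mono inter_subset_left)) ((le_iSup (chartVolume g) x₁) _)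
  ext A hA
  rw [Measure.restrict_apply hA]
  refine le_antisymm ?_ ?_
  · refine (hle _).trans ?_
    rw [Measure.add_apply, Measure.restrict_apply (hA.inter hS)]
    have : A ∩ S ∩ Sᶜ = ∅ := by rw [inter_assoc, inter_compl_self, inter_empty]
    rw [this, measure_empty, add_zero]
    exact measure_mono inter_subset_left
  · rw [← measure_inter_add_sdiff A hS, measure_mono_null (s := A \ S) (fun x hx => hx.2)
      (chartVolume_compl_source g x₀), add_zero]
    exact (le_iSup (chartVolume g) x₀) _

theorem isFiniteMeasure_riemannianVolume [CompactSpace M] (g : Metric n M) :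
    IsFiniteMeasure (riemannianVolume g) := by
  refine ⟨isCompact_univ.measure_lt_top_of_nhdsWithin fun x _ => ?_⟩
  rw [nhdsWithin_univ]
  have ht : (extChartAt (𝓡 n) x).target ∈ 𝓝 (extChartAt (𝓡 n) x x) :=
    (isOpen_chart_target x).mem_nhds (mem_extChartAt_target x)
  obtain ⟨K, hK, hKt, hKc⟩ := local_compact_nhds ht
  refine ⟨(extChartAt (𝓡 n) x).source ∩ extChartAt (𝓡 n) x ⁻¹' interior K, ?_, ?_⟩
  · exact inter_mem (extChartAt_source_mem_nhds x)
      ((continuousAt_extChartAt x).preimage_mem_nhds (interior_mem_nhds.2 hK))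
  · have hm : MeasurableSet ((extChartAt (𝓡 n) x).source ∩ extChartAt (𝓡 n) x ⁻¹' interior K) :=
      ((continuousOn_extChartAt x).isOpen_inter_preimage (isOpen_chart_source x)
        isOpen_interior).measurableSet
    have h1 : riemannianVolume g ((extChartAt (𝓡 n) x).source ∩
        extChartAt (𝓡 n) x ⁻¹' interior K) = chartVolume g x ((extChartAt (𝓡 n) x).source ∩
        extChartAt (𝓡 n) x ⁻¹' interior K) := by
      rw [← riemannianVolume_restrict g x, Measure.restrict_apply hm]
      congr 1
      ext z
      simp only [mem_inter_iff]
      tauto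
    rw [h1, chartVolume_apply g x hm]
    refine lt_of_le_of_lt (lintegral_mono_set (t := K) ?_) ?_
    · rintro y ⟨hy, hy'⟩
      have := interior_subset hy'.2
      rwa [(extChartAt (𝓡 n) x).right_inv hy] at this
    · have := ((contDiffOn_volDensity g x).continuousOn.mono hKt).integrableOn_compact hKc
        (μ := volume)
      exact this.lintegral_lt_top

theorem setIntegral_chart_source (g : Metric n M) (x₀ : M) {G : M → ℝ}
    (hG : AEStronglyMeasurable G ((riemannianVolume g).restrict (extChartAt (𝓡 n) x₀).source)) :
    ∫ x in (extChartAt (𝓡 n) x₀).source, G x ∂(riemannianVolume g) =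
      ∫ y in (extChartAt (𝓡 n) x₀).target,
        volDensity g x₀ y * G ((extChartAt (𝓡 n) x₀).symm y) := by
  rw [riemannianVolume_restrict] at hG ⊢
  rw [chartVolume, integral_map (aemeasurable_chart_symm_withDensity x₀) hG]
  have hc : AEMeasurable (fun y => √(gram g x₀ y).det)
      (volume.restrict (extChartAt (𝓡 n) x₀).target) :=
    (contDiffOn_volDensity g x₀).continuousOn.aemeasurable (isOpen_chart_target x₀).measurableSet
  rw [integral_withDensity_eq_integral_toReal_smul₀ hc.ennreal_ofReal
    (Eventually.of_forall fun y => ENNReal.ofReal_lt_top)]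
  refine integral_congr_ae (Eventually.of_forall fun y => ?_)
  simp only [smul_eq_mul]
  rw [ENNReal.toReal_ofReal (Real.sqrt_nonneg _)]
  rfl

end Volume

end BarotropicFlow

/-! ### Smoothness of the inverse curve, the Eulerian velocity and the Eulerian rate. -/

namespace BarotropicFlow

section Curves

open Filter Topology

variable {n : ℕ}
  {N : Type*} [TopologicalSpace N] [ChartedSpace (Model n) N]
  {M : Type*} [TopologicalSpace M] [ChartedSpace (Model n) M]

/-- The derivative in the last variable of a smooth map with values in a vector space is smooth. -/
theorem contMDiffAt_deriv_of_uncurry {EZ : Type*} [NormedAddCommGroup EZ] [NormedSpace ℝ EZ]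
    {HZ : Type*} [TopologicalSpace HZ] {IZ : ModelWithCorners ℝ EZ HZ} {Z : Type*}
    [TopologicalSpace Z] [ChartedSpace HZ Z] [IsManifold IZ ∞ Z]
    {V : Type*} [NormedAddCommGroup V] [NormedSpace ℝ V] {h : Z → ℝ → V} {τ : Z → ℝ} {z₀ : Z}
    (hh : ContMDiffAt (IZ.prod 𝓘(ℝ, ℝ)) 𝓘(ℝ, V) ∞ (Function.uncurry h) (z₀, τ z₀))
    (hτ : ContMDiffAt IZ 𝓘(ℝ, ℝ) ∞ τ z₀) :
    ContMDiffAt IZ 𝓘(ℝ, V) ∞ (fun z => deriv (h z) (τ z)) z₀ := by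
  have key := ContMDiffAt.mfderiv (m := ∞) h τ hh hτ (by simp)
  have h2 : ContMDiffAt IZ 𝓘(ℝ, V) ∞ (fun z =>
      (inTangentCoordinates 𝓘(ℝ, ℝ) 𝓘(ℝ, V) τ (fun x => h x (τ x))
        (fun x => mfderiv 𝓘(ℝ, ℝ) 𝓘(ℝ, V) (h x) (τ x)) z₀ z) (1 : ℝ)) z₀ :=
    key.clm_apply contMDiffAt_const
  refine h2.congr_of_eventuallyEq (Eventually.of_forall fun z => ?_)
  have h3 := inTangentCoordinates_model_space τ (fun x => h x (τ x))
    (fun x => (mfderiv 𝓘(ℝ, ℝ) 𝓘(ℝ, V) (h x) (τ x) : ℝ →L[ℝ] V)) z₀ (I := 𝓘(ℝ, ℝ))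
    (I' := 𝓘(ℝ, V))
  have h4 : deriv (h z) (τ z) = (mfderiv 𝓘(ℝ, ℝ) 𝓘(ℝ, V) (h z) (τ z) : ℝ →L[ℝ] V) 1 := by
    rw [mfderiv_eq_fderiv]
    rfl
  exact h4.trans (congrArg (fun L : ℝ →L[ℝ] V => L 1) (congrFun h3 z)).symm

variable {η : ℝ → N ≃ₘ⟮𝓡 n, 𝓡 n⟯ M} {F : ℝ → C^∞⟮𝓡 n, N; 𝓘(ℝ, ℝ), ℝ⟯} {J : Set ℝ}

theorem contMDiffAt_path (hJ : IsOpen J)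
    (hη : ContMDiffOn (𝓘(ℝ, ℝ).prod (𝓡 n)) (𝓡 n) ∞ (fun z : ℝ × N => η z.1 z.2) (J ×ˢ univ))
    {t : ℝ} (ht : t ∈ J) (p : N) :
    ContMDiffAt 𝓘(ℝ, ℝ) (𝓡 n) ∞ (fun τ => η τ p) t :=
  ContMDiffAt.comp t (g := fun z : ℝ × N => η z.1 z.2) (f := fun τ => (τ, p))
    (hη.contMDiffAt ((hJ.prod isOpen_univ).mem_nhds ⟨ht, mem_univ _⟩))
    (contMDiffAt_id.prodMk contMDiffAt_const)

variable [IsManifold (𝓡 n) ∞ M]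

/-- The inverses of a smooth curve of diffeomorphisms form a smooth curve. -/
theorem contMDiffAt_symm_curve (hJ : IsOpen J)
    (hη : ContMDiffOn (𝓘(ℝ, ℝ).prod (𝓡 n)) (𝓡 n) ∞ (fun z : ℝ × N => η z.1 z.2) (J ×ˢ univ))
    {t₀ : ℝ} (ht₀ : t₀ ∈ J) (x₀ : M) :
    ContMDiffAt (𝓘(ℝ, ℝ).prod (𝓡 n)) (𝓡 n) ∞ (fun z : ℝ × M => (η z.1).symm z.2) (t₀, x₀) := by
  have hηat : ∀ p : N, ContMDiffAt (𝓘(ℝ, ℝ).prod (𝓡 n)) (𝓡 n) ∞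
      (fun z : ℝ × N => η z.1 z.2) (t₀, p) := fun p =>
    hη.contMDiffAt ((hJ.prod isOpen_univ).mem_nhds ⟨ht₀, mem_univ _⟩)
  set y₀ := extChartAt (𝓡 n) x₀ x₀ with hy₀
  have hsy₀ : (extChartAt (𝓡 n) x₀).symm y₀ = x₀ := extChartAt_to_inv x₀
  -- `N` is parametrised through `η t₀` and the chart at `x₀`, so that at time `t₀` the curve reads
  -- as the identity in coordinates.
  set back : Model n → N := fun y => (η t₀).symm ((extChartAt (𝓡 n) x₀).symm y) with hback
  have hback_smooth : ContMDiffAt 𝓘(ℝ, Model n) (𝓡 n) ∞ back y₀ :=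
    (η t₀).symm.contMDiff.contMDiffAt.comp y₀ ((contMDiffOn_extChartAt_symm x₀).contMDiffAt
      ((isOpen_chart_target x₀).mem_nhds (mem_extChartAt_target x₀)))
  set Ψ : ℝ × Model n → M := fun z => η z.1 (back z.2) with hΨ
  have hback0 : back y₀ = (η t₀).symm x₀ := by rw [hback]; simp only [hsy₀]
  have hΨ0 : Ψ (t₀, y₀) = x₀ := by simp only [hΨ, hback0, Diffeomorph.apply_symm_apply]
  have hΨs : ContMDiffAt 𝓘(ℝ, ℝ × Model n) (𝓡 n) ∞ Ψ (t₀, y₀) := by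
    have h1 : ContMDiffAt 𝓘(ℝ, ℝ × Model n) (𝓘(ℝ, ℝ).prod (𝓡 n)) ∞
        (fun z : ℝ × Model n => (z.1, back z.2)) (t₀, y₀) :=
      contDiff_fst.contMDiff.contMDiffAt.prodMk
        (ContMDiffAt.comp (t₀, y₀) (g := back) (f := Prod.snd) hback_smooth
          contDiff_snd.contMDiff.contMDiffAt)
    exact ContMDiffAt.comp (t₀, y₀) (g := fun z : ℝ × N => η z.1 z.2) (hηat (back y₀)) h1
  set θ : ℝ × Model n → Model n := fun z => extChartAt (𝓡 n) x₀ (Ψ z) with hθ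
  have hθs : ContDiffAt ℝ ∞ θ (t₀, y₀) := by
    rw [← contMDiffAt_iff_contDiffAt]
    refine ContMDiffAt.comp (t₀, y₀) (g := extChartAt (𝓡 n) x₀) ?_ hΨs
    rw [hΨ0]
    exact contMDiffAt_extChartAt
  set G : ℝ × Model n → ℝ × Model n := fun z => (z.1, θ z) with hG
  have hGs : ContDiffAt ℝ ∞ G (t₀, y₀) := contDiffAt_fst.prodMk hθs
  have hθid : ∀ᶠ y in 𝓝 y₀, θ (t₀, y) = y := by
    filter_upwards [(isOpen_chart_target x₀).mem_nhds (mem_extChartAt_target x₀)] with y hy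
    simp only [hθ, hΨ, hback, Diffeomorph.apply_symm_apply]
    exact (extChartAt (𝓡 n) x₀).right_inv hy
  have hθ0 : θ (t₀, y₀) = y₀ := hθid.self_of_nhds
  set θ' := fderiv ℝ θ (t₀, y₀) with hθ'
  have hθd : HasFDerivAt θ θ' (t₀, y₀) := (hθs.differentiableAt (by simp)).hasFDerivAt
  have hθ'2 : ∀ w, θ' (0, w) = w := by
    intro w
    have h1 : HasFDerivAt (fun y => θ (t₀, y)) (θ'.comp (ContinuousLinearMap.inr ℝ ℝ (Model n)))
        y₀ := hθd.comp y₀ (hasFDerivAt_prodMk_right t₀ y₀)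
    have h2 : HasFDerivAt (fun y => θ (t₀, y)) (ContinuousLinearMap.id ℝ (Model n)) y₀ :=
      (hasFDerivAt_id y₀).congr_of_eventuallyEq hθid
    exact congrArg (fun L : Model n →L[ℝ] Model n => L w) (h1.unique h2)
  -- The derivative of `G (t, y) = (t, θ (t, y))` is triangular with identity diagonal blocks, so
  -- its inverse can be written down, and the inverse function theorem applies with time as a
  -- parameter.
  set e : (ℝ × Model n) ≃L[ℝ] (ℝ × Model n) := ContinuousLinearEquiv.equivOfInverse
    ((ContinuousLinearMap.fst ℝ ℝ (Model n)).prod θ')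
    ((ContinuousLinearMap.fst ℝ ℝ (Model n)).prod (ContinuousLinearMap.snd ℝ ℝ (Model n) -
      (θ'.comp (ContinuousLinearMap.inl ℝ ℝ (Model n))).comp
        (ContinuousLinearMap.fst ℝ ℝ (Model n))))
    (by
      rintro ⟨a, b⟩
      have : θ' (a, b) = θ' (a, 0) + b := by
        rw [← hθ'2 b, ← map_add]
        simp [hθ'2]
      simp [this])
    (by
      rintro ⟨a, b⟩
      have : θ' (a, b - θ' (a, 0)) = b := by
        have h : ((a, b - θ' (a, 0)) : ℝ × Model n) = (a, 0) + (0, b - θ' (a, 0)) := by simp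
        rw [h, map_add, hθ'2]
        simp
      simp [this]) with he
  have hGd : HasFDerivAt G (e : (ℝ × Model n) →L[ℝ] (ℝ × Model n)) (t₀, y₀) :=
    hasFDerivAt_fst.prodMk hθd
  set ψ := hGs.localInverse hGd (by simp) with hψ
  have hG0 : G (t₀, y₀) = (t₀, y₀) := by simp only [hG, hθ0]
  have hψs : ContDiffAt ℝ ∞ ψ (t₀, y₀) := by
    have := hGs.to_localInverse hGd (by simp)
    rwa [hG0] at this
  have hψ0 : ψ (t₀, y₀) = (t₀, y₀) := by
    have := hGs.localInverse_apply_image hGd (by simp)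
    rwa [hG0] at this
  have hψr : ∀ᶠ z in 𝓝 (t₀, y₀), G (ψ z) = z := by
    have := (hGs.hasStrictFDerivAt' hGd (by simp)).eventually_right_inverse
    rwa [hG0] at this
  have hψsrc : ∀ᶠ z in 𝓝 (t₀, y₀), Ψ (ψ z) ∈ (extChartAt (𝓡 n) x₀).source := by
    have hc : ContinuousAt (fun z => Ψ (ψ z)) (t₀, y₀) := by
      refine ContinuousAt.comp (g := Ψ) ?_ hψs.continuousAt
      rw [hψ0]
      exact hΨs.continuousAt
    refine hc.preimage_mem_nhds ?_
    rw [hψ0, hΨ0]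
    exact extChartAt_source_mem_nhds x₀
  have hchart : ContMDiffAt (𝓘(ℝ, ℝ).prod (𝓡 n)) 𝓘(ℝ, ℝ × Model n) ∞
      (fun z : ℝ × M => (z.1, extChartAt (𝓡 n) x₀ z.2)) (t₀, x₀) := by
    have h1 : ContMDiffAt (𝓘(ℝ, ℝ).prod (𝓡 n)) 𝓘(ℝ, Model n) ∞
      (fun z : ℝ × M => extChartAt (𝓡 n) x₀ z.2) (t₀, x₀) :=
      ContMDiffAt.comp (t₀, x₀) (g := extChartAt (𝓡 n) x₀) contMDiffAt_extChartAt contMDiffAt_snd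
    exact contMDiffAt_fst.prodMk_space h1
  have hcc : ContinuousAt (fun z : ℝ × M => (z.1, extChartAt (𝓡 n) x₀ z.2)) (t₀, x₀) :=
    hchart.continuousAt
  have hfin : ContMDiffAt (𝓘(ℝ, ℝ).prod (𝓡 n)) (𝓡 n) ∞
      (fun z : ℝ × M => back (ψ (z.1, extChartAt (𝓡 n) x₀ z.2)).2) (t₀, x₀) := by
    have h1 : ContMDiffAt (𝓘(ℝ, ℝ).prod (𝓡 n)) 𝓘(ℝ, Model n) ∞
        (fun z : ℝ × M => (ψ (z.1, extChartAt (𝓡 n) x₀ z.2)).2) (t₀, x₀) :=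
      ContMDiffAt.comp (t₀, x₀) (g := fun w => (ψ w).2)
        (f := fun z : ℝ × M => (z.1, extChartAt (𝓡 n) x₀ z.2))
        (contMDiffAt_iff_contDiffAt.2 (contDiffAt_snd.comp _ hψs)) hchart
    refine ContMDiffAt.comp (t₀, x₀) (g := back) ?_ h1
    have : (ψ (t₀, extChartAt (𝓡 n) x₀ x₀)).2 = y₀ := by rw [← hy₀, hψ0]
    simp only [this]
    exact hback_smooth
  refine hfin.congr_of_eventuallyEq ?_
  have hsrc : ∀ᶠ z : ℝ × M in 𝓝 (t₀, x₀), z.2 ∈ (extChartAt (𝓡 n) x₀).source :=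
    continuousAt_snd.preimage_mem_nhds (extChartAt_source_mem_nhds x₀)
  filter_upwards [hcc.eventually hψr, hcc.eventually hψsrc, hsrc] with z h1 h2 h3
  have h4 : (ψ (z.1, extChartAt (𝓡 n) x₀ z.2)).1 = z.1 := congrArg Prod.fst h1
  have h5 : extChartAt (𝓡 n) x₀ (Ψ (ψ (z.1, extChartAt (𝓡 n) x₀ z.2)))
      = extChartAt (𝓡 n) x₀ z.2 := congrArg Prod.snd h1
  -- Injectivity of the chart and of `η z.1` identifies the local inverse with the given global
  -- inverse.
  have h6 := (extChartAt (𝓡 n) x₀).injOn h2 h3 h5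
  simp only [hΨ, h4] at h6
  have h7 := congrArg (η z.1).symm h6
  rw [Diffeomorph.symm_apply_apply] at h7
  exact h7.symm

/-- In a chart, the Eulerian velocity is the time derivative of the particle paths. -/
theorem hasDerivAt_chart_curve (hJ : IsOpen J)
    (hη : ContMDiffOn (𝓘(ℝ, ℝ).prod (𝓡 n)) (𝓡 n) ∞ (fun z : ℝ × N => η z.1 z.2) (J ×ˢ univ))
    {t : ℝ} (ht : t ∈ J) (p : N) {x₀ : M} (hp : η t p ∈ (extChartAt (𝓡 n) x₀).source) :
    HasDerivAt (fun τ => extChartAt (𝓡 n) x₀ (η τ p))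
      (fieldCoord x₀ (eulerVelocity η t) (extChartAt (𝓡 n) x₀ (η t p))) t := by
  rw [fieldCoord_extChartAt hp, eulerVelocity_apply]
  have h1 : MDifferentiableAt (𝓡 n) 𝓘(ℝ, Model n) (extChartAt (𝓡 n) x₀) (η t p) :=
    mdifferentiableAt_extChartAt (mem_chart_source_iff.2 hp)
  have h2 : MDifferentiableAt 𝓘(ℝ, ℝ) (𝓡 n) (fun τ => η τ p) t :=
    (contMDiffAt_path hJ hη ht p).mdifferentiableAt (by simp)
  have h3 : HasFDerivAt (fun τ => extChartAt (𝓡 n) x₀ (η τ p))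
      (show ℝ →L[ℝ] Model n from (chartDeriv x₀ (η t p)).comp
        (mfderiv 𝓘(ℝ, ℝ) (𝓡 n) (fun τ => η τ p) t)) t :=
    (h1.hasMFDerivAt.comp t h2.hasMFDerivAt).hasFDerivAt
  exact h3.hasDerivAt

/-- With the point of `M` as variable, instead of the particle, this is the form from which joint
smoothness in time and position follows. -/
theorem fieldCoord_eulerVelocity (hJ : IsOpen J)
    (hη : ContMDiffOn (𝓘(ℝ, ℝ).prod (𝓡 n)) (𝓡 n) ∞ (fun z : ℝ × N => η z.1 z.2) (J ×ˢ univ))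
    {t : ℝ} (ht : t ∈ J) {x₀ x : M} (hx : x ∈ (extChartAt (𝓡 n) x₀).source) :
    chartDeriv x₀ x (eulerVelocity η t x) =
      deriv (fun τ => extChartAt (𝓡 n) x₀ (η τ ((η t).symm x))) t := by
  obtain ⟨p, rfl⟩ : ∃ p, η t p = x := ⟨(η t).symm x, (η t).apply_symm_apply x⟩
  rw [Diffeomorph.symm_apply_apply, (hasDerivAt_chart_curve hJ hη ht p hx).deriv,
    fieldCoord_extChartAt hx]

/-- The particle path through `x` at time `t`, as a function of `(t, x)` and of time. -/
theorem contMDiffAt_path_through (hJ : IsOpen J)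
    (hη : ContMDiffOn (𝓘(ℝ, ℝ).prod (𝓡 n)) (𝓡 n) ∞ (fun z : ℝ × N => η z.1 z.2) (J ×ˢ univ))
    {t₀ : ℝ} (ht₀ : t₀ ∈ J) (x₀ : M) :
    ContMDiffAt ((𝓘(ℝ, ℝ).prod (𝓡 n)).prod 𝓘(ℝ, ℝ)) (𝓡 n) ∞
      (fun w : (ℝ × M) × ℝ => η w.2 ((η w.1.1).symm w.1.2)) ((t₀, x₀), t₀) := by
  have h1 : ContMDiffAt ((𝓘(ℝ, ℝ).prod (𝓡 n)).prod 𝓘(ℝ, ℝ)) (𝓘(ℝ, ℝ).prod (𝓡 n)) ∞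
      (fun w : (ℝ × M) × ℝ => (w.2, (η w.1.1).symm w.1.2)) ((t₀, x₀), t₀) :=
    contMDiffAt_snd.prodMk (ContMDiffAt.comp ((t₀, x₀), t₀)
      (g := fun z : ℝ × M => (η z.1).symm z.2) (f := Prod.fst)
      (contMDiffAt_symm_curve hJ hη ht₀ x₀) contMDiffAt_fst)
  exact ContMDiffAt.comp ((t₀, x₀), t₀) (g := fun z : ℝ × N => η z.1 z.2)
    (hη.contMDiffAt ((hJ.prod isOpen_univ).mem_nhds ⟨ht₀, mem_univ _⟩)) h1

/-- The Eulerian velocity is a smooth time-dependent vector field. -/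
theorem contMDiffAt_eulerVelocity (hJ : IsOpen J)
    (hη : ContMDiffOn (𝓘(ℝ, ℝ).prod (𝓡 n)) (𝓡 n) ∞ (fun z : ℝ × N => η z.1 z.2) (J ×ˢ univ))
    {t₀ : ℝ} (ht₀ : t₀ ∈ J) (x₀ : M) :
    ContMDiffAt (𝓘(ℝ, ℝ).prod (𝓡 n)) (𝓡 n).tangent ∞
      (fun z : ℝ × M => (⟨z.2, eulerVelocity η z.1 z.2⟩ : TangentBundle (𝓡 n) M)) (t₀, x₀) := by
  have hm : (⟨x₀, eulerVelocity η t₀ x₀⟩ : TangentBundle (𝓡 n) M) ∈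
      (trivializationAt (Model n) (TangentSpace (𝓡 n)) x₀).source := by
    rw [TangentBundle.trivializationAt_source]
    exact mem_chart_source (Model n) x₀
  rw [Bundle.Trivialization.contMDiffAt_iff (f := fun z : ℝ × M =>
    (⟨z.2, eulerVelocity η z.1 z.2⟩ : TangentBundle (𝓡 n) M)) hm]
  refine ⟨contMDiffAt_snd, ?_⟩
  have h2 : ContMDiffAt ((𝓘(ℝ, ℝ).prod (𝓡 n)).prod 𝓘(ℝ, ℝ)) 𝓘(ℝ, Model n) ∞
      (fun w : (ℝ × M) × ℝ => extChartAt (𝓡 n) x₀ (η w.2 ((η w.1.1).symm w.1.2)))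
      ((t₀, x₀), t₀) := by
    refine ContMDiffAt.comp ((t₀, x₀), t₀) (g := extChartAt (𝓡 n) x₀) ?_
      (contMDiffAt_path_through hJ hη ht₀ x₀)
    rw [Diffeomorph.apply_symm_apply]
    exact contMDiffAt_extChartAt
  -- Time enters twice, in the choice of the particle and along its path. The two are kept apart:
  -- the derivative is taken in `τ` only and then evaluated at `τ = z.1`.
  have h3 := contMDiffAt_deriv_of_uncurry (Z := ℝ × M) (z₀ := (t₀, x₀)) (τ := Prod.fst)
    (h := fun z τ => extChartAt (𝓡 n) x₀ (η τ ((η z.1).symm z.2))) h2 contMDiffAt_fst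
  refine h3.congr_of_eventuallyEq ?_
  have hsrc : ∀ᶠ z : ℝ × M in 𝓝 (t₀, x₀), z.2 ∈ (extChartAt (𝓡 n) x₀).source :=
    continuousAt_snd.preimage_mem_nhds (extChartAt_source_mem_nhds x₀)
  have hJe : ∀ᶠ z : ℝ × M in 𝓝 (t₀, x₀), z.1 ∈ J :=
    continuousAt_fst.preimage_mem_nhds (hJ.mem_nhds ht₀)
  filter_upwards [hsrc, hJe] with z hz hzJ
  have hz' := mem_chart_source_iff.2 hz
  rw [← fieldCoord_eulerVelocity hJ hη hzJ hz,
    ← Bundle.Trivialization.continuousLinearMapAt_apply_of_mem (R := ℝ) _ hz',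
    TangentBundle.continuousLinearMapAt_trivializationAt hz']
  rfl

/-- The Eulerian rate is smooth. -/
theorem contMDiffAt_eulerRate (hJ : IsOpen J)
    (hη : ContMDiffOn (𝓘(ℝ, ℝ).prod (𝓡 n)) (𝓡 n) ∞ (fun z : ℝ × N => η z.1 z.2) (J ×ˢ univ))
    (hF : ContMDiffOn (𝓘(ℝ, ℝ).prod (𝓡 n)) 𝓘(ℝ, ℝ) ∞ (fun z : ℝ × N => F z.1 z.2) (J ×ˢ univ))
    {t₀ : ℝ} (ht₀ : t₀ ∈ J) (x₀ : M) :
    ContMDiffAt (𝓘(ℝ, ℝ).prod (𝓡 n)) 𝓘(ℝ, ℝ) ∞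
      (fun z : ℝ × M => eulerRate η F z.1 z.2) (t₀, x₀) := by
  have h1 : ContMDiffAt ((𝓘(ℝ, ℝ).prod (𝓡 n)).prod 𝓘(ℝ, ℝ)) (𝓘(ℝ, ℝ).prod (𝓡 n)) ∞
      (fun w : (ℝ × M) × ℝ => (w.2, (η w.1.1).symm w.1.2)) ((t₀, x₀), t₀) :=
    contMDiffAt_snd.prodMk (ContMDiffAt.comp ((t₀, x₀), t₀)
      (g := fun z : ℝ × M => (η z.1).symm z.2) (f := Prod.fst)
      (contMDiffAt_symm_curve hJ hη ht₀ x₀) contMDiffAt_fst)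
  have h2 : ContMDiffAt ((𝓘(ℝ, ℝ).prod (𝓡 n)).prod 𝓘(ℝ, ℝ)) 𝓘(ℝ, ℝ) ∞
      (fun w : (ℝ × M) × ℝ => F w.2 ((η w.1.1).symm w.1.2)) ((t₀, x₀), t₀) :=
    ContMDiffAt.comp ((t₀, x₀), t₀) (g := fun z : ℝ × N => F z.1 z.2)
      (hF.contMDiffAt ((hJ.prod isOpen_univ).mem_nhds ⟨ht₀, mem_univ _⟩)) h1
  exact contMDiffAt_deriv_of_uncurry (Z := ℝ × M) (z₀ := (t₀, x₀)) (τ := Prod.fst)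
    (h := fun z τ => F τ ((η z.1).symm z.2)) h2 contMDiffAt_fst

end Curves

end BarotropicFlow

/-! ### Positivity, transformation and smoothness of the density. -/

namespace BarotropicFlow

section Density

open Filter Topology

variable {n : ℕ}
  {N : Type*} [TopologicalSpace N] [ChartedSpace (Model n) N]
  {M : Type*} [TopologicalSpace M] [ChartedSpace (Model n) M]

/-- The value of a volume form on the coordinate frame at `p`. -/
noncomputable def VolumeForm.frame (ν : VolumeForm n N) (p : N) : ℝ :=
  ν.form p (fun i => ofCoord p (Pi.single i 1))

/-- In dimension `n` an alternating `n`-form is a multiple of the determinant with respect to a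
basis. -/
theorem VolumeForm.form_comp (ν : VolumeForm n N) (p : N) (L : Model n →L[ℝ] Model n) :
    ν.form p (fun i => (L (EuclideanSpace.single i 1) : Model n)) = L.det * ν.frame p := by
  set b := (EuclideanSpace.basisFun (Fin n) ℝ).toBasis with hb
  set κ : Model n [⋀^Fin n]→ₗ[ℝ] ℝ := ν.form p with hκ
  have h1 := κ.eq_smul_basis_det b
  have hbv : ∀ i, b i = (EuclideanSpace.single i 1 : Model n) := fun i => by simp [hb]
  have h2 : (fun i => (L (EuclideanSpace.single i 1) : Model n)) = (L : Model n →ₗ[ℝ] Model n) ∘ b :=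
    funext fun i => by simp [hbv]
  have h3 : ν.frame p = κ b := congrArg κ (funext fun i => (hbv i).symm)
  show κ _ = _
  rw [h2, h3]
  conv_lhs => rw [h1]
  rw [AlternatingMap.smul_apply, Module.Basis.det_comp, Module.Basis.det_self, mul_one,
    smul_eq_mul, mul_comm]

theorem VolumeForm.frame_ne_zero (ν : VolumeForm n N) (p : N) : ν.frame p ≠ 0 := by
  intro h
  set b := (EuclideanSpace.basisFun (Fin n) ℝ).toBasis with hb
  set κ : Model n [⋀^Fin n]→ₗ[ℝ] ℝ := ν.form p with hκ
  have h1 := κ.eq_smul_basis_det b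
  have hbv : ∀ i, b i = (EuclideanSpace.single i 1 : Model n) := fun i => by simp [hb]
  have h3 : ν.frame p = κ b := congrArg κ (funext fun i => (hbv i).symm)
  rw [← h3, h, zero_smul] at h1
  exact ν.ne_zero p h1

theorem mfderiv_diffeomorph_injective (Φ : N ≃ₘ⟮𝓡 n, 𝓡 n⟯ M) (p : N) :
    Function.Injective (mfderiv (𝓡 n) (𝓡 n) Φ p) :=
  (Φ.mfderivToContinuousLinearEquiv (by simp) p).injective

variable [IsManifold (𝓡 n) ∞ M]

theorem density_apply (g : Metric n M) (ν : VolumeForm n N) (Φ : N ≃ₘ⟮𝓡 n, 𝓡 n⟯ M) (p : N) :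
    density g ν Φ (Φ p) = |ν.frame p| / √(Matrix.of fun i j : Fin n =>
      g.inner (Φ p) (mfderiv (𝓡 n) (𝓡 n) Φ p (ofCoord p (Pi.single i 1)))
        (mfderiv (𝓡 n) (𝓡 n) Φ p (ofCoord p (Pi.single j 1)))).det := by
  -- The point `Φ.symm (Φ p)` equals `p` only propositionally, and the tangent spaces depend on it,
  -- so the point is generalised before substituting.
  have key : ∀ p' : N, p' = p →
      |ν.form p' (fun i => ofCoord p' (Pi.single i 1))| / √(Matrix.of fun i j : Fin n =>
      g.inner (Φ p') (mfderiv (𝓡 n) (𝓡 n) Φ p' (ofCoord p' (Pi.single i 1)))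
        (mfderiv (𝓡 n) (𝓡 n) Φ p' (ofCoord p' (Pi.single j 1)))).det
      = |ν.frame p| / √(Matrix.of fun i j : Fin n =>
      g.inner (Φ p) (mfderiv (𝓡 n) (𝓡 n) Φ p (ofCoord p (Pi.single i 1)))
        (mfderiv (𝓡 n) (𝓡 n) Φ p (ofCoord p (Pi.single j 1)))).det := by
    rintro _ rfl; rfl
  exact key _ (Φ.symm_apply_apply p)

/-- The derivative of `Φ` at `p`, read in the chart at `x₀`. -/
noncomputable def chartMFDeriv (Φ : N → M) (x₀ : M) (p : N) : Model n →L[ℝ] Model n :=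
  (chartDeriv x₀ (Φ p)).comp (mfderiv (𝓡 n) (𝓡 n) Φ p)

/-- This separates the three influences on the density: the form at the particle, the volume density
at its position, and a coordinate Jacobian that obeys the chain rule. -/
theorem density_eq (g : Metric n M) (ν : VolumeForm n N) (Φ : N ≃ₘ⟮𝓡 n, 𝓡 n⟯ M) {p : N} {x₀ : M}
    (hx : Φ p ∈ (extChartAt (𝓡 n) x₀).source) :
    density g ν Φ (Φ p) = |ν.frame p| /
      (volDensity g x₀ (extChartAt (𝓡 n) x₀ (Φ p)) * |(chartMFDeriv (n := n) Φ x₀ p).det|) := by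
  rw [density_apply]
  congr 1
  exact sqrt_det_inner_eq g hx (mfderiv (𝓡 n) (𝓡 n) Φ p)

theorem chartMFDeriv_det_ne_zero (Φ : N ≃ₘ⟮𝓡 n, 𝓡 n⟯ M) {p : N} {x₀ : M}
    (hx : Φ p ∈ (extChartAt (𝓡 n) x₀).source) : (chartMFDeriv (n := n) Φ x₀ p).det ≠ 0 := by
  have hinj : Function.Injective ((chartMFDeriv (n := n) Φ x₀ p : Model n →L[ℝ] Model n) :
      Model n →ₗ[ℝ] Model n) :=
    (chartDeriv_injective hx).comp (mfderiv_diffeomorph_injective Φ p)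
  exact ((LinearEquiv.ofInjectiveEndo _ hinj).isUnit_det').ne_zero

theorem density_pos (g : Metric n M) (ν : VolumeForm n N) (Φ : N ≃ₘ⟮𝓡 n, 𝓡 n⟯ M) (x : M) :
    0 < density g ν Φ x := by
  obtain ⟨p, rfl⟩ : ∃ p, Φ p = x := ⟨Φ.symm x, Φ.apply_symm_apply x⟩
  have hx : Φ p ∈ (extChartAt (𝓡 n) (Φ p)).source := mem_extChartAt_source _
  rw [density_eq g ν Φ hx]
  have h1 := volDensity_pos g ((extChartAt (𝓡 n) (Φ p)).map_source hx)
  have h2 := abs_pos.2 (chartMFDeriv_det_ne_zero Φ hx)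
  have h3 := abs_pos.2 (ν.frame_ne_zero p)
  positivity

/-- Transformation of the density under a diffeomorphism of `M`. -/
theorem density_trans (g : Metric n M) (ν : VolumeForm n N) (Φ : N ≃ₘ⟮𝓡 n, 𝓡 n⟯ M)
    (Ψ : M ≃ₘ⟮𝓡 n, 𝓡 n⟯ M) {x₀ : M} {y : Model n} (hy : y ∈ (extChartAt (𝓡 n) x₀).target)
    (hΨ : Ψ ((extChartAt (𝓡 n) x₀).symm y) ∈ (extChartAt (𝓡 n) x₀).source)
    {L : Model n →L[ℝ] Model n}
    (hL : HasFDerivAt (fun z => extChartAt (𝓡 n) x₀ (Ψ ((extChartAt (𝓡 n) x₀).symm z))) L y) :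
    density g ν (Φ.trans Ψ) (Ψ ((extChartAt (𝓡 n) x₀).symm y)) *
      (volDensity g x₀ (extChartAt (𝓡 n) x₀ (Ψ ((extChartAt (𝓡 n) x₀).symm y))) * |L.det|) =
      density g ν Φ ((extChartAt (𝓡 n) x₀).symm y) * volDensity g x₀ y := by
  set x := (extChartAt (𝓡 n) x₀).symm y with hxdef
  have hx : x ∈ (extChartAt (𝓡 n) x₀).source := (extChartAt (𝓡 n) x₀).map_target hy
  obtain ⟨p, hp⟩ : ∃ p, Φ p = x := ⟨Φ.symm x, Φ.apply_symm_apply x⟩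
  have hpx : extChartAt (𝓡 n) x₀ x = y := (extChartAt (𝓡 n) x₀).right_inv hy
  have e1 := density_eq g ν Φ (p := p) (x₀ := x₀) (by rw [hp]; exact hx)
  have hs2 : (Φ.trans Ψ) p ∈ (extChartAt (𝓡 n) x₀).source := by
    show Ψ (Φ p) ∈ _; rw [hp]; exact hΨ
  have e2 := density_eq g ν (Φ.trans Ψ) (p := p) (x₀ := x₀) hs2
  -- By the chain rule the Jacobians multiply. The factor coming from `ν` is common to both
  -- densities, since both are evaluated at the same particle `p`.
  have hcomp : (chartMFDeriv (n := n) (Φ.trans Ψ) x₀ p) = L.comp (chartMFDeriv (n := n) Φ x₀ p) := by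
    have hΦd : MDifferentiableAt (𝓡 n) (𝓡 n) Φ p := Φ.mdifferentiable (by simp) p
    have hΨd : MDifferentiableAt (𝓡 n) (𝓡 n) Ψ (Φ p) := Ψ.mdifferentiable (by simp) (Φ p)
    have hcd : ∀ {x}, x ∈ (extChartAt (𝓡 n) x₀).source →
        MDifferentiableAt (𝓡 n) 𝓘(ℝ, Model n) (extChartAt (𝓡 n) x₀) x := fun h =>
      mdifferentiableAt_extChartAt (mem_chart_source_iff.2 h)
    have f1 : HasMFDerivAt (𝓡 n) 𝓘(ℝ, Model n)
        (fun q => extChartAt (𝓡 n) x₀ (Ψ (Φ q))) p (chartMFDeriv (n := n) (Φ.trans Ψ) x₀ p) := by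
      have : HasMFDerivAt (𝓡 n) (𝓡 n) (Φ.trans Ψ) p (mfderiv (𝓡 n) (𝓡 n) (Φ.trans Ψ) p) :=
        ((Φ.trans Ψ).mdifferentiable (by simp) p).hasMFDerivAt
      exact (hcd hs2).hasMFDerivAt.comp p this
    have f2 : HasMFDerivAt (𝓡 n) 𝓘(ℝ, Model n)
        (fun q => extChartAt (𝓡 n) x₀ (Φ q)) p (chartMFDeriv (n := n) Φ x₀ p) :=
      (hcd (by rw [hp]; exact hx)).hasMFDerivAt.comp p hΦd.hasMFDerivAt
    have f3 : HasMFDerivAt (𝓡 n) 𝓘(ℝ, Model n) ((fun z => extChartAt (𝓡 n) x₀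
        (Ψ ((extChartAt (𝓡 n) x₀).symm z))) ∘ (fun q => extChartAt (𝓡 n) x₀ (Φ q))) p
        (L.comp (chartMFDeriv (n := n) Φ x₀ p)) := by
      refine HasMFDerivAt.comp p ?_ f2
      rw [hp, hpx]
      exact hL.hasMFDerivAt
    have f4 : (fun q => extChartAt (𝓡 n) x₀ (Ψ (Φ q))) =ᶠ[𝓝 p] ((fun z => extChartAt (𝓡 n) x₀
        (Ψ ((extChartAt (𝓡 n) x₀).symm z))) ∘ (fun q => extChartAt (𝓡 n) x₀ (Φ q))) := by
      have : ∀ᶠ q in 𝓝 p, Φ q ∈ (extChartAt (𝓡 n) x₀).source :=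
        Φ.continuous.continuousAt.preimage_mem_nhds
          ((isOpen_chart_source x₀).mem_nhds (by rw [hp]; exact hx))
      filter_upwards [this] with q hq
      simp only [Function.comp_apply, (extChartAt (𝓡 n) x₀).left_inv hq]
    exact hasMFDerivAt_unique f1 (f3.congr_of_eventuallyEq f4)
  have hd : (chartMFDeriv (n := n) (Φ.trans Ψ) x₀ p).det = L.det * (chartMFDeriv (n := n) Φ x₀ p).det := by
    rw [hcomp]
    exact LinearMap.det_comp _ _
  have hne := chartMFDeriv_det_ne_zero Φ (p := p) (x₀ := x₀) (by rw [hp]; exact hx)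
  have hne2 := chartMFDeriv_det_ne_zero (Φ.trans Ψ) hs2
  rw [hd] at hne2 e2
  have hLne : L.det ≠ 0 := left_ne_zero_of_mul hne2
  have hΦΨ : (Φ.trans Ψ) p = Ψ x := by rw [← hp]; rfl
  rw [hΦΨ] at e2
  rw [hp, hpx] at e1
  rw [e1, e2, abs_mul]
  have v1 := volDensity_pos g hy
  have v2 := volDensity_pos g ((extChartAt (𝓡 n) x₀).map_source hΨ)
  have a1 := abs_pos.2 hne
  have a2 := abs_pos.2 hLne
  field_simp

variable [IsManifold (𝓡 n) ∞ N] {η : ℝ → N ≃ₘ⟮𝓡 n, 𝓡 n⟯ M} {J : Set ℝ}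

/-- The density is a smooth function of time and position. -/
theorem contMDiffAt_density (g : Metric n M) (ν : VolumeForm n N) (hJ : IsOpen J)
    (hη : ContMDiffOn (𝓘(ℝ, ℝ).prod (𝓡 n)) (𝓡 n) ∞ (fun z : ℝ × N => η z.1 z.2) (J ×ˢ univ))
    {t₀ : ℝ} (ht₀ : t₀ ∈ J) (x₀ : M) :
    ContMDiffAt (𝓘(ℝ, ℝ).prod (𝓡 n)) 𝓘(ℝ, ℝ) ∞
      (fun z : ℝ × M => density g ν (η z.1) z.2) (t₀, x₀) := by
  set p₀ := (η t₀).symm x₀ with hp₀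
  have hinv := contMDiffAt_symm_curve hJ hη ht₀ x₀
  have hmap : ContMDiffAt ((𝓘(ℝ, ℝ).prod (𝓡 n)).prod (𝓡 n)) (𝓡 n) ∞
      (Function.uncurry fun (z : ℝ × M) (p : N) => η z.1 p) ((t₀, x₀), p₀) := by
    have h1 : ContMDiffAt ((𝓘(ℝ, ℝ).prod (𝓡 n)).prod (𝓡 n)) (𝓘(ℝ, ℝ).prod (𝓡 n)) ∞
        (fun w : (ℝ × M) × N => (w.1.1, w.2)) ((t₀, x₀), p₀) :=
      (ContMDiffAt.comp ((t₀, x₀), p₀) (g := Prod.fst) (f := Prod.fst) contMDiffAt_fst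
        contMDiffAt_fst).prodMk contMDiffAt_snd
    exact ContMDiffAt.comp ((t₀, x₀), p₀) (g := fun z : ℝ × N => η z.1 z.2)
      (hη.contMDiffAt ((hJ.prod isOpen_univ).mem_nhds ⟨ht₀, mem_univ _⟩)) h1
  have hder := ContMDiffAt.mfderiv (m := ∞) (fun (z : ℝ × M) (p : N) => η z.1 p)
    (fun z : ℝ × M => (η z.1).symm z.2) hmap hinv (by simp)
  -- `A` is the derivative of `η t` at the particle located at `x`, read in the fixed charts at `p₀`
  -- and `x₀`, which makes smoothness meaningful. Reading `ν` on the coordinate frame of the chart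
  -- at `p₀` introduces the factor `L.det`, which cancels against the same factor in `(A z).det`.
  set A : ℝ × M → (Model n →L[ℝ] Model n) := inTangentCoordinates (𝓡 n) (𝓡 n)
    (fun z : ℝ × M => (η z.1).symm z.2) (fun z => η z.1 ((η z.1).symm z.2))
    (fun z => mfderiv (𝓡 n) (𝓡 n) (η z.1) ((η z.1).symm z.2)) (t₀, x₀) with hA
  set νhat : Model n → ℝ := fun y => ν.form ((extChartAt (𝓡 n) p₀).symm y)
    (fun i => coordVec p₀ y i) with hνhat
  have hpsrc : ∀ᶠ z : ℝ × M in 𝓝 (t₀, x₀), (η z.1).symm z.2 ∈ (extChartAt (𝓡 n) p₀).source :=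
    hinv.continuousAt.preimage_mem_nhds (extChartAt_source_mem_nhds p₀)
  have hsrc : ∀ᶠ z : ℝ × M in 𝓝 (t₀, x₀), z.2 ∈ (extChartAt (𝓡 n) x₀).source :=
    continuousAt_snd.preimage_mem_nhds (extChartAt_source_mem_nhds x₀)
  have hdet : ∀ z : ℝ × M, (η z.1).symm z.2 ∈ (extChartAt (𝓡 n) p₀).source →
      z.2 ∈ (extChartAt (𝓡 n) x₀).source →
      (A z).det ≠ 0 ∧ νhat (extChartAt (𝓡 n) p₀ ((η z.1).symm z.2)) ≠ 0 ∧
      density g ν (η z.1) z.2 = |νhat (extChartAt (𝓡 n) p₀ ((η z.1).symm z.2))| /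
        (volDensity g x₀ (extChartAt (𝓡 n) x₀ z.2) * |(A z).det|) := by
    rintro ⟨t, x⟩ hz1 hz2
    obtain ⟨p, rfl⟩ : ∃ p, η t p = x := ⟨(η t).symm x, (η t).apply_symm_apply x⟩
    simp only [Diffeomorph.symm_apply_apply] at hz1 hz2 ⊢
    obtain ⟨y, hy, rfl⟩ : ∃ y ∈ (extChartAt (𝓡 n) p₀).target, (extChartAt (𝓡 n) p₀).symm y = p :=
      ⟨_, (extChartAt (𝓡 n) p₀).map_source hz1, (extChartAt (𝓡 n) p₀).left_inv hz1⟩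
    set p := (extChartAt (𝓡 n) p₀).symm y with hp
    have hpy : extChartAt (𝓡 n) p₀ p = y := (extChartAt (𝓡 n) p₀).right_inv hy
    rw [hpy]
    set L : Model n →L[ℝ] Model n := chartSymmDeriv p₀ y with hL
    have hLne : L.det ≠ 0 := by
      have hinj : Function.Injective (L : Model n →ₗ[ℝ] Model n) :=
        Function.LeftInverse.injective (chartDeriv_chartSymmDeriv hy)
      exact ((LinearEquiv.ofInjectiveEndo _ hinj).isUnit_det').ne_zero
    have hν : νhat y = L.det * ν.frame p := ν.form_comp p L
    have hAz : A (t, η t p) = (chartMFDeriv (n := n) (η t) x₀ p).comp L := by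
      have hA1 : A (t, η t p) = (show Model n →L[ℝ] Model n from
          (mfderiv (𝓡 n) 𝓘(ℝ, Model n) (extChartAt (𝓡 n) (η t₀ ((η t₀).symm x₀)))
            (η t ((η t).symm (η t p)))).comp
          ((mfderiv (𝓡 n) (𝓡 n) (η t) ((η t).symm (η t p))).comp
          (mfderivWithin 𝓘(ℝ, Model n) (𝓡 n) (extChartAt (𝓡 n) p₀).symm (range (𝓡 n))
            (extChartAt (𝓡 n) p₀ ((η t).symm (η t p)))))) := by
        rw [hA]
        refine inTangentCoordinates_eq_mfderiv_comp (I := 𝓡 n) (I' := 𝓡 n)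
          (f := fun z : ℝ × M => (η z.1).symm z.2) (g := fun z => η z.1 ((η z.1).symm z.2))
          (ϕ := fun z => mfderiv (𝓡 n) (𝓡 n) (η z.1) ((η z.1).symm z.2))
          (x₀ := (t₀, x₀)) (x := (t, η t p)) ?_ ?_
        · simp only [Diffeomorph.symm_apply_apply]
          exact mem_chart_source_iff.2 hz1
        · simp only [Diffeomorph.apply_symm_apply]
          exact mem_chart_source_iff.2 hz2
      rw [hA1]
      have key : ∀ (q : N) (x : M) (w : Model n), q = p → x = x₀ → w = y →
          (show Model n →L[ℝ] Model n from
          (mfderiv (𝓡 n) 𝓘(ℝ, Model n) (extChartAt (𝓡 n) x) (η t q)).comp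
          ((mfderiv (𝓡 n) (𝓡 n) (η t) q).comp
          (mfderivWithin 𝓘(ℝ, Model n) (𝓡 n) (extChartAt (𝓡 n) p₀).symm (range (𝓡 n)) w))) =
          (chartMFDeriv (n := n) (η t) x₀ p).comp L := by
        rintro _ _ _ rfl rfl rfl
        rw [ModelWithCorners.range_eq_univ, mfderivWithin_univ]
        rfl
      exact key _ _ _ ((η t).symm_apply_apply p) ((η t₀).apply_symm_apply x₀)
        (by rw [(η t).symm_apply_apply p, hpy])
    have hAd : (A (t, η t p)).det = (chartMFDeriv (n := n) (η t) x₀ p).det * L.det := by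
      rw [hAz]
      exact LinearMap.det_comp _ _
    have hcne := chartMFDeriv_det_ne_zero (η t) hz2
    refine ⟨by rw [hAd]; exact mul_ne_zero hcne hLne,
      by rw [hν]; exact mul_ne_zero hLne (ν.frame_ne_zero p), ?_⟩
    rw [density_eq g ν (η t) hz2, hAd, hν, abs_mul, abs_mul]
    have v1 := volDensity_pos g ((extChartAt (𝓡 n) x₀).map_source hz2)
    have a1 := abs_pos.2 hcne
    have a2 := abs_pos.2 hLne
    field_simp
  have hνs : ContMDiffAt (𝓘(ℝ, ℝ).prod (𝓡 n)) 𝓘(ℝ, ℝ) ∞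
      (fun z : ℝ × M => νhat (extChartAt (𝓡 n) p₀ ((η z.1).symm z.2))) (t₀, x₀) := by
    have h1 : ContMDiffAt (𝓘(ℝ, ℝ).prod (𝓡 n)) 𝓘(ℝ, Model n) ∞
        (fun z : ℝ × M => extChartAt (𝓡 n) p₀ ((η z.1).symm z.2)) (t₀, x₀) :=
      ContMDiffAt.comp (t₀, x₀) (g := extChartAt (𝓡 n) p₀) contMDiffAt_extChartAt hinv
    refine ContMDiffAt.comp (t₀, x₀) (g := νhat) ?_ h1
    exact ((ν.smooth p₀).contDiffAt ((isOpen_chart_target p₀).mem_nhds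
      (mem_extChartAt_target p₀))).contMDiffAt
  have hvs : ContMDiffAt (𝓘(ℝ, ℝ).prod (𝓡 n)) 𝓘(ℝ, ℝ) ∞
      (fun z : ℝ × M => volDensity g x₀ (extChartAt (𝓡 n) x₀ z.2)) (t₀, x₀) := by
    have h1 : ContMDiffAt (𝓘(ℝ, ℝ).prod (𝓡 n)) 𝓘(ℝ, Model n) ∞
        (fun z : ℝ × M => extChartAt (𝓡 n) x₀ z.2) (t₀, x₀) :=
      ContMDiffAt.comp (t₀, x₀) (g := extChartAt (𝓡 n) x₀) contMDiffAt_extChartAt contMDiffAt_snd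
    refine ContMDiffAt.comp (t₀, x₀) (g := volDensity g x₀) ?_ h1
    exact ((contDiffOn_volDensity g x₀).contDiffAt ((isOpen_chart_target x₀).mem_nhds
      (mem_extChartAt_target x₀))).contMDiffAt
  have hdets : ContDiff ℝ ∞ (fun B : Model n →L[ℝ] Model n => B.det) := by
    set b := (EuclideanSpace.basisFun (Fin n) ℝ).toBasis with hb
    have : (fun B : Model n →L[ℝ] Model n => B.det) = fun B =>
        ∑ σ : Equiv.Perm (Fin n), ((Equiv.Perm.sign σ : ℤ) : ℝ) * ∏ i,
          (B (EuclideanSpace.single i 1)) (σ i) := by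
      ext B
      have h1 : B.det = (LinearMap.toMatrix b b (B : Model n →ₗ[ℝ] Model n)).det := by
        rw [LinearMap.det_toMatrix]
      rw [h1, Matrix.det_apply']
      refine Finset.sum_congr rfl fun σ _ => ?_
      congr 1
    rw [this]
    refine ContDiff.sum fun σ _ => contDiff_const.mul (contDiff_prod fun i _ => ?_)
    have h2 : ContDiff ℝ ∞ fun B : Model n →L[ℝ] Model n => B (EuclideanSpace.single i 1) :=
      contDiff_id.clm_apply contDiff_const
    exact (EuclideanSpace.proj (𝕜 := ℝ) (σ i)).contDiff.comp h2
  have hAs : ContMDiffAt (𝓘(ℝ, ℝ).prod (𝓡 n)) 𝓘(ℝ, ℝ) ∞ (fun z : ℝ × M => (A z).det) (t₀, x₀) :=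
    ContMDiffAt.comp (t₀, x₀) (g := fun B : Model n →L[ℝ] Model n => B.det)
      hdets.contMDiff.contMDiffAt hder
  obtain ⟨hd1, hd2, -⟩ := hdet (t₀, x₀) hpsrc.self_of_nhds hsrc.self_of_nhds
  -- The absolute values in the density do no harm to smoothness because their arguments do not
  -- vanish.
  have habs : ∀ {φ : ℝ × M → ℝ}, ContMDiffAt (𝓘(ℝ, ℝ).prod (𝓡 n)) 𝓘(ℝ, ℝ) ∞ φ (t₀, x₀) →
      φ (t₀, x₀) ≠ 0 →
      ContMDiffAt (𝓘(ℝ, ℝ).prod (𝓡 n)) 𝓘(ℝ, ℝ) ∞ (fun z => |φ z|) (t₀, x₀) := fun h hne =>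
    ContMDiffAt.comp (t₀, x₀) (g := fun r : ℝ => |r|) (contDiffAt_abs hne).contMDiffAt h
  have hfin : ContMDiffAt (𝓘(ℝ, ℝ).prod (𝓡 n)) 𝓘(ℝ, ℝ) ∞ (fun z : ℝ × M =>
      |νhat (extChartAt (𝓡 n) p₀ ((η z.1).symm z.2))| /
        (volDensity g x₀ (extChartAt (𝓡 n) x₀ z.2) * |(A z).det|)) (t₀, x₀) := by
    refine (habs hνs hd2).div₀ (hvs.mul (habs hAs hd1)) ?_
    exact mul_ne_zero (volDensity_pos g (mem_extChartAt_target x₀)).ne' (abs_pos.2 hd1).ne'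
  refine hfin.congr_of_eventuallyEq ?_
  filter_upwards [hpsrc, hsrc] with z h1 h2
  exact (hdet z h1 h2).2.2

end Density

end BarotropicFlow

/-! ### Eulerian quantities in a chart and conservation of mass. -/

namespace BarotropicFlow

section Coordinates

open Filter Topology

variable {n : ℕ}
  {N : Type*} [TopologicalSpace N] [ChartedSpace (Model n) N]
  {M : Type*} [TopologicalSpace M] [ChartedSpace (Model n) M]

/-- The Eulerian velocity in the chart at `x₀`. -/
noncomputable def velC (η : ℝ → N ≃ₘ⟮𝓡 n, 𝓡 n⟯ M) (x₀ : M) (z : ℝ × Model n) : Model n :=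
  fieldCoord x₀ (eulerVelocity η z.1) z.2

/-- The Eulerian rate in the chart at `x₀`. -/
noncomputable def rateC (η : ℝ → N ≃ₘ⟮𝓡 n, 𝓡 n⟯ M) (F : ℝ → C^∞⟮𝓡 n, N; 𝓘(ℝ, ℝ), ℝ⟯) (x₀ : M)
    (z : ℝ × Model n) : ℝ :=
  eulerRate η F z.1 ((extChartAt (𝓡 n) x₀).symm z.2)

variable [IsManifold (𝓡 n) ∞ M]

/-- The density in the chart at `x₀`. -/
noncomputable def densC (g : Metric n M) (ν : VolumeForm n N) (η : ℝ → N ≃ₘ⟮𝓡 n, 𝓡 n⟯ M) (x₀ : M)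
    (z : ℝ × Model n) : ℝ :=
  density g ν (η z.1) ((extChartAt (𝓡 n) x₀).symm z.2)

/-- The mass density with respect to Lebesgue measure in the chart at `x₀`. -/
noncomputable def massC (g : Metric n M) (ν : VolumeForm n N) (η : ℝ → N ≃ₘ⟮𝓡 n, 𝓡 n⟯ M) (x₀ : M)
    (z : ℝ × Model n) : ℝ :=
  densC g ν η x₀ z * volDensity g x₀ z.2

theorem contMDiffAt_chart_symm_prod {x₀ : M} {t : ℝ} {y : Model n}
    (hy : y ∈ (extChartAt (𝓡 n) x₀).target) :
    ContMDiffAt 𝓘(ℝ, ℝ × Model n) (𝓘(ℝ, ℝ).prod (𝓡 n)) ∞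
      (fun z : ℝ × Model n => (z.1, (extChartAt (𝓡 n) x₀).symm z.2)) (t, y) := by
  refine contDiff_fst.contMDiff.contMDiffAt.prodMk ?_
  exact ContMDiffAt.comp (t, y) (g := (extChartAt (𝓡 n) x₀).symm) (f := Prod.snd)
    ((contMDiffOn_extChartAt_symm x₀).contMDiffAt ((isOpen_chart_target x₀).mem_nhds hy))
    contDiff_snd.contMDiff.contMDiffAt

theorem contDiffAt_comp_chart_symm {V : Type*} [NormedAddCommGroup V] [NormedSpace ℝ V]
    {h : ℝ × M → V} {x₀ : M} {t : ℝ} {y : Model n} (hy : y ∈ (extChartAt (𝓡 n) x₀).target)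
    (hh : ContMDiffAt (𝓘(ℝ, ℝ).prod (𝓡 n)) 𝓘(ℝ, V) ∞ h (t, (extChartAt (𝓡 n) x₀).symm y)) :
    ContDiffAt ℝ ∞ (fun z : ℝ × Model n => h (z.1, (extChartAt (𝓡 n) x₀).symm z.2)) (t, y) := by
  rw [← contMDiffAt_iff_contDiffAt]
  exact ContMDiffAt.comp (t, y) (g := h) hh (contMDiffAt_chart_symm_prod hy)

variable {η : ℝ → N ≃ₘ⟮𝓡 n, 𝓡 n⟯ M} {F : ℝ → C^∞⟮𝓡 n, N; 𝓘(ℝ, ℝ), ℝ⟯} {J : Set ℝ}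

theorem contDiffOn_rateC (hJ : IsOpen J)
    (hη : ContMDiffOn (𝓘(ℝ, ℝ).prod (𝓡 n)) (𝓡 n) ∞ (fun z : ℝ × N => η z.1 z.2) (J ×ˢ univ))
    (hF : ContMDiffOn (𝓘(ℝ, ℝ).prod (𝓡 n)) 𝓘(ℝ, ℝ) ∞ (fun z : ℝ × N => F z.1 z.2) (J ×ˢ univ))
    (x₀ : M) : ContDiffOn ℝ ∞ (rateC η F x₀) (J ×ˢ (extChartAt (𝓡 n) x₀).target) :=
  fun _ hz => (contDiffAt_comp_chart_symm hz.2
    (contMDiffAt_eulerRate hJ hη hF hz.1 _)).contDiffWithinAt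

theorem contDiffOn_velC (hJ : IsOpen J)
    (hη : ContMDiffOn (𝓘(ℝ, ℝ).prod (𝓡 n)) (𝓡 n) ∞ (fun z : ℝ × N => η z.1 z.2) (J ×ˢ univ))
    (x₀ : M) : ContDiffOn ℝ ∞ (velC η x₀) (J ×ˢ (extChartAt (𝓡 n) x₀).target) := by
  rintro ⟨t, y⟩ ⟨ht, hy⟩
  have hs := (extChartAt (𝓡 n) x₀).map_target hy
  have hm : (⟨(extChartAt (𝓡 n) x₀).symm y, eulerVelocity η t ((extChartAt (𝓡 n) x₀).symm y)⟩ :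
      TangentBundle (𝓡 n) M) ∈
      (trivializationAt (Model n) (TangentSpace (𝓡 n)) x₀).source := by
    rw [TangentBundle.trivializationAt_source]
    exact mem_chart_source_iff.2 hs
  have h1 := contMDiffAt_eulerVelocity hJ hη ht ((extChartAt (𝓡 n) x₀).symm y)
  rw [Bundle.Trivialization.contMDiffAt_iff (f := fun z : ℝ × M =>
    (⟨z.2, eulerVelocity η z.1 z.2⟩ : TangentBundle (𝓡 n) M)) hm] at h1
  have h2 := contDiffAt_comp_chart_symm hy h1.2
  refine (h2.congr_of_eventuallyEq ?_).contDiffWithinAt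
  filter_upwards [continuousAt_snd.preimage_mem_nhds ((isOpen_chart_target x₀).mem_nhds hy)] with z hz
  have hz' := mem_chart_source_iff.2 ((extChartAt (𝓡 n) x₀).map_target hz)
  rw [← Bundle.Trivialization.continuousLinearMapAt_apply_of_mem (R := ℝ) _ hz',
    TangentBundle.continuousLinearMapAt_trivializationAt hz']
  rfl

theorem densC_pos (g : Metric n M) (ν : VolumeForm n N) (η : ℝ → N ≃ₘ⟮𝓡 n, 𝓡 n⟯ M) (x₀ : M)
    (z : ℝ × Model n) : 0 < densC g ν η x₀ z := density_pos _ _ _ _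

variable [IsManifold (𝓡 n) ∞ N]

theorem contDiffOn_densC (g : Metric n M) (ν : VolumeForm n N) (hJ : IsOpen J)
    (hη : ContMDiffOn (𝓘(ℝ, ℝ).prod (𝓡 n)) (𝓡 n) ∞ (fun z : ℝ × N => η z.1 z.2) (J ×ˢ univ))
    (x₀ : M) : ContDiffOn ℝ ∞ (densC g ν η x₀) (J ×ˢ (extChartAt (𝓡 n) x₀).target) :=
  fun _ hz => (contDiffAt_comp_chart_symm hz.2
    (contMDiffAt_density g ν hJ hη hz.1 _)).contDiffWithinAt

theorem contDiffOn_massC (g : Metric n M) (ν : VolumeForm n N) (hJ : IsOpen J)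
    (hη : ContMDiffOn (𝓘(ℝ, ℝ).prod (𝓡 n)) (𝓡 n) ∞ (fun z : ℝ × N => η z.1 z.2) (J ×ˢ univ))
    (x₀ : M) : ContDiffOn ℝ ∞ (massC g ν η x₀) (J ×ˢ (extChartAt (𝓡 n) x₀).target) :=
  (contDiffOn_densC g ν hJ hη x₀).mul
    ((contDiffOn_volDensity g x₀).comp contDiffOn_snd fun _ hz => hz.2)

/-- Used with `a = 1` and `w` the velocity, to pass between the material derivative and partial
derivatives. -/
theorem fderiv_apply_eq_sum {n : ℕ} {h : ℝ × Model n → ℝ} {z : ℝ × Model n} (a : ℝ) (w : Model n) :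
    fderiv ℝ h z (a, w) = a * fderiv ℝ h z (1, 0) +
      ∑ i, w i * fderiv ℝ h z (0, EuclideanSpace.single i 1) := by
  have h1 : (a, w) = a • ((1 : ℝ), (0 : Model n)) +
      ∑ i, w i • ((0 : ℝ), (EuclideanSpace.single i (1 : ℝ) : Model n)) := by
    rw [Prod.ext_iff]
    constructor
    · simp [Prod.fst_sum]
    · simp only [Prod.snd_add, Prod.smul_snd, smul_zero, Prod.snd_sum, zero_add]
      exact model_sum_single w
  rw [h1, map_add, map_smul, map_sum]
  simp only [map_smul, smul_eq_mul]

/-- Conservation of mass in a chart, in advective form. -/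
theorem continuity_advective (g : Metric n M) (ν : VolumeForm n N) (hJ : IsOpen J)
    (hη : ContMDiffOn (𝓘(ℝ, ℝ).prod (𝓡 n)) (𝓡 n) ∞ (fun z : ℝ × N => η z.1 z.2) (J ×ˢ univ))
    (x₀ : M) {t : ℝ} (ht : t ∈ J) {y : Model n} (hy : y ∈ (extChartAt (𝓡 n) x₀).target) :
    fderiv ℝ (massC g ν η x₀) (t, y) (1, velC η x₀ (t, y)) + massC g ν η x₀ (t, y) *
      ∑ i, fderiv ℝ (fun z => velC η x₀ z i) (t, y) (0, EuclideanSpace.single i 1) = 0 := by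
  have hUo : IsOpen (J ×ˢ (extChartAt (𝓡 n) x₀).target) := hJ.prod (isOpen_chart_target x₀)
  have hU : (t, y) ∈ J ×ˢ (extChartAt (𝓡 n) x₀).target := ⟨ht, hy⟩
  set back : Model n → N := fun w => (η t).symm ((extChartAt (𝓡 n) x₀).symm w) with hback
  -- `Ψ (τ, w)` is the position at time `τ` of the particle that has coordinates `w` at the fixed
  -- time `t`.
  set Ψ : ℝ × Model n → M := fun z => η z.1 (back z.2) with hΨ
  have hΨs : ContMDiffAt 𝓘(ℝ, ℝ × Model n) (𝓡 n) ∞ Ψ (t, y) := by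
    have h1 : ContMDiffAt 𝓘(ℝ, ℝ × Model n) (𝓘(ℝ, ℝ).prod (𝓡 n)) ∞
        (fun z : ℝ × Model n => (z.1, back z.2)) (t, y) := by
      refine contDiff_fst.contMDiff.contMDiffAt.prodMk (ContMDiffAt.comp (t, y) (g := back)
        (f := Prod.snd) ?_ contDiff_snd.contMDiff.contMDiffAt)
      exact (η t).symm.contMDiff.contMDiffAt.comp y ((contMDiffOn_extChartAt_symm x₀).contMDiffAt
        ((isOpen_chart_target x₀).mem_nhds hy))
    exact ContMDiffAt.comp (t, y) (g := fun z : ℝ × N => η z.1 z.2)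
      (hη.contMDiffAt ((hJ.prod isOpen_univ).mem_nhds ⟨ht, mem_univ _⟩)) h1
  have hΨt : ∀ w, Ψ (t, w) = (extChartAt (𝓡 n) x₀).symm w := fun w => by
    simp only [hΨ, hback, Diffeomorph.apply_symm_apply]
  have hΨsrc : ∀ᶠ z in 𝓝 (t, y), Ψ z ∈ (extChartAt (𝓡 n) x₀).source := by
    refine hΨs.continuousAt.preimage_mem_nhds ((isOpen_chart_source x₀).mem_nhds ?_)
    rw [hΨt]
    exact (extChartAt (𝓡 n) x₀).map_target hy
  set θ : ℝ × Model n → Model n := fun z => extChartAt (𝓡 n) x₀ (Ψ z) with hθ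
  have hθt : ∀ w ∈ (extChartAt (𝓡 n) x₀).target, θ (t, w) = w := fun w hw => by
    simp only [hθ, hΨt]
    exact (extChartAt (𝓡 n) x₀).right_inv hw
  have hθs : ContDiffAt ℝ ∞ θ (t, y) := by
    rw [← contMDiffAt_iff_contDiffAt]
    refine ContMDiffAt.comp (t, y) (g := extChartAt (𝓡 n) x₀) ?_ hΨs
    refine (contMDiffOn_extChartAt (x := x₀)).contMDiffAt
      ((chartAt (Model n) x₀).open_source.mem_nhds ?_)
    rw [mem_chart_source_iff]
    exact hΨsrc.self_of_nhds
  have hθd : ∀ᶠ z in 𝓝 (t, y), HasFDerivAt θ (fderiv ℝ θ z) z := by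
    have h1 : ContDiffAt ℝ 1 θ (t, y) := hθs.of_le (by simp)
    filter_upwards [h1.eventually (by simp)] with z hz
    exact (hz.differentiableAt (by simp)).hasFDerivAt
  have hJe : ∀ᶠ z : ℝ × Model n in 𝓝 (t, y), z.1 ∈ J :=
    continuousAt_fst.preimage_mem_nhds (hJ.mem_nhds ht)
  have hdt : ∀ᶠ z in 𝓝 (t, y), fderiv ℝ θ z (1, 0) = velC η x₀ (z.1, θ z) := by
    filter_upwards [hθd, hJe, hΨsrc] with z hz hzJ hzs
    have h1 : HasDerivAt (fun τ => θ (τ, z.2)) (fderiv ℝ θ z (1, 0)) z.1 :=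
      HasFDerivAt.comp_hasDerivAt (f := fun τ : ℝ => (τ, z.2)) z.1 hz
        ((hasDerivAt_id z.1).prodMk (hasDerivAt_const z.1 z.2))
    have h2 := hasDerivAt_chart_curve hJ hη hzJ (back z.2) (x₀ := x₀) hzs
    exact h1.unique h2
  have hvs : ContDiffAt ℝ ∞ (velC η x₀) (t, y) :=
    (contDiffOn_velC hJ hη x₀).contDiffAt (hUo.mem_nhds hU)
  have hms : ContDiffAt ℝ ∞ (massC g ν η x₀) (t, y) :=
    (contDiffOn_massC g ν hJ hη x₀).contDiffAt (hUo.mem_nhds hU)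
  have hvd := (hvs.differentiableAt (by simp)).hasFDerivAt
  have hmd := (hms.differentiableAt (by simp)).hasFDerivAt
  have hdy : ∀ w, fderiv ℝ θ (t, y) (0, w) = w := by
    intro w
    have h1 : HasFDerivAt (fun w => θ (t, w)) ((fderiv ℝ θ (t, y)).comp
        (ContinuousLinearMap.inr ℝ ℝ (Model n))) y :=
      hθd.self_of_nhds.comp y (hasFDerivAt_prodMk_right t y)
    have h2 : HasFDerivAt (fun w => θ (t, w)) (ContinuousLinearMap.id ℝ (Model n)) y := by
      refine (hasFDerivAt_id y).congr_of_eventuallyEq ?_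
      filter_upwards [(isOpen_chart_target x₀).mem_nhds hy] with w hw
      exact hθt w hw
    exact congrArg (fun L : Model n →L[ℝ] Model n => L w) (h1.unique h2)
  have hθ0 : θ (t, y) = y := hθt y hy
  have hdd : HasFDerivAt (fderiv ℝ θ) (fderiv ℝ (fderiv ℝ θ) (t, y)) (t, y) := by
    have h1 : ContDiffAt ℝ ∞ (fderiv ℝ θ) (t, y) := hθs.fderiv_right (by simp)
    exact (h1.differentiableAt (by simp)).hasFDerivAt
  have hsymm : IsSymmSndFDerivAt ℝ θ (t, y) := hθs.isSymmSndFDerivAt (by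
    rw [minSmoothness_of_isRCLikeNormedField]; exact WithTop.coe_le_coe.2 le_top)
  -- Since `∂θ/∂τ` is the velocity at the moving position, symmetry of the second derivative turns
  -- the time derivative of the Jacobian matrix into the spatial derivative of the velocity.
  have hmixed : ∀ w, fderiv ℝ (fderiv ℝ θ) (t, y) (1, 0) (0, w) =
      fderiv ℝ (velC η x₀) (t, y) (0, w) := by
    intro w
    rw [hsymm.eq]
    have h1 : HasFDerivAt (fun z => fderiv ℝ θ z (1, 0))
        ((fderiv ℝ (fderiv ℝ θ) (t, y)).flip (1, 0)) (t, y) := by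
      simpa using hdd.clm_apply (hasFDerivAt_const ((1 : ℝ), (0 : Model n)) (t, y))
    have h2 : HasFDerivAt (fun z => velC η x₀ (z.1, θ z))
        ((fderiv ℝ (velC η x₀) (t, y)).comp ((ContinuousLinearMap.fst ℝ ℝ (Model n)).prod
          (fderiv ℝ θ (t, y)))) (t, y) := by
      refine HasFDerivAt.comp (g := velC η x₀) (t, y) ?_
        (hasFDerivAt_fst.prodMk hθd.self_of_nhds)
      simp only [hθ0]
      exact hvd
    have h3 := h1.unique (h2.congr_of_eventuallyEq hdt)
    have h4 := congrArg (fun L : (ℝ × Model n) →L[ℝ] Model n => L (0, w)) h3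
    simpa [hdy] using h4
  -- the Jacobian of the flow from time `t`
  set A : ℝ → Matrix (Fin n) (Fin n) ℝ := fun τ => Matrix.of fun i j =>
    fderiv ℝ θ (τ, y) (0, EuclideanSpace.single j 1) i with hA
  set A' : Matrix (Fin n) (Fin n) ℝ := Matrix.of fun i j =>
    fderiv ℝ (fun z => velC η x₀ z i) (t, y) (0, EuclideanSpace.single j 1) with hA'
  have hproj : ∀ i, fderiv ℝ (fun z => velC η x₀ z i) (t, y) =
      (EuclideanSpace.proj (𝕜 := ℝ) i).comp (fderiv ℝ (velC η x₀) (t, y)) := fun i =>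
    (HasFDerivAt.comp (t, y) (g := EuclideanSpace.proj (𝕜 := ℝ) i)
      (EuclideanSpace.proj (𝕜 := ℝ) i).hasFDerivAt hvd).fderiv
  have hAd : ∀ i j, HasDerivAt (fun τ => A τ i j) (A' i j) t := by
    intro i j
    have h1 : HasDerivAt (fun τ => fderiv ℝ θ (τ, y))
        (fderiv ℝ (fderiv ℝ θ) (t, y) (1, 0)) t :=
      HasFDerivAt.comp_hasDerivAt (f := fun τ : ℝ => (τ, y)) t hdd
        ((hasDerivAt_id t).prodMk (hasDerivAt_const t y))
    have h2 : HasDerivAt (fun τ => fderiv ℝ θ (τ, y) (0, EuclideanSpace.single j 1))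
        (fderiv ℝ (fderiv ℝ θ) (t, y) (1, 0) (0, EuclideanSpace.single j 1)) t := by
      simpa using h1.clm_apply (hasDerivAt_const t ((0 : ℝ), (EuclideanSpace.single j 1 : Model n)))
    rw [hmixed] at h2
    have h3 := (EuclideanSpace.proj (𝕜 := ℝ) i).hasFDerivAt.comp_hasDerivAt t h2
    simp only [hA', Matrix.of_apply, hproj]
    exact h3
  have hA1 : A t = 1 := by
    ext i j
    simp only [hA, Matrix.of_apply, hdy, Matrix.one_apply]
    simp
  have hdet := hasDerivAt_det_of_eq_one hAd hA1
  have hline : Tendsto (fun τ : ℝ => (τ, y)) (𝓝 t) (𝓝 (t, y)) :=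
    (Continuous.prodMk_left y).continuousAt
  -- The Jacobian is `1` at time `t`, hence positive nearby; this removes the absolute value in
  -- `density_trans`.
  have hpos : ∀ᶠ τ in 𝓝 t, 0 < (A τ).det :=
    hdet.continuousAt.eventually_const_lt (by
      show 0 < (A t).det
      rw [hA1, Matrix.det_one]; exact one_pos)
  -- Mass conservation in Lagrangian form is `density_trans` for the flow from time `t` to time `τ`.
  -- Differentiating it at `τ = t` with Jacobi's formula gives the claim.
  have hcons : ∀ᶠ τ in 𝓝 t, massC g ν η x₀ (τ, θ (τ, y)) * (A τ).det = massC g ν η x₀ (t, y) := by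
    filter_upwards [hpos, hline.eventually hθd, hline.eventually hΨsrc] with τ h1 h2 h3
    set Ξ : M ≃ₘ⟮𝓡 n, 𝓡 n⟯ M := (η t).symm.trans (η τ) with hΞ
    have hL : HasFDerivAt (fun w => extChartAt (𝓡 n) x₀ (Ξ ((extChartAt (𝓡 n) x₀).symm w)))
        ((fderiv ℝ θ (τ, y)).comp (ContinuousLinearMap.inr ℝ ℝ (Model n))) y :=
      h2.comp y (hasFDerivAt_prodMk_right τ y)
    have h4 := density_trans g ν (η t) Ξ hy h3 hL
    have h5 : (η t).trans Ξ = η τ := by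
      ext p
      show η τ ((η t).symm (η t p)) = η τ p
      rw [Diffeomorph.symm_apply_apply]
    have h6 : ((fderiv ℝ θ (τ, y)).comp (ContinuousLinearMap.inr ℝ ℝ (Model n))).det
        = (A τ).det := by
      set b := (EuclideanSpace.basisFun (Fin n) ℝ).toBasis with hb
      have h7 := LinearMap.det_toMatrix b (((fderiv ℝ θ (τ, y)).comp
        (ContinuousLinearMap.inr ℝ ℝ (Model n)) : Model n →L[ℝ] Model n) :
        Model n →ₗ[ℝ] Model n)
      refine Eq.trans h7.symm ?_
      congr 1
    rw [h5, h6, abs_of_pos h1] at h4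
    have h8 : Ξ ((extChartAt (𝓡 n) x₀).symm y) = (extChartAt (𝓡 n) x₀).symm (θ (τ, y)) :=
      ((extChartAt (𝓡 n) x₀).left_inv h3).symm
    simp only [massC, densC]
    rw [← h8, ← h4]
    show _ = density g ν (η τ) (Ψ (τ, y)) * (volDensity g x₀ (θ (τ, y)) * _)
    rw [mul_assoc]
    rfl
  have hmτ : HasDerivAt (fun τ => massC g ν η x₀ (τ, θ (τ, y)))
      (fderiv ℝ (massC g ν η x₀) (t, y) (1, velC η x₀ (t, y))) t := by
    have h1 : HasDerivAt (fun τ => θ (τ, y)) (velC η x₀ (t, y)) t := by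
      have h2 : HasDerivAt (fun τ => θ (τ, y)) (fderiv ℝ θ (t, y) (1, 0)) t :=
        HasFDerivAt.comp_hasDerivAt (f := fun τ : ℝ => (τ, y)) t hθd.self_of_nhds
          ((hasDerivAt_id t).prodMk (hasDerivAt_const t y))
      rw [hdt.self_of_nhds] at h2
      simpa only [hθ0] using h2
    have h3 : HasFDerivAt (massC g ν η x₀) (fderiv ℝ (massC g ν η x₀) (t, y)) (t, θ (t, y)) := by
      rw [hθ0]; exact hmd
    exact HasFDerivAt.comp_hasDerivAt (f := fun τ : ℝ => (τ, θ (τ, y))) t h3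
      ((hasDerivAt_id t).prodMk h1)
  have hprod := hmτ.mul hdet
  have hconst : HasDerivAt (fun τ => massC g ν η x₀ (τ, θ (τ, y)) * (A τ).det) 0 t :=
    (hasDerivAt_const t _).congr_of_eventuallyEq hcons
  have hfin := hprod.unique hconst
  simp only [hθ0, hA1, Matrix.det_one, mul_one] at hfin
  exact hfin

end Coordinates

end BarotropicFlow

/-! ### Variations supported in a chart. -/

namespace BarotropicFlow

section Variations

open Filter Topology

variable {n : ℕ}
  {N : Type*} [TopologicalSpace N] [ChartedSpace (Model n) N]
  {M : Type*} [TopologicalSpace M] [ChartedSpace (Model n) M]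

open Classical in
/-- A self-map of the model space, transported to the domain of the chart at `x₀` and extended by
the identity. -/
noncomputable def chartExtend (x₀ : M) (e : Model n → Model n) (x : M) : M :=
  if x ∈ (extChartAt (𝓡 n) x₀).source then
    (extChartAt (𝓡 n) x₀).symm (e (extChartAt (𝓡 n) x₀ x)) else x

open Classical in
/-- A function on the model space, transported to the domain of the chart at `x₀` and extended by
zero. -/
noncomputable def chartBump (x₀ : M) (h : Model n → ℝ) (x : M) : ℝ :=
  if x ∈ (extChartAt (𝓡 n) x₀).source then h (extChartAt (𝓡 n) x₀ x) else 0

theorem chartExtend_of_mem {x₀ x : M} (hx : x ∈ (extChartAt (𝓡 n) x₀).source)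
    (e : Model n → Model n) : chartExtend x₀ e x =
      (extChartAt (𝓡 n) x₀).symm (e (extChartAt (𝓡 n) x₀ x)) := if_pos hx

theorem chartExtend_of_notMem {x₀ x : M} (hx : x ∉ (extChartAt (𝓡 n) x₀).source)
    (e : Model n → Model n) : chartExtend x₀ e x = x := if_neg hx

theorem chartExtend_eq_self {x₀ x : M} {K : Set (Model n)} {e : Model n → Model n}
    (he : ∀ y ∉ K, e y = y) (hx : x ∉ (extChartAt (𝓡 n) x₀).symm '' K) :
    chartExtend x₀ e x = x := by
  by_cases hs : x ∈ (extChartAt (𝓡 n) x₀).source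
  · have : extChartAt (𝓡 n) x₀ x ∉ K := fun h => hx ⟨_, h, (extChartAt (𝓡 n) x₀).left_inv hs⟩
    rw [chartExtend_of_mem hs, he _ this, (extChartAt (𝓡 n) x₀).left_inv hs]
  · exact chartExtend_of_notMem hs e

theorem chartBump_of_mem {x₀ x : M} (hx : x ∈ (extChartAt (𝓡 n) x₀).source)
    (h : Model n → ℝ) : chartBump x₀ h x = h (extChartAt (𝓡 n) x₀ x) := if_pos hx

theorem chartBump_eq_zero {x₀ x : M} {K : Set (Model n)} {h : Model n → ℝ}
    (hh : ∀ y ∉ K, h y = 0) (hx : x ∉ (extChartAt (𝓡 n) x₀).symm '' K) :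
    chartBump x₀ h x = 0 := by
  by_cases hs : x ∈ (extChartAt (𝓡 n) x₀).source
  · have : extChartAt (𝓡 n) x₀ x ∉ K := fun h => hx ⟨_, h, (extChartAt (𝓡 n) x₀).left_inv hs⟩
    rw [chartBump_of_mem hs, hh _ this]
  · exact if_neg hs

/-- A point of `K` sent outside `T` would land outside `K`, where `e` is the identity; by
injectivity it would equal its own image, which is absurd. -/
theorem mapsTo_of_eq_off {e : Model n ≃ Model n} {K T : Set (Model n)} (hKT : K ⊆ T)
    (he : ∀ y ∉ K, e y = y) : MapsTo e T T := by
  intro y hy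
  by_cases hyK : y ∈ K
  · by_contra h
    have h1 : e y ∉ K := fun h' => h (hKT h')
    have h2 := e.injective (he _ h1)
    rw [h2] at h1
    exact h1 hyK
  · rwa [he y hyK]

theorem symm_eq_off {e : Model n ≃ Model n} {K : Set (Model n)}
    (he : ∀ y ∉ K, e y = y) : ∀ y ∉ K, e.symm y = y := fun y hy => by
  rw [Equiv.symm_apply_eq, he y hy]

theorem isClosed_chart_symm_image [T2Space M] {x₀ : M} {K : Set (Model n)} (hK : IsCompact K)
    (hKt : K ⊆ (extChartAt (𝓡 n) x₀).target) : IsClosed ((extChartAt (𝓡 n) x₀).symm '' K) :=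
  (hK.image_of_continuousOn ((continuousOn_extChartAt_symm x₀).mono hKt)).isClosed

theorem chart_symm_image_subset {x₀ : M} {K : Set (Model n)}
    (hKt : K ⊆ (extChartAt (𝓡 n) x₀).target) :
    (extChartAt (𝓡 n) x₀).symm '' K ⊆ (extChartAt (𝓡 n) x₀).source := by
  rintro _ ⟨y, hy, rfl⟩
  exact (extChartAt (𝓡 n) x₀).map_target (hKt hy)

variable [IsManifold (𝓡 n) ∞ M]

/-- The chart domain and the complement of the image of `K` are open and cover `M`; on the first the
map has a smooth coordinate expression, on the second it is the identity. The Hausdorff property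
makes the image of `K` closed. The parameter space `P` will carry `s` and `t`. -/
theorem contMDiffAt_chartExtend [T2Space M] {P : Type*} [NormedAddCommGroup P] [NormedSpace ℝ P]
    {x₀ : M} {K : Set (Model n)} (hK : IsCompact K) (hKt : K ⊆ (extChartAt (𝓡 n) x₀).target)
    {e : P → Model n → Model n} (hes : ContDiff ℝ ∞ (fun z : P × Model n => e z.1 z.2))
    (he : ∀ a, ∀ y ∉ K, e a y = y) {a : P}
    (hm : MapsTo (e a) (extChartAt (𝓡 n) x₀).target (extChartAt (𝓡 n) x₀).target) (x : M) :
    ContMDiffAt (𝓘(ℝ, P).prod (𝓡 n)) (𝓡 n) ∞ (fun z : P × M => chartExtend x₀ (e z.1) z.2)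
      (a, x) := by
  by_cases hx : x ∈ (extChartAt (𝓡 n) x₀).source
  · have hev : ∀ᶠ z : P × M in 𝓝 (a, x), z.2 ∈ (extChartAt (𝓡 n) x₀).source :=
      continuousAt_snd.preimage_mem_nhds ((isOpen_chart_source x₀).mem_nhds hx)
    have h1 : ContMDiffAt (𝓘(ℝ, P).prod (𝓡 n)) 𝓘(ℝ, Model n) ∞
        (fun z : P × M => extChartAt (𝓡 n) x₀ z.2) (a, x) :=
      ContMDiffAt.comp (a, x) (g := extChartAt (𝓡 n) x₀) (f := Prod.snd)
        ((contMDiffOn_extChartAt (x := x₀)).contMDiffAt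
          ((chartAt (Model n) x₀).open_source.mem_nhds (mem_chart_source_iff.2 hx)))
        contMDiffAt_snd
    have h2 : ContMDiffAt (𝓘(ℝ, P).prod (𝓡 n)) 𝓘(ℝ, Model n) ∞
        (fun z : P × M => e z.1 (extChartAt (𝓡 n) x₀ z.2)) (a, x) :=
      ContMDiffAt.comp (a, x) (g := fun z : P × Model n => e z.1 z.2)
        hes.contMDiff.contMDiffAt (contMDiffAt_fst.prodMk_space h1)
    have h3 : ContMDiffAt (𝓘(ℝ, P).prod (𝓡 n)) (𝓡 n) ∞
        (fun z : P × M => (extChartAt (𝓡 n) x₀).symm (e z.1 (extChartAt (𝓡 n) x₀ z.2))) (a, x) :=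
      ContMDiffAt.comp (a, x) (g := (extChartAt (𝓡 n) x₀).symm)
        ((contMDiffOn_extChartAt_symm x₀).contMDiffAt ((isOpen_chart_target x₀).mem_nhds
          (hm ((extChartAt (𝓡 n) x₀).map_source hx)))) h2
    refine h3.congr_of_eventuallyEq ?_
    filter_upwards [hev] with z hz
    exact chartExtend_of_mem hz _
  · have hx' : x ∉ (extChartAt (𝓡 n) x₀).symm '' K := fun h => hx (chart_symm_image_subset hKt h)
    have hev : ∀ᶠ z : P × M in 𝓝 (a, x), z.2 ∉ (extChartAt (𝓡 n) x₀).symm '' K :=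
      have h1 : ∀ᶠ w in 𝓝 x, w ∉ (extChartAt (𝓡 n) x₀).symm '' K :=
        (isClosed_chart_symm_image hK hKt).isOpen_compl.mem_nhds hx'
      (continuous_snd.tendsto (a, x)).eventually h1
    refine contMDiffAt_snd.congr_of_eventuallyEq ?_
    filter_upwards [hev] with z hz
    exact chartExtend_eq_self (he z.1) hz

theorem contMDiff_chartBump [T2Space M] {P : Type*} [NormedAddCommGroup P] [NormedSpace ℝ P]
    {x₀ : M} {K : Set (Model n)} (hK : IsCompact K) (hKt : K ⊆ (extChartAt (𝓡 n) x₀).target)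
    {h : P → Model n → ℝ} (hs : ContDiff ℝ ∞ (fun z : P × Model n => h z.1 z.2))
    (h0 : ∀ a, ∀ y ∉ K, h a y = 0) :
    ContMDiff (𝓘(ℝ, P).prod (𝓡 n)) 𝓘(ℝ, ℝ) ∞ (fun z : P × M => chartBump x₀ (h z.1) z.2) := by
  rintro ⟨a, x⟩
  by_cases hx : x ∈ (extChartAt (𝓡 n) x₀).source
  · have hev : ∀ᶠ z : P × M in 𝓝 (a, x), z.2 ∈ (extChartAt (𝓡 n) x₀).source :=
      continuousAt_snd.preimage_mem_nhds ((isOpen_chart_source x₀).mem_nhds hx)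
    have h1 : ContMDiffAt (𝓘(ℝ, P).prod (𝓡 n)) 𝓘(ℝ, Model n) ∞
        (fun z : P × M => extChartAt (𝓡 n) x₀ z.2) (a, x) :=
      ContMDiffAt.comp (a, x) (g := extChartAt (𝓡 n) x₀) (f := Prod.snd)
        ((contMDiffOn_extChartAt (x := x₀)).contMDiffAt
          ((chartAt (Model n) x₀).open_source.mem_nhds (mem_chart_source_iff.2 hx)))
        contMDiffAt_snd
    have h2 : ContMDiffAt (𝓘(ℝ, P).prod (𝓡 n)) 𝓘(ℝ, ℝ) ∞
        (fun z : P × M => h z.1 (extChartAt (𝓡 n) x₀ z.2)) (a, x) :=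
      ContMDiffAt.comp (a, x) (g := fun z : P × Model n => h z.1 z.2)
        hs.contMDiff.contMDiffAt (contMDiffAt_fst.prodMk_space h1)
    refine h2.congr_of_eventuallyEq ?_
    filter_upwards [hev] with z hz
    exact chartBump_of_mem hz _
  · have hx' : x ∉ (extChartAt (𝓡 n) x₀).symm '' K := fun h => hx (chart_symm_image_subset hKt h)
    have hev : ∀ᶠ z : P × M in 𝓝 (a, x), z.2 ∉ (extChartAt (𝓡 n) x₀).symm '' K :=
      have h1 : ∀ᶠ w in 𝓝 x, w ∉ (extChartAt (𝓡 n) x₀).symm '' K :=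
        (isClosed_chart_symm_image hK hKt).isOpen_compl.mem_nhds hx'
      (continuous_snd.tendsto (a, x)).eventually h1
    refine (contMDiffAt_const (c := (0 : ℝ))).congr_of_eventuallyEq ?_
    filter_upwards [hev] with z hz
    exact chartBump_eq_zero (h0 z.1) hz

theorem exists_diffeomorph_chartExtend [T2Space M] {x₀ : M} {K : Set (Model n)} (hK : IsCompact K)
    (hKt : K ⊆ (extChartAt (𝓡 n) x₀).target) (e : Model n ≃ Model n) (he : ∀ y ∉ K, e y = y)
    (hs : ContDiff ℝ ∞ e) (hs' : ContDiff ℝ ∞ e.symm) :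
    ∃ Φ : M ≃ₘ⟮𝓡 n, 𝓡 n⟯ M, ∀ x, Φ x = chartExtend x₀ e x := by
  have hinv : ∀ (e : Model n ≃ Model n), (∀ y ∉ K, e y = y) →
      Function.LeftInverse (chartExtend x₀ e.symm) (chartExtend (M := M) x₀ e) := by
    intro e he x
    by_cases hx : x ∈ (extChartAt (𝓡 n) x₀).source
    · have h1 := mapsTo_of_eq_off hKt he ((extChartAt (𝓡 n) x₀).map_source hx)
      rw [chartExtend_of_mem hx, chartExtend_of_mem ((extChartAt (𝓡 n) x₀).map_target h1),
        (extChartAt (𝓡 n) x₀).right_inv h1, Equiv.symm_apply_apply,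
        (extChartAt (𝓡 n) x₀).left_inv hx]
    · rw [chartExtend_of_notMem hx, chartExtend_of_notMem hx]
  have hsm : ∀ (e : Model n ≃ Model n), (∀ y ∉ K, e y = y) → ContDiff ℝ ∞ e →
      ContMDiff (𝓡 n) (𝓡 n) ∞ (chartExtend (M := M) x₀ e) := by
    intro e he hs x
    have h1 := contMDiffAt_chartExtend (P := ℝ) hK hKt (e := fun _ => e)
      (hs.comp contDiff_snd) (fun _ => he) (a := 0) (mapsTo_of_eq_off hKt he) x
    exact ContMDiffAt.comp x (g := fun z : ℝ × M => chartExtend x₀ e z.2) (f := fun x => (0, x)) h1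
      (contMDiffAt_const.prodMk contMDiffAt_id)
  exact ⟨{ toFun := chartExtend x₀ e
           invFun := chartExtend x₀ e.symm
           left_inv := hinv e he
           right_inv := hinv e.symm (symm_eq_off he)
           contMDiff_toFun := hsm e he hs
           contMDiff_invFun := hsm e.symm (symm_eq_off he) hs' }, fun x => rfl⟩

variable {η : ℝ → N ≃ₘ⟮𝓡 n, 𝓡 n⟯ M} {F : ℝ → C^∞⟮𝓡 n, N; 𝓘(ℝ, ℝ), ℝ⟯} {J : Set ℝ}

/-- The displacement `y ↦ y + s χ(t, y) v`. -/
def displace (χ : ℝ × Model n → ℝ) (v : Model n) (s t : ℝ) (y : Model n) : Model n :=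
  y + (s * χ (t, y)) • v

theorem eq_zero_of_notMem_snd_tsupport {χ : ℝ × Model n → ℝ} {y : Model n}
    (hy : y ∉ Prod.snd '' tsupport χ) (t : ℝ) : χ (t, y) = 0 :=
  image_eq_zero_of_notMem_tsupport fun h => hy ⟨_, h, rfl⟩

/-- The variation of a curve which displaces the first component in the direction `v` in a chart
and shifts the second component. -/
theorem exists_variation [T2Space M]
    (hη : ContMDiffOn (𝓘(ℝ, ℝ).prod (𝓡 n)) (𝓡 n) ∞ (fun z : ℝ × N => η z.1 z.2) (J ×ˢ univ))
    (hF : ContMDiffOn (𝓘(ℝ, ℝ).prod (𝓡 n)) 𝓘(ℝ, ℝ) ∞ (fun z : ℝ × N => F z.1 z.2) (J ×ˢ univ))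
    (x₀ : M) {a b : ℝ} {χ₁ χ₂ : ℝ × Model n → ℝ} (v : Model n)
    (h1 : ContDiff ℝ ∞ χ₁) (h1c : HasCompactSupport χ₁)
    (h1s : tsupport χ₁ ⊆ Ioo a b ×ˢ (extChartAt (𝓡 n) x₀).target)
    (h2 : ContDiff ℝ ∞ χ₂) (h2c : HasCompactSupport χ₂)
    (h2s : tsupport χ₂ ⊆ Ioo a b ×ˢ (extChartAt (𝓡 n) x₀).target) :
    ∃ ε > 0, ∃ (Φ : ℝ → ℝ → M ≃ₘ⟮𝓡 n, 𝓡 n⟯ M) (K : ℝ → ℝ → C^∞⟮𝓡 n, N; 𝓘(ℝ, ℝ), ℝ⟯),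
      IsProperVariation η F J a b ε (fun s t => (η t).trans (Φ s t)) K ∧
      (∀ s ∈ Ioo (-ε) ε, ∀ t, (∀ y, 0 < 1 + s * fderiv ℝ χ₁ (t, y) (0, v)) ∧
        (∃ e : Model n ≃ Model n, ⇑e = displace χ₁ v s t) ∧
        ∀ x, Φ s t x = chartExtend x₀ (displace χ₁ v s t) x) ∧
      ∀ s t p, K s t p = F t p + s * chartBump x₀ (fun y => χ₂ (t, y)) (η t p) := by
  obtain ⟨ε, hε, hεs⟩ := exists_equiv_add_smul h1 h1c v
  set K₁ := Prod.snd '' tsupport χ₁ with hK₁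
  set K₂ := Prod.snd '' tsupport χ₂ with hK₂
  have hK₁c : IsCompact K₁ := IsCompact.image h1c continuous_snd
  have hK₂c : IsCompact K₂ := IsCompact.image h2c continuous_snd
  have hK₁t : K₁ ⊆ (extChartAt (𝓡 n) x₀).target := by
    rintro _ ⟨z, hz, rfl⟩; exact (h1s hz).2
  have hK₂t : K₂ ⊆ (extChartAt (𝓡 n) x₀).target := by
    rintro _ ⟨z, hz, rfl⟩; exact (h2s hz).2
  have hoff : ∀ s t, ∀ y ∉ K₁, displace χ₁ v s t y = y := by
    intro s t y hy
    simp [displace, eq_zero_of_notMem_snd_tsupport hy t]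
  have hoff2 : ∀ t, ∀ y ∉ K₂, χ₂ (t, y) = 0 := fun t y hy => eq_zero_of_notMem_snd_tsupport hy t
  have hend : ∀ {χ : ℝ × Model n → ℝ}, tsupport χ ⊆ Ioo a b ×ˢ (extChartAt (𝓡 n) x₀).target →
      ∀ t ∉ Ioo a b, ∀ y, χ (t, y) = 0 := fun hs t ht y =>
    image_eq_zero_of_notMem_tsupport fun h => ht (hs h).1
  -- A variation is indexed by all real `s`. Outside the small interval, where the displacement may
  -- fail to be invertible, the identity serves as a default.
  have hex : ∀ s t, ∃ Φ : M ≃ₘ⟮𝓡 n, 𝓡 n⟯ M, s ∈ Ioo (-ε) ε →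
      ∀ x, Φ x = chartExtend x₀ (displace χ₁ v s t) x := by
    intro s t
    by_cases hs : s ∈ Ioo (-ε) ε
    · obtain ⟨-, e, he, he1, he2⟩ := hεs s hs t
      have hee : ⇑e = displace χ₁ v s t := funext he
      obtain ⟨Φ, hΦ⟩ := exists_diffeomorph_chartExtend (M := M) hK₁c hK₁t e
        (by rw [hee]; exact hoff s t) he1 he2
      exact ⟨Φ, fun _ => by rw [← hee]; exact hΦ⟩
    · exact ⟨Diffeomorph.refl (𝓡 n) M ∞, fun h => absurd h hs⟩
  choose Φ hΦ using hex
  have hbump : ContMDiff (𝓘(ℝ, ℝ).prod (𝓡 n)) 𝓘(ℝ, ℝ) ∞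
      (fun z : ℝ × M => chartBump x₀ (fun y => χ₂ (z.1, y)) z.2) :=
    contMDiff_chartBump (h := fun t y => χ₂ (t, y)) hK₂c hK₂t h2 hoff2
  have hbumpη : ∀ t, ContMDiff (𝓡 n) 𝓘(ℝ, ℝ) ∞
      (fun p => chartBump x₀ (fun y => χ₂ (t, y)) (η t p)) := fun t =>
    ContMDiff.comp (g := fun z : ℝ × M => chartBump x₀ (fun y => χ₂ (z.1, y)) z.2)
      (f := fun p => (t, η t p)) hbump (contMDiff_const.prodMk (η t).contMDiff)
  -- The shift is a function on `M` composed with `η t`, so that its time derivative at a fixed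
  -- particle is the material derivative of `χ₂`.
  set K : ℝ → ℝ → C^∞⟮𝓡 n, N; 𝓘(ℝ, ℝ), ℝ⟯ := fun s t =>
    ⟨fun p => F t p + s * chartBump x₀ (fun y => χ₂ (t, y)) (η t p),
      (F t).contMDiff.add (contMDiff_const.mul (hbumpη t))⟩ with hK
  -- The cutoffs vanish identically at times outside `(a, b)`, in particular at both end points;
  -- nothing moves there, which is why the exceptional set can be empty.
  have hendpt : ∀ t ∉ Ioo a b, ∀ s ∈ Ioo (-ε) ε, (η t).trans (Φ s t) = η t ∧ K s t = F t := by
    intro t ht s hs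
    constructor
    · ext p
      show Φ s t (η t p) = η t p
      rw [hΦ s t hs]
      exact chartExtend_eq_self (K := ∅) (fun y _ => by simp [displace, hend h1s t ht]) (by simp)
    · ext p
      have : chartBump x₀ (fun y => χ₂ (t, y)) (η t p) = 0 :=
        chartBump_eq_zero (K := ∅) (fun y _ => hend h2s t ht y) (by simp)
      simp [hK, this]
  refine ⟨ε, hε, Φ, K, ?_, ?_, fun s t p => rfl⟩
  · have hdisp : ContDiff ℝ ∞ (fun z : (ℝ × ℝ) × Model n => displace χ₁ v z.1.1 z.1.2 z.2) := by
      have : ContDiff ℝ ∞ fun z : (ℝ × ℝ) × Model n => χ₁ (z.1.2, z.2) :=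
        h1.comp ((contDiff_snd.comp contDiff_fst).prodMk contDiff_snd)
      exact contDiff_snd.add (((contDiff_fst.comp contDiff_fst).mul this).smul contDiff_const)
    have hηx : ContMDiffOn (𝓘(ℝ, ℝ).prod (𝓘(ℝ, ℝ).prod (𝓡 n))) (𝓡 n) ∞
        (fun z : ℝ × ℝ × N => η z.2.1 z.2.2) (Ioo (-ε) ε ×ˢ J ×ˢ univ) :=
      ContMDiffOn.comp (g := fun z : ℝ × N => η z.1 z.2) hη contMDiffOn_snd fun z hz => hz.2
    have hFx : ContMDiffOn (𝓘(ℝ, ℝ).prod (𝓘(ℝ, ℝ).prod (𝓡 n))) 𝓘(ℝ, ℝ) ∞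
        (fun z : ℝ × ℝ × N => F z.2.1 z.2.2) (Ioo (-ε) ε ×ˢ J ×ˢ univ) :=
      ContMDiffOn.comp (g := fun z : ℝ × N => F z.1 z.2) hF contMDiffOn_snd fun z hz => hz.2
    have hz1 : ContMDiff (𝓘(ℝ, ℝ).prod (𝓘(ℝ, ℝ).prod (𝓡 n))) 𝓘(ℝ, ℝ) ∞
        (fun z : ℝ × ℝ × N => z.1) := contMDiff_fst
    have hz2 : ContMDiff (𝓘(ℝ, ℝ).prod (𝓘(ℝ, ℝ).prod (𝓡 n))) 𝓘(ℝ, ℝ) ∞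
        (fun z : ℝ × ℝ × N => z.2.1) := contMDiff_fst.comp contMDiff_snd
    refine ⟨?_, ?_, ?_, ?_, ?_⟩
    · have h3 : ContMDiffOn (𝓘(ℝ, ℝ).prod (𝓘(ℝ, ℝ).prod (𝓡 n))) (𝓡 n) ∞
          (fun z : ℝ × ℝ × N => chartExtend x₀ (displace χ₁ v z.1 z.2.1) (η z.2.1 z.2.2))
          (Ioo (-ε) ε ×ˢ J ×ˢ univ) := by
        intro z hz
        obtain ⟨-, e, he, -, -⟩ := hεs z.1 hz.1 z.2.1
        have hee : ⇑e = displace χ₁ v z.1 z.2.1 := funext he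
        have h4 := contMDiffAt_chartExtend (P := ℝ × ℝ) hK₁c hK₁t
          (e := fun w => displace χ₁ v w.1 w.2) hdisp (fun w => hoff w.1 w.2) (a := (z.1, z.2.1))
          (by
            show MapsTo (displace χ₁ v z.1 z.2.1) _ _
            rw [← hee]
            exact mapsTo_of_eq_off hK₁t (by rw [hee]; exact hoff _ _)) (η z.2.1 z.2.2)
        exact ContMDiffAt.comp_contMDiffWithinAt z
          (g := fun w : (ℝ × ℝ) × M => chartExtend x₀ (displace χ₁ v w.1.1 w.1.2) w.2)
          (f := fun z : ℝ × ℝ × N => ((z.1, z.2.1), η z.2.1 z.2.2)) h4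
          (((hz1.prodMk_space hz2).contMDiffAt.contMDiffWithinAt).prodMk (hηx z hz))
      exact h3.congr fun z hz => hΦ z.1 z.2.1 hz.1 _
    · refine hFx.add (hz1.contMDiffOn.mul ?_)
      exact ContMDiff.comp_contMDiffOn
        (g := fun z : ℝ × M => chartBump x₀ (fun y => χ₂ (z.1, y)) z.2)
        (f := fun z : ℝ × ℝ × N => (z.2.1, η z.2.1 z.2.2)) hbump (hz2.contMDiffOn.prodMk hηx)
    · intro t _
      constructor
      · ext p
        show Φ 0 t (η t p) = η t p
        rw [hΦ 0 t ⟨by linarith, hε⟩]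
        exact chartExtend_eq_self (K := ∅) (fun y _ => by simp [displace]) (by simp)
      · ext p
        simp [hK]
    · exact fun s hs => hendpt a (by simp) s hs
    · exact fun s hs => hendpt b (by simp) s hs
  · intro s hs t
    obtain ⟨hp, e, he, -, -⟩ := hεs s hs t
    exact ⟨hp, ⟨e, funext he⟩, hΦ s t hs⟩

end Variations

end BarotropicFlow

/-! ### The energy density, its smoothness and integrability. -/

namespace BarotropicFlow

section EnergyDensity

open Filter Topology

variable {n : ℕ}
  {N : Type*} [TopologicalSpace N] [ChartedSpace (Model n) N]
  {M : Type*} [TopologicalSpace M] [ChartedSpace (Model n) M] [IsManifold (𝓡 n) ∞ M]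

/-- The integrand of the Riemannian metric at the velocity of a curve. -/
noncomputable def energyDensity (g : Metric n M) (ν : VolumeForm n N) (lam : ℝ → ℝ)
    (η : ℝ → N ≃ₘ⟮𝓡 n, 𝓡 n⟯ M) (F : ℝ → C^∞⟮𝓡 n, N; 𝓘(ℝ, ℝ), ℝ⟯) (t : ℝ) (x : M) : ℝ :=
  lam (density g ν (η t) x) * (eulerRate η F t x * eulerRate η F t x) +
    density g ν (η t) x * g.inner x (eulerVelocity η t x) (eulerVelocity η t x)

/-- The quadratic form of the metric in the chart at `x₀`. -/
noncomputable def normSqC (g : Metric n M) (x₀ : M) (y V : Model n) : ℝ :=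
  ∑ i, ∑ j, gram g x₀ y i j * V i * V j

/-- The energy density in the chart at `x₀`. -/
noncomputable def energyC (g : Metric n M) (ν : VolumeForm n N) (lam : ℝ → ℝ)
    (η : ℝ → N ≃ₘ⟮𝓡 n, 𝓡 n⟯ M) (F : ℝ → C^∞⟮𝓡 n, N; 𝓘(ℝ, ℝ), ℝ⟯) (x₀ : M) (z : ℝ × Model n) : ℝ :=
  lam (densC g ν η x₀ z) * (rateC η F x₀ z * rateC η F x₀ z) +
    densC g ν η x₀ z * normSqC g x₀ z.2 (velC η x₀ z)

variable {η : ℝ → N ≃ₘ⟮𝓡 n, 𝓡 n⟯ M} {F : ℝ → C^∞⟮𝓡 n, N; 𝓘(ℝ, ℝ), ℝ⟯} {J : Set ℝ}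

theorem energyDensity_chart (g : Metric n M) (ν : VolumeForm n N) (lam : ℝ → ℝ) {x₀ x : M}
    (hx : x ∈ (extChartAt (𝓡 n) x₀).source) (t : ℝ) :
    energyDensity g ν lam η F t x = energyC g ν lam η F x₀ (t, extChartAt (𝓡 n) x₀ x) := by
  simp only [energyDensity, energyC, densC, rateC, velC, normSqC,
    (extChartAt (𝓡 n) x₀).left_inv hx, fieldCoord_extChartAt hx]
  rw [inner_eq_sum g hx]

theorem contDiffOn_normSqC (g : Metric n M) (x₀ : M) :
    ContDiffOn ℝ ∞ (fun w : Model n × Model n => normSqC g x₀ w.1 w.2)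
      ((extChartAt (𝓡 n) x₀).target ×ˢ univ) := by
  refine ContDiffOn.sum fun i _ => ContDiffOn.sum fun j _ => ?_
  have hc : ∀ k : Fin n, ContDiff ℝ ∞ (fun w : Model n × Model n => w.2 k) := fun k =>
    (EuclideanSpace.proj (𝕜 := ℝ) k).contDiff.comp contDiff_snd
  exact (((contDiffOn_gram g x₀ i j).comp contDiffOn_fst fun _ hw => hw.1).mul
    (hc i).contDiffOn).mul (hc j).contDiffOn

theorem contDiffOn_normSqC_comp (g : Metric n M) {x₀ : M} {Z : Type*} [NormedAddCommGroup Z]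
    [NormedSpace ℝ Z] {S : Set Z} {Y V : Z → Model n} (hY : ContDiffOn ℝ ∞ Y S)
    (hV : ContDiffOn ℝ ∞ V S) (hm : ∀ z ∈ S, Y z ∈ (extChartAt (𝓡 n) x₀).target) :
    ContDiffOn ℝ ∞ (fun z => normSqC g x₀ (Y z) (V z)) S := by
  have h1 : MapsTo (fun z => (Y z, V z)) S ((extChartAt (𝓡 n) x₀).target ×ˢ univ) :=
    fun z hz => ⟨hm z hz, mem_univ _⟩
  have h2 := hY.prodMk hV
  have h3 := (contDiffOn_normSqC g x₀).comp h2 h1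
  exact h3

variable [IsManifold (𝓡 n) ∞ N]

theorem contDiffOn_energyC (g : Metric n M) (ν : VolumeForm n N) {lam : ℝ → ℝ}
    (hlam : ContDiffOn ℝ ∞ lam (Ioi 0)) (hJ : IsOpen J)
    (hη : ContMDiffOn (𝓘(ℝ, ℝ).prod (𝓡 n)) (𝓡 n) ∞ (fun z : ℝ × N => η z.1 z.2) (J ×ˢ univ))
    (hF : ContMDiffOn (𝓘(ℝ, ℝ).prod (𝓡 n)) 𝓘(ℝ, ℝ) ∞ (fun z : ℝ × N => F z.1 z.2) (J ×ˢ univ))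
    (x₀ : M) :
    ContDiffOn ℝ ∞ (energyC g ν lam η F x₀) (J ×ˢ (extChartAt (𝓡 n) x₀).target) := by
  have h1 := contDiffOn_densC g ν hJ hη x₀
  have h2 := contDiffOn_rateC hJ hη hF x₀
  have h3 := contDiffOn_velC hJ hη x₀
  have h4 : ContDiffOn ℝ ∞ (fun z => lam (densC g ν η x₀ z))
      (J ×ˢ (extChartAt (𝓡 n) x₀).target) :=
    ContDiffOn.comp (g := lam) hlam h1 fun z _ => densC_pos g ν η x₀ z
  have h5 : ContDiffOn ℝ ∞ (fun z => normSqC g x₀ z.2 (velC η x₀ z))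
      (J ×ˢ (extChartAt (𝓡 n) x₀).target) :=
    contDiffOn_normSqC_comp g contDiffOn_snd h3 fun z hz => hz.2
  have h6 := h4.mul (h2.mul h2)
  have h7 := h1.mul h5
  unfold energyC
  exact h6.add h7

theorem continuousOn_energyDensity (g : Metric n M) (ν : VolumeForm n N) {lam : ℝ → ℝ}
    (hlam : ContDiffOn ℝ ∞ lam (Ioi 0)) (hJ : IsOpen J)
    (hη : ContMDiffOn (𝓘(ℝ, ℝ).prod (𝓡 n)) (𝓡 n) ∞ (fun z : ℝ × N => η z.1 z.2) (J ×ˢ univ))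
    (hF : ContMDiffOn (𝓘(ℝ, ℝ).prod (𝓡 n)) 𝓘(ℝ, ℝ) ∞ (fun z : ℝ × N => F z.1 z.2) (J ×ˢ univ)) :
    ContinuousOn (fun z : ℝ × M => energyDensity g ν lam η F z.1 z.2) (J ×ˢ univ) := by
  rintro ⟨t, x⟩ ⟨ht, -⟩
  refine ContinuousAt.continuousWithinAt ?_
  have h1 : ContinuousAt (energyC g ν lam η F x) (t, extChartAt (𝓡 n) x x) :=
    (contDiffOn_energyC g ν hlam hJ hη hF x).continuousOn.continuousAt
      ((hJ.prod (isOpen_chart_target x)).mem_nhds ⟨ht, mem_extChartAt_target x⟩)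
  have h2 : ContinuousAt (fun z : ℝ × M => (z.1, extChartAt (𝓡 n) x z.2)) (t, x) :=
    continuousAt_fst.prodMk (ContinuousAt.comp (g := extChartAt (𝓡 n) x) (f := Prod.snd)
      (x := (t, x)) (continuousAt_extChartAt x) continuousAt_snd)
  have h3 : ContinuousAt (fun z : ℝ × M => energyC g ν lam η F x (z.1, extChartAt (𝓡 n) x z.2))
      (t, x) := ContinuousAt.comp (g := energyC g ν lam η F x) (f := fun z : ℝ × M => (z.1, extChartAt (𝓡 n) x z.2)) h1 h2
  refine h3.congr ?_
  have h4 : ∀ᶠ w in 𝓝 x, w ∈ (extChartAt (𝓡 n) x).source :=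
    (isOpen_chart_source x).mem_nhds (mem_extChartAt_source x)
  filter_upwards [(continuous_snd.tendsto (t, x)).eventually h4] with z hz
  exact (energyDensity_chart g ν lam hz z.1).symm

variable [CompactSpace M] [MeasurableSpace M] [BorelSpace M]

theorem continuousOn_integral_energyDensity (g : Metric n M) (ν : VolumeForm n N) {lam : ℝ → ℝ}
    (hlam : ContDiffOn ℝ ∞ lam (Ioi 0)) (hJ : IsOpen J)
    (hη : ContMDiffOn (𝓘(ℝ, ℝ).prod (𝓡 n)) (𝓡 n) ∞ (fun z : ℝ × N => η z.1 z.2) (J ×ˢ univ))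
    (hF : ContMDiffOn (𝓘(ℝ, ℝ).prod (𝓡 n)) 𝓘(ℝ, ℝ) ∞ (fun z : ℝ × N => F z.1 z.2) (J ×ˢ univ)) :
    ContinuousOn (fun t => ∫ x, energyDensity g ν lam η F t x ∂(riemannianVolume g)) J := by
  have := isFiniteMeasure_riemannianVolume g
  exact continuousOn_integral_of_compact_support (isCompact_univ (X := M))
    (continuousOn_energyDensity g ν hlam hJ hη hF) fun t x _ hx => absurd trivial hx

theorem integrable_energyDensity (g : Metric n M) (ν : VolumeForm n N) {lam : ℝ → ℝ}
    (hlam : ContDiffOn ℝ ∞ lam (Ioi 0)) (hJ : IsOpen J)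
    (hη : ContMDiffOn (𝓘(ℝ, ℝ).prod (𝓡 n)) (𝓡 n) ∞ (fun z : ℝ × N => η z.1 z.2) (J ×ˢ univ))
    (hF : ContMDiffOn (𝓘(ℝ, ℝ).prod (𝓡 n)) 𝓘(ℝ, ℝ) ∞ (fun z : ℝ × N => F z.1 z.2) (J ×ˢ univ))
    {t : ℝ} (ht : t ∈ J) : Integrable (energyDensity g ν lam η F t) (riemannianVolume g) := by
  have := isFiniteMeasure_riemannianVolume g
  have h1 : Continuous (energyDensity g ν lam η F t) :=
    (continuousOn_energyDensity g ν hlam hJ hη hF).comp_continuous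
      (f := fun x => (t, x)) (by fun_prop) fun x => ⟨ht, trivial⟩
  exact h1.integrable_of_hasCompactSupport (HasCompactSupport.of_compactSpace _)

/-- Integrability over the whole chart target is not visible in coordinates, where the integrand may
be unbounded near the boundary. It is inherited from the compact manifold through the description of
the measure in the chart. -/
theorem integrableOn_energyC (g : Metric n M) (ν : VolumeForm n N) {lam : ℝ → ℝ}
    (hlam : ContDiffOn ℝ ∞ lam (Ioi 0)) (hJ : IsOpen J)
    (hη : ContMDiffOn (𝓘(ℝ, ℝ).prod (𝓡 n)) (𝓡 n) ∞ (fun z : ℝ × N => η z.1 z.2) (J ×ˢ univ))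
    (hF : ContMDiffOn (𝓘(ℝ, ℝ).prod (𝓡 n)) 𝓘(ℝ, ℝ) ∞ (fun z : ℝ × N => F z.1 z.2) (J ×ˢ univ))
    {t : ℝ} (ht : t ∈ J) (x₀ : M) :
    IntegrableOn (fun y => volDensity g x₀ y * energyC g ν lam η F x₀ (t, y))
      (extChartAt (𝓡 n) x₀).target ∧
    ∫ x in (extChartAt (𝓡 n) x₀).source, energyDensity g ν lam η F t x ∂(riemannianVolume g) =
      ∫ y in (extChartAt (𝓡 n) x₀).target,
        volDensity g x₀ y * energyC g ν lam η F x₀ (t, y) := by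
  have hi := (integrable_energyDensity g ν hlam hJ hη hF ht).restrict
    (s := (extChartAt (𝓡 n) x₀).source)
  have hcongr : ∀ y ∈ (extChartAt (𝓡 n) x₀).target,
      volDensity g x₀ y * energyDensity g ν lam η F t ((extChartAt (𝓡 n) x₀).symm y) =
      volDensity g x₀ y * energyC g ν lam η F x₀ (t, y) := fun y hy => by
    rw [energyDensity_chart g ν lam ((extChartAt (𝓡 n) x₀).map_target hy),
      (extChartAt (𝓡 n) x₀).right_inv hy]
  constructor
  · refine IntegrableOn.congr_fun ?_ hcongr (isOpen_chart_target x₀).measurableSet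
    rw [riemannianVolume_restrict, chartVolume] at hi
    rw [integrable_map_measure hi.aestronglyMeasurable
      (aemeasurable_chart_symm_withDensity x₀)] at hi
    have hc : AEMeasurable (fun y => √(gram g x₀ y).det)
        (volume.restrict (extChartAt (𝓡 n) x₀).target) :=
      (contDiffOn_volDensity g x₀).continuousOn.aemeasurable (isOpen_chart_target x₀).measurableSet
    rw [integrable_withDensity_iff_integrable_smul₀' hc.ennreal_ofReal
      (by simp)] at hi
    refine hi.congr (Eventually.of_forall fun y => ?_)
    simp only [Function.comp, smul_eq_mul, ENNReal.toReal_ofReal (Real.sqrt_nonneg _)]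
    rfl
  · rw [setIntegral_chart_source g x₀ hi.aestronglyMeasurable]
    exact setIntegral_congr_fun (isOpen_chart_target x₀).measurableSet hcongr

end EnergyDensity

end BarotropicFlow

/-! ### Chart variations and the pull-back of their energy. -/

namespace BarotropicFlow

section ChartVariation

open Filter Topology

variable {n : ℕ}
  {N : Type*} [TopologicalSpace N] [ChartedSpace (Model n) N]
  {M : Type*} [TopologicalSpace M] [ChartedSpace (Model n) M]

/-- `(t ↦ (η t).trans (Φ t), F')` is the curve which arises from `(η, F)` by the displacement
`y ↦ y + s χ₁(t, y) v` in the chart at `x₀` and the addition of `s χ₂` to the second component. -/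
structure IsChartVariation (η : ℝ → N ≃ₘ⟮𝓡 n, 𝓡 n⟯ M) (F : ℝ → C^∞⟮𝓡 n, N; 𝓘(ℝ, ℝ), ℝ⟯)
    (J : Set ℝ) (x₀ : M) (χ₁ χ₂ : ℝ × Model n → ℝ) (v : Model n) (s : ℝ)
    (Φ : ℝ → M ≃ₘ⟮𝓡 n, 𝓡 n⟯ M) (F' : ℝ → C^∞⟮𝓡 n, N; 𝓘(ℝ, ℝ), ℝ⟯) : Prop where
  isOpen : IsOpen J
  base_fst : ContMDiffOn (𝓘(ℝ, ℝ).prod (𝓡 n)) (𝓡 n) ∞ (fun z : ℝ × N => η z.1 z.2) (J ×ˢ univ)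
  base_snd : ContMDiffOn (𝓘(ℝ, ℝ).prod (𝓡 n)) 𝓘(ℝ, ℝ) ∞ (fun z : ℝ × N => F z.1 z.2) (J ×ˢ univ)
  smooth_fst : ContMDiffOn (𝓘(ℝ, ℝ).prod (𝓡 n)) (𝓡 n) ∞
    (fun z : ℝ × N => (η z.1).trans (Φ z.1) z.2) (J ×ˢ univ)
  smooth_snd : ContMDiffOn (𝓘(ℝ, ℝ).prod (𝓡 n)) 𝓘(ℝ, ℝ) ∞
    (fun z : ℝ × N => F' z.1 z.2) (J ×ˢ univ)
  smooth₁ : ContDiff ℝ ∞ χ₁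
  compact₁ : HasCompactSupport χ₁
  subset₁ : tsupport χ₁ ⊆ J ×ˢ (extChartAt (𝓡 n) x₀).target
  smooth₂ : ContDiff ℝ ∞ χ₂
  compact₂ : HasCompactSupport χ₂
  subset₂ : tsupport χ₂ ⊆ J ×ˢ (extChartAt (𝓡 n) x₀).target
  jacobian_pos : ∀ t y, 0 < 1 + s * fderiv ℝ χ₁ (t, y) (0, v)
  exists_equiv : ∀ t, ∃ e : Model n ≃ Model n, ⇑e = displace χ₁ v s t
  apply_fst : ∀ t x, Φ t x = chartExtend x₀ (displace χ₁ v s t) x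
  apply_snd : ∀ t p, F' t p = F t p + s * chartBump x₀ (fun y => χ₂ (t, y)) (η t p)

theorem hasFDerivAt_displace {χ : ℝ × Model n → ℝ} (hχ : ContDiff ℝ ∞ χ) (v : Model n) (s t : ℝ)
    (y : Model n) : HasFDerivAt (displace χ v s t) (ContinuousLinearMap.id ℝ (Model n) +
      (s • (fderiv ℝ χ (t, y)).comp (ContinuousLinearMap.inr ℝ ℝ (Model n))).smulRight v) y := by
  have h1 : HasFDerivAt (fun y => χ (t, y))
      ((fderiv ℝ χ (t, y)).comp (ContinuousLinearMap.inr ℝ ℝ (Model n))) y :=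
    HasFDerivAt.comp y (hχ.differentiable (by simp) (t, y)).hasFDerivAt (hasFDerivAt_prodMk_right t y)
  exact (hasFDerivAt_id y).add ((h1.const_mul s).smul_const v)

theorem det_displace {χ : ℝ × Model n → ℝ} (v : Model n) (s t : ℝ) (y : Model n) :
    (ContinuousLinearMap.id ℝ (Model n) +
      (s • (fderiv ℝ χ (t, y)).comp (ContinuousLinearMap.inr ℝ ℝ (Model n))).smulRight v).det =
    1 + s * fderiv ℝ χ (t, y) (0, v) := by
  rw [det_id_add_smulRight]
  simp

theorem displace_eq_self {χ : ℝ × Model n → ℝ} {v : Model n} {s t : ℝ} {y : Model n}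
    (hy : y ∉ Prod.snd '' tsupport χ) : displace χ v s t y = y := by
  simp [displace, eq_zero_of_notMem_snd_tsupport hy t]

variable {η : ℝ → N ≃ₘ⟮𝓡 n, 𝓡 n⟯ M} {F : ℝ → C^∞⟮𝓡 n, N; 𝓘(ℝ, ℝ), ℝ⟯} {J : Set ℝ} {x₀ : M}
  {χ₁ χ₂ : ℝ × Model n → ℝ} {v : Model n} {s : ℝ} {Φ : ℝ → M ≃ₘ⟮𝓡 n, 𝓡 n⟯ M}
  {F' : ℝ → C^∞⟮𝓡 n, N; 𝓘(ℝ, ℝ), ℝ⟯}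

namespace IsChartVariation

theorem mapsTo (h : IsChartVariation η F J x₀ χ₁ χ₂ v s Φ F') (t : ℝ) :
    MapsTo (displace χ₁ v s t) (extChartAt (𝓡 n) x₀).target (extChartAt (𝓡 n) x₀).target := by
  obtain ⟨e, he⟩ := h.exists_equiv t
  rw [← he]
  refine mapsTo_of_eq_off (K := Prod.snd '' tsupport χ₁) ?_ fun y hy => ?_
  · rintro _ ⟨z, hz, rfl⟩; exact (h.subset₁ hz).2
  · rw [he]; exact displace_eq_self hy

theorem injective (h : IsChartVariation η F J x₀ χ₁ χ₂ v s Φ F') (t : ℝ) :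
    Function.Injective (displace χ₁ v s t) := by
  obtain ⟨e, he⟩ := h.exists_equiv t
  rw [← he]
  exact e.injective

theorem image_target (h : IsChartVariation η F J x₀ χ₁ χ₂ v s Φ F') (t : ℝ) :
    displace χ₁ v s t '' (extChartAt (𝓡 n) x₀).target = (extChartAt (𝓡 n) x₀).target := by
  refine Subset.antisymm (h.mapsTo t).image_subset fun y hy => ?_
  obtain ⟨e, he⟩ := h.exists_equiv t
  refine ⟨e.symm y, ?_, by rw [← he, Equiv.apply_symm_apply]⟩
  refine mapsTo_of_eq_off (K := Prod.snd '' tsupport χ₁) ?_ (symm_eq_off fun y hy => ?_) hy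
  · rintro _ ⟨z, hz, rfl⟩; exact (h.subset₁ hz).2
  · rw [he]; exact displace_eq_self hy

theorem apply_chart_symm (h : IsChartVariation η F J x₀ χ₁ χ₂ v s Φ F') (t : ℝ) {y : Model n}
    (hy : y ∈ (extChartAt (𝓡 n) x₀).target) :
    Φ t ((extChartAt (𝓡 n) x₀).symm y) = (extChartAt (𝓡 n) x₀).symm (displace χ₁ v s t y) := by
  rw [h.apply_fst, chartExtend_of_mem ((extChartAt (𝓡 n) x₀).map_target hy),
    (extChartAt (𝓡 n) x₀).right_inv hy]

theorem chart_apply (h : IsChartVariation η F J x₀ χ₁ χ₂ v s Φ F') (t : ℝ) {x : M}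
    (hx : x ∈ (extChartAt (𝓡 n) x₀).source) :
    extChartAt (𝓡 n) x₀ (Φ t x) = displace χ₁ v s t (extChartAt (𝓡 n) x₀ x) := by
  rw [h.apply_fst, chartExtend_of_mem hx,
    (extChartAt (𝓡 n) x₀).right_inv (h.mapsTo t ((extChartAt (𝓡 n) x₀).map_source hx))]

theorem eventually_mem_source (h : IsChartVariation η F J x₀ χ₁ χ₂ v s Φ F') {t : ℝ} (ht : t ∈ J)
    {p : N} {S : Set M} (hS : IsOpen S) (hp : η t p ∈ S) : ∀ᶠ τ in 𝓝 t, η τ p ∈ S :=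
  (contMDiffAt_path h.isOpen h.base_fst ht p).continuousAt.preimage_mem_nhds (hS.mem_nhds hp)

end IsChartVariation

variable [IsManifold (𝓡 n) ∞ M]

namespace IsChartVariation

/-- In coordinates a varied particle path is the old path plus `s χ₁ v` evaluated along it, so the
cutoff contributes its material derivative. -/
theorem velC_eq (h : IsChartVariation η F J x₀ χ₁ χ₂ v s Φ F') {t : ℝ} (ht : t ∈ J) {y : Model n}
    (hy : y ∈ (extChartAt (𝓡 n) x₀).target) :
    velC (fun τ => (η τ).trans (Φ τ)) x₀ (t, displace χ₁ v s t y) =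
      velC η x₀ (t, y) + (s * fderiv ℝ χ₁ (t, y) (1, velC η x₀ (t, y))) • v := by
  have hys := (extChartAt (𝓡 n) x₀).map_target hy
  obtain ⟨p, hp⟩ : ∃ p, η t p = (extChartAt (𝓡 n) x₀).symm y :=
    ⟨(η t).symm _, (η t).apply_symm_apply _⟩
  have hpy : extChartAt (𝓡 n) x₀ (η t p) = y := by rw [hp, (extChartAt (𝓡 n) x₀).right_inv hy]
  have hps : η t p ∈ (extChartAt (𝓡 n) x₀).source := by rw [hp]; exact hys
  have h1 := hasDerivAt_chart_curve h.isOpen h.base_fst ht p hps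
  have h2s : (η t).trans (Φ t) p ∈ (extChartAt (𝓡 n) x₀).source := by
    show Φ t (η t p) ∈ _
    rw [hp, h.apply_chart_symm t hy]
    exact (extChartAt (𝓡 n) x₀).map_target (h.mapsTo t hy)
  have h2 := hasDerivAt_chart_curve (η := fun τ => (η τ).trans (Φ τ)) h.isOpen h.smooth_fst ht p h2s
  have h3 : extChartAt (𝓡 n) x₀ ((η t).trans (Φ t) p) = displace χ₁ v s t y := by
    show extChartAt (𝓡 n) x₀ (Φ t (η t p)) = _
    rw [h.chart_apply t hps, hpy]
  rw [h3] at h2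
  rw [hpy] at h1
  change HasDerivAt _ (velC (fun τ => (η τ).trans (Φ τ)) x₀ (t, displace χ₁ v s t y)) t at h2
  change HasDerivAt _ (velC η x₀ (t, y)) t at h1
  refine h2.unique ?_
  have hχ : HasFDerivAt χ₁ (fderiv ℝ χ₁ (t, y)) (t, extChartAt (𝓡 n) x₀ (η t p)) := by
    rw [hpy]; exact (h.smooth₁.differentiable (by simp) (t, y)).hasFDerivAt
  have h4 : HasDerivAt (fun τ => χ₁ (τ, extChartAt (𝓡 n) x₀ (η τ p)))
      (fderiv ℝ χ₁ (t, y) (1, velC η x₀ (t, y))) t :=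
    HasFDerivAt.comp_hasDerivAt (f := fun τ => (τ, extChartAt (𝓡 n) x₀ (η τ p))) t hχ
      ((hasDerivAt_id t).prodMk h1)
  refine (h1.add ((h4.const_mul s).smul_const v)).congr_of_eventuallyEq ?_
  filter_upwards [h.eventually_mem_source ht (isOpen_chart_source x₀) hps] with τ hτ
  exact h.chart_apply τ hτ

/-- The particle found at the displaced point after the variation is the one found at `y` before it.
Hence `χ₁` does not enter, and the rate gains only the material derivative of `χ₂`. -/
theorem rateC_eq (h : IsChartVariation η F J x₀ χ₁ χ₂ v s Φ F') {t : ℝ} (ht : t ∈ J) {y : Model n}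
    (hy : y ∈ (extChartAt (𝓡 n) x₀).target) :
    rateC (fun τ => (η τ).trans (Φ τ)) F' x₀ (t, displace χ₁ v s t y) =
      rateC η F x₀ (t, y) + s * fderiv ℝ χ₂ (t, y) (1, velC η x₀ (t, y)) := by
  have hys := (extChartAt (𝓡 n) x₀).map_target hy
  obtain ⟨p, hp⟩ : ∃ p, η t p = (extChartAt (𝓡 n) x₀).symm y :=
    ⟨(η t).symm _, (η t).apply_symm_apply _⟩
  have hpy : extChartAt (𝓡 n) x₀ (η t p) = y := by rw [hp, (extChartAt (𝓡 n) x₀).right_inv hy]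
  have hps : η t p ∈ (extChartAt (𝓡 n) x₀).source := by rw [hp]; exact hys
  have h1 := hasDerivAt_chart_curve h.isOpen h.base_fst ht p hps
  rw [hpy] at h1
  change HasDerivAt _ (velC η x₀ (t, y)) t at h1
  have hp' : ((η t).trans (Φ t)).symm ((extChartAt (𝓡 n) x₀).symm (displace χ₁ v s t y)) = p := by
    rw [← h.apply_chart_symm t hy, ← hp]
    exact ((η t).trans (Φ t)).symm_apply_apply p
  simp only [rateC, eulerRate, hp']
  rw [← hp, Diffeomorph.symm_apply_apply]
  have hχ : HasFDerivAt χ₂ (fderiv ℝ χ₂ (t, y)) (t, extChartAt (𝓡 n) x₀ (η t p)) := by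
    rw [hpy]; exact (h.smooth₂.differentiable (by simp) (t, y)).hasFDerivAt
  have h4 : HasDerivAt (fun τ => χ₂ (τ, extChartAt (𝓡 n) x₀ (η τ p)))
      (fderiv ℝ χ₂ (t, y) (1, velC η x₀ (t, y))) t :=
    HasFDerivAt.comp_hasDerivAt (f := fun τ => (τ, extChartAt (𝓡 n) x₀ (η τ p))) t hχ
      ((hasDerivAt_id t).prodMk h1)
  have hFs : ContMDiffAt 𝓘(ℝ, ℝ) 𝓘(ℝ, ℝ) ∞ (fun τ => F τ p) t :=
    ContMDiffAt.comp t (g := fun z : ℝ × N => F z.1 z.2) (f := fun τ => (τ, p))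
      (h.base_snd.contMDiffAt ((h.isOpen.prod isOpen_univ).mem_nhds ⟨ht, mem_univ _⟩))
      (contMDiffAt_id.prodMk contMDiffAt_const)
  have h5 := (hFs.contDiffAt.differentiableAt (by simp)).hasDerivAt
  refine HasDerivAt.deriv ((h5.add (h4.const_mul s)).congr_of_eventuallyEq ?_)
  filter_upwards [h.eventually_mem_source ht (isOpen_chart_source x₀) hps] with τ hτ
  rw [h.apply_snd, chartBump_of_mem hτ]
  rfl

/-- The displacement carries the mass of a coordinate volume element along, with Jacobian `1 + s
∂ᵥχ₁`. This is the reason why mass does not vary after pulling back. -/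
theorem densC_mul (h : IsChartVariation η F J x₀ χ₁ χ₂ v s Φ F') (g : Metric n M)
    (ν : VolumeForm n N) (t : ℝ) {y : Model n} (hy : y ∈ (extChartAt (𝓡 n) x₀).target) :
    densC g ν (fun τ => (η τ).trans (Φ τ)) x₀ (t, displace χ₁ v s t y) *
      (volDensity g x₀ (displace χ₁ v s t y) * (1 + s * fderiv ℝ χ₁ (t, y) (0, v))) =
      massC g ν η x₀ (t, y) := by
  have h1 := h.apply_chart_symm t hy
  have h2s : Φ t ((extChartAt (𝓡 n) x₀).symm y) ∈ (extChartAt (𝓡 n) x₀).source := by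
    rw [h1]; exact (extChartAt (𝓡 n) x₀).map_target (h.mapsTo t hy)
  have hL := (hasFDerivAt_displace h.smooth₁ v s t y).congr_of_eventuallyEq
    (f₁ := fun w => extChartAt (𝓡 n) x₀ (Φ t ((extChartAt (𝓡 n) x₀).symm w))) (by
      filter_upwards [(isOpen_chart_target x₀).mem_nhds hy] with w hw
      rw [h.chart_apply t ((extChartAt (𝓡 n) x₀).map_target hw), (extChartAt (𝓡 n) x₀).right_inv hw])
  have h3 := density_trans g ν (η t) (Φ t) hy h2s hL
  rw [det_displace, abs_of_pos (h.jacobian_pos t y), h1,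
    (extChartAt (𝓡 n) x₀).right_inv (h.mapsTo t hy)] at h3
  exact h3

end IsChartVariation

/-- The energy density of a chart variation, pulled back to the unperturbed configuration. -/
noncomputable def pulledEnergy (g : Metric n M) (ν : VolumeForm n N) (lam : ℝ → ℝ)
    (η : ℝ → N ≃ₘ⟮𝓡 n, 𝓡 n⟯ M) (F : ℝ → C^∞⟮𝓡 n, N; 𝓘(ℝ, ℝ), ℝ⟯) (x₀ : M)
    (χ₁ χ₂ : ℝ × Model n → ℝ) (v : Model n) (s : ℝ) (z : ℝ × Model n) : ℝ :=
  let w := volDensity g x₀ (displace χ₁ v s z.1 z.2) * (1 + s * fderiv ℝ χ₁ z (0, v))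
  let D : ℝ × Model n := (1, velC η x₀ z)
  lam (massC g ν η x₀ z / w) * w * (rateC η F x₀ z + s * fderiv ℝ χ₂ z D) ^ 2 +
    massC g ν η x₀ z * normSqC g x₀ (displace χ₁ v s z.1 z.2)
      (velC η x₀ z + (s * fderiv ℝ χ₁ z D) • v)

namespace IsChartVariation

/-- The change of variables formula for the energy density. -/
theorem energyC_eq (h : IsChartVariation η F J x₀ χ₁ χ₂ v s Φ F') (g : Metric n M)
    (ν : VolumeForm n N) (lam : ℝ → ℝ) {t : ℝ} (ht : t ∈ J) {y : Model n}
    (hy : y ∈ (extChartAt (𝓡 n) x₀).target) :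
    (1 + s * fderiv ℝ χ₁ (t, y) (0, v)) * (volDensity g x₀ (displace χ₁ v s t y) *
      energyC g ν lam (fun τ => (η τ).trans (Φ τ)) F' x₀ (t, displace χ₁ v s t y)) =
      pulledEnergy g ν lam η F x₀ χ₁ χ₂ v s (t, y) := by
  have h1 := h.densC_mul g ν t hy
  have hw : 0 < volDensity g x₀ (displace χ₁ v s t y) * (1 + s * fderiv ℝ χ₁ (t, y) (0, v)) :=
    mul_pos (volDensity_pos g (h.mapsTo t hy)) (h.jacobian_pos t y)
  have h2 := (eq_div_iff hw.ne').2 h1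
  simp only [energyC, pulledEnergy, h.velC_eq ht hy, h.rateC_eq ht hy]
  rw [← h2, ← h1]
  ring

/-- Equality of the curves at a single point would not suffice, since derivatives are involved. A
point off the chart domain has a neighbourhood that misses the transported supports, and a particle
there remains in it for nearby times, so velocity, rate and density all agree. -/
theorem energyDensity_eq_off [T2Space M] (h : IsChartVariation η F J x₀ χ₁ χ₂ v s Φ F')
    (g : Metric n M) (ν : VolumeForm n N) (lam : ℝ → ℝ) {t : ℝ} (ht : t ∈ J) {x : M}
    (hx : x ∉ (extChartAt (𝓡 n) x₀).source) :
    energyDensity g ν lam (fun τ => (η τ).trans (Φ τ)) F' t x = energyDensity g ν lam η F t x := by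
  set K₁ := (extChartAt (𝓡 n) x₀).symm '' (Prod.snd '' tsupport χ₁) with hK₁
  set K₂ := (extChartAt (𝓡 n) x₀).symm '' (Prod.snd '' tsupport χ₂) with hK₂
  have ht₁ : Prod.snd '' tsupport χ₁ ⊆ (extChartAt (𝓡 n) x₀).target := by
    rintro _ ⟨z, hz, rfl⟩; exact (h.subset₁ hz).2
  have ht₂ : Prod.snd '' tsupport χ₂ ⊆ (extChartAt (𝓡 n) x₀).target := by
    rintro _ ⟨z, hz, rfl⟩; exact (h.subset₂ hz).2
  have ho₁ : IsOpen K₁ᶜ :=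
    (isClosed_chart_symm_image (IsCompact.image h.compact₁ continuous_snd) ht₁).isOpen_compl
  have ho₂ : IsOpen K₂ᶜ :=
    (isClosed_chart_symm_image (IsCompact.image h.compact₂ continuous_snd) ht₂).isOpen_compl
  have hx₁ : x ∈ K₁ᶜ := fun h' => hx (chart_symm_image_subset ht₁ h')
  have hx₂ : x ∈ K₂ᶜ := fun h' => hx (chart_symm_image_subset ht₂ h')
  have hΦ : ∀ τ, ∀ w ∈ K₁ᶜ, Φ τ w = w := fun τ w hw => by
    rw [h.apply_fst]
    exact chartExtend_eq_self (fun y hy => displace_eq_self hy) hw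
  obtain ⟨p, rfl⟩ : ∃ p, η t p = x := ⟨(η t).symm x, (η t).apply_symm_apply x⟩
  have hp' : ((η t).trans (Φ t)).symm (η t p) = p := by
    have := ((η t).trans (Φ t)).symm_apply_apply p
    rwa [show (η t).trans (Φ t) p = η t p from hΦ t _ hx₁] at this
  have hev : ∀ᶠ τ in 𝓝 t, (η τ).trans (Φ τ) p = η τ p := by
    filter_upwards [h.eventually_mem_source ht ho₁ hx₁] with τ hτ
    exact hΦ τ _ hτ
  have hvel : eulerVelocity (fun τ => (η τ).trans (Φ τ)) t (η t p) = eulerVelocity η t (η t p) := by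
    have e1 := fieldCoord_eulerVelocity (η := fun τ => (η τ).trans (Φ τ)) h.isOpen h.smooth_fst ht
      (mem_extChartAt_source (I := 𝓡 n) (η t p))
    have e2 := fieldCoord_eulerVelocity h.isOpen h.base_fst ht
      (mem_extChartAt_source (I := 𝓡 n) (η t p))
    rw [chartDeriv_self, hp'] at e1
    rw [chartDeriv_self, Diffeomorph.symm_apply_apply] at e2
    rw [e1, e2]
    refine Filter.EventuallyEq.deriv_eq (𝕜 := ℝ) (F := Model n) ?_
    filter_upwards [hev] with τ hτ
    rw [hτ]
  have hrate : eulerRate (fun τ => (η τ).trans (Φ τ)) F' t (η t p) = eulerRate η F t (η t p) := by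
    simp only [eulerRate, hp', Diffeomorph.symm_apply_apply]
    refine Filter.EventuallyEq.deriv_eq ?_
    filter_upwards [h.eventually_mem_source ht ho₂ hx₂] with τ hτ
    rw [h.apply_snd, chartBump_eq_zero (fun y hy => eq_zero_of_notMem_snd_tsupport hy τ) hτ]
    simp
  have hdens : density g ν ((η t).trans (Φ t)) (η t p) = density g ν (η t) (η t p) := by
    set x := η t p
    have hxt := mem_extChartAt_target (I := 𝓡 n) x
    have hxx : (extChartAt (𝓡 n) x).symm (extChartAt (𝓡 n) x x) = x := extChartAt_to_inv x
    have hL : HasFDerivAt (fun w => extChartAt (𝓡 n) x (Φ t ((extChartAt (𝓡 n) x).symm w)))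
        (ContinuousLinearMap.id ℝ (Model n)) (extChartAt (𝓡 n) x x) := by
      refine (hasFDerivAt_id (𝕜 := ℝ) (extChartAt (𝓡 n) x x)).congr_of_eventuallyEq ?_
      have h1 : ∀ᶠ w in 𝓝 (extChartAt (𝓡 n) x x), (extChartAt (𝓡 n) x).symm w ∈ K₁ᶜ :=
        (continuousAt_extChartAt_symm x).preimage_mem_nhds (by rw [hxx]; exact ho₁.mem_nhds hx₁)
      filter_upwards [h1, (isOpen_chart_target x).mem_nhds hxt] with w hw hwt
      rw [hΦ t _ hw, (extChartAt (𝓡 n) x).right_inv hwt]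
      rfl
    have h2 := density_trans g ν (η t) (Φ t) hxt
      (by rw [hxx, hΦ t _ hx₁]; exact mem_extChartAt_source x) hL
    rw [hxx, hΦ t _ hx₁] at h2
    have h3 : (ContinuousLinearMap.id ℝ (Model n)).det = 1 := by
      simp [ContinuousLinearMap.det]
    rw [h3, abs_one, mul_one] at h2
    exact mul_right_cancel₀ (volDensity_pos g hxt).ne' h2
  simp only [energyDensity, hvel, hrate, hdens]

variable [IsManifold (𝓡 n) ∞ N] [T2Space M] [CompactSpace M] [MeasurableSpace M] [BorelSpace M]

/-- The contributions from outside the chart domain cancel. Inside, the displacement maps the chart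
target bijectively onto itself, so the change of variables leaves the domain of integration alone.
-/
theorem integral_energyDensity_sub (h : IsChartVariation η F J x₀ χ₁ χ₂ v s Φ F') (g : Metric n M)
    (ν : VolumeForm n N) {lam : ℝ → ℝ} (hlam : ContDiffOn ℝ ∞ lam (Ioi 0)) {t : ℝ} (ht : t ∈ J) :
    ∫ x, energyDensity g ν lam (fun τ => (η τ).trans (Φ τ)) F' t x ∂(riemannianVolume g) -
      ∫ x, energyDensity g ν lam η F t x ∂(riemannianVolume g) =
    ∫ y in (extChartAt (𝓡 n) x₀).target,
      (pulledEnergy g ν lam η F x₀ χ₁ χ₂ v s (t, y) -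
        volDensity g x₀ y * energyC g ν lam η F x₀ (t, y)) := by
  have hms := (isOpen_chart_source (n := n) x₀).measurableSet
  have hmt := (isOpen_chart_target (n := n) x₀).measurableSet
  have i1 := integrable_energyDensity (η := fun τ => (η τ).trans (Φ τ)) g ν hlam h.isOpen h.smooth_fst h.smooth_snd ht
  have i2 := integrable_energyDensity g ν hlam h.isOpen h.base_fst h.base_snd ht
  obtain ⟨c1, d1⟩ := integrableOn_energyC (η := fun τ => (η τ).trans (Φ τ)) g ν hlam h.isOpen h.smooth_fst h.smooth_snd ht x₀
  obtain ⟨c2, d2⟩ := integrableOn_energyC g ν hlam h.isOpen h.base_fst h.base_snd ht x₀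
  have hd : ∀ y ∈ (extChartAt (𝓡 n) x₀).target, HasFDerivWithinAt (displace χ₁ v s t) _
      (extChartAt (𝓡 n) x₀).target y := fun y _ =>
    (hasFDerivAt_displace h.smooth₁ v s t y).hasFDerivWithinAt
  have hinj := (h.injective t).injOn (s := (extChartAt (𝓡 n) x₀).target)
  have hcongr : ∀ y ∈ (extChartAt (𝓡 n) x₀).target,
      |(ContinuousLinearMap.id ℝ (Model n) + (s • (fderiv ℝ χ₁ (t, y)).comp
        (ContinuousLinearMap.inr ℝ ℝ (Model n))).smulRight v).det| •
        (volDensity g x₀ (displace χ₁ v s t y) *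
          energyC g ν lam (fun τ => (η τ).trans (Φ τ)) F' x₀ (t, displace χ₁ v s t y)) =
      pulledEnergy g ν lam η F x₀ χ₁ χ₂ v s (t, y) := fun y hy => by
    rw [det_displace, abs_of_pos (h.jacobian_pos t y), smul_eq_mul, h.energyC_eq g ν lam ht hy]
  have c3 : IntegrableOn (fun y => pulledEnergy g ν lam η F x₀ χ₁ χ₂ v s (t, y))
      (extChartAt (𝓡 n) x₀).target := by
    rw [← h.image_target t, integrableOn_image_iff_integrableOn_abs_det_fderiv_smul _ hmt hd hinj]
      at c1
    exact c1.congr_fun hcongr hmt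
  have d3 : ∫ y in (extChartAt (𝓡 n) x₀).target, volDensity g x₀ y *
      energyC g ν lam (fun τ => (η τ).trans (Φ τ)) F' x₀ (t, y) =
      ∫ y in (extChartAt (𝓡 n) x₀).target, pulledEnergy g ν lam η F x₀ χ₁ χ₂ v s (t, y) := by
    conv_lhs => rw [← h.image_target t]
    rw [integral_image_eq_integral_abs_det_fderiv_smul _ hmt hd hinj]
    exact setIntegral_congr_fun hmt hcongr
  rw [integral_sub c3 c2, ← integral_add_compl hms i1, ← integral_add_compl hms i2, d1, d2, d3,
    setIntegral_congr_fun hms.compl fun x hx => h.energyDensity_eq_off g ν lam ht hx]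
  ring

end IsChartVariation

end ChartVariation

end BarotropicFlow

/-! ### The derivative of the pulled-back energy. -/

namespace BarotropicFlow

section FirstVariation

open Filter Topology

variable {n : ℕ}
  {N : Type*} [TopologicalSpace N] [ChartedSpace (Model n) N]
  {M : Type*} [TopologicalSpace M] [ChartedSpace (Model n) M] [IsManifold (𝓡 n) ∞ M]
  {η : ℝ → N ≃ₘ⟮𝓡 n, 𝓡 n⟯ M} {F : ℝ → C^∞⟮𝓡 n, N; 𝓘(ℝ, ℝ), ℝ⟯} {J : Set ℝ} {x₀ : M}
  {χ₁ χ₂ : ℝ × Model n → ℝ} {v : Model n}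

theorem pulledEnergy_zero (g : Metric n M) (ν : VolumeForm n N) (lam : ℝ → ℝ) (v : Model n) {t : ℝ}
    {y : Model n} (hy : y ∈ (extChartAt (𝓡 n) x₀).target) :
    pulledEnergy g ν lam η F x₀ χ₁ χ₂ v 0 (t, y) =
      volDensity g x₀ y * energyC g ν lam η F x₀ (t, y) := by
  have h1 : massC g ν η x₀ (t, y) / volDensity g x₀ y = densC g ν η x₀ (t, y) :=
    mul_div_cancel_right₀ _ (volDensity_pos g hy).ne'
  simp only [pulledEnergy, displace, energyC, zero_mul, add_zero, zero_smul, mul_one, h1]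
  simp only [massC]
  ring

theorem pulledEnergy_eq_off (g : Metric n M) (ν : VolumeForm n N) (lam : ℝ → ℝ) (s : ℝ)
    {z : ℝ × Model n} (h1 : z ∉ tsupport χ₁) (h2 : z ∉ tsupport χ₂) :
    pulledEnergy g ν lam η F x₀ χ₁ χ₂ v s z = pulledEnergy g ν lam η F x₀ χ₁ χ₂ v 0 z := by
  have e1 : χ₁ (z.1, z.2) = 0 := image_eq_zero_of_notMem_tsupport h1
  have e2 : fderiv ℝ χ₁ z = 0 := fderiv_of_notMem_tsupport (𝕜 := ℝ) h1
  have e3 : fderiv ℝ χ₂ z = 0 := fderiv_of_notMem_tsupport (𝕜 := ℝ) h2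
  simp [pulledEnergy, displace, e1, e2, e3]

theorem contDiff_fderiv_apply_const {χ : ℝ × Model n → ℝ} (hχ : ContDiff ℝ ∞ χ) :
    ContDiff ℝ ∞ (fun w : (ℝ × Model n) × (ℝ × Model n) => fderiv ℝ χ w.1 w.2) :=
  ((hχ.fderiv_right (m := ∞) (by simp)).comp contDiff_fst).clm_apply contDiff_snd

/-- Base point and vector both move in the direction `v`. Symmetry of the metric merges the two
terms that come from the vector, which accounts for the factor `2`. -/
theorem hasDerivAt_normSqC (g : Metric n M) {y : Model n}
    (hy : y ∈ (extChartAt (𝓡 n) x₀).target) (V v : Model n) (c d : ℝ) :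
    HasDerivAt (fun s : ℝ => normSqC g x₀ (y + (s * c) • v) (V + (s * d) • v))
      (c * (∑ i, ∑ j, fderiv ℝ (fun w => gram g x₀ w i j) y v * V i * V j) +
        2 * d * ∑ i, ∑ j, gram g x₀ y i j * v i * V j) 0 := by
  have h1 : HasDerivAt (fun s : ℝ => y + (s * c) • v) (c • v) 0 := by
    simpa using ((((hasDerivAt_id (0 : ℝ)).mul_const c).smul_const v).const_add y)
  have hg : ∀ i j, HasDerivAt (fun s : ℝ => gram g x₀ (y + (s * c) • v) i j)
      (c * fderiv ℝ (fun w => gram g x₀ w i j) y v) 0 := by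
    intro i j
    have h2 : HasFDerivAt (fun w => gram g x₀ w i j) (fderiv ℝ (fun w => gram g x₀ w i j) y)
        (y + ((0 : ℝ) * c) • v) := by
      rw [zero_mul, zero_smul, add_zero]
      exact (((contDiffOn_gram g x₀ i j).contDiffAt ((isOpen_chart_target x₀).mem_nhds
        hy)).differentiableAt (by simp)).hasFDerivAt
    have h3 := HasFDerivAt.comp_hasDerivAt (f := fun s : ℝ => y + (s * c) • v) 0 h2 h1
    rw [map_smul, smul_eq_mul] at h3
    exact h3
  have hV : ∀ i, HasDerivAt (fun s : ℝ => (V + (s * d) • v) i) (d * v i) 0 := by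
    intro i
    have h2 : HasDerivAt (fun s : ℝ => V i + s * d * v i) (1 * d * v i) 0 :=
      (((hasDerivAt_id (0 : ℝ)).mul_const d).mul_const (v i)).const_add (V i)
    simpa using h2
  have h4 : HasDerivAt (fun s : ℝ => normSqC g x₀ (y + (s * c) • v) (V + (s * d) • v))
      (∑ i, ∑ j, ((c * fderiv ℝ (fun w => gram g x₀ w i j) y v * (V + ((0 : ℝ) * d) • v) i +
        gram g x₀ (y + ((0 : ℝ) * c) • v) i j * (d * v i)) * (V + ((0 : ℝ) * d) • v) j +
        gram g x₀ (y + ((0 : ℝ) * c) • v) i j * (V + ((0 : ℝ) * d) • v) i * (d * v j))) 0 := by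
    exact HasDerivAt.fun_sum fun i _ => HasDerivAt.fun_sum fun j _ =>
      ((hg i j).mul (hV i)).mul (hV j)
  refine h4.congr_deriv ?_
  simp only [zero_mul, zero_smul, add_zero]
  have h5 : ∑ i, ∑ j, gram g x₀ y i j * V i * (d * v j) =
      ∑ i, ∑ j, gram g x₀ y i j * (d * v i) * V j := by
    rw [Finset.sum_comm]
    refine Finset.sum_congr rfl fun i _ => Finset.sum_congr rfl fun j _ => ?_
    rw [gram_symm g x₀ y j i]
    ring
  simp only [add_mul, Finset.sum_add_distrib, h5]
  simp only [Finset.mul_sum]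
  simp only [← Finset.sum_add_distrib]
  refine Finset.sum_congr rfl fun i _ => Finset.sum_congr rfl fun j _ => ?_
  ring

/-- The mass `m` is constant in `s`, so the coefficient of the squared rate varies only through the
volume `w`, and `d/dw (λ(m/w) w) = λ(ρ) - ρ λ'(ρ) = 2 φ(ρ)` at `s = 0`. The overall factor `2` will
cancel the `½` of the energy. -/
theorem hasDerivAt_pulledEnergy (g : Metric n M) (ν : VolumeForm n N) {lam : ℝ → ℝ}
    (hlam : ContDiffOn ℝ ∞ lam (Ioi 0)) {t : ℝ} {y : Model n}
    (hy : y ∈ (extChartAt (𝓡 n) x₀).target) :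
    HasDerivAt (fun s => pulledEnergy g ν lam η F x₀ χ₁ χ₂ v s (t, y))
      (2 * (phi lam (densC g ν η x₀ (t, y)) * rateC η F x₀ (t, y) ^ 2 *
          (fderiv ℝ (volDensity g x₀) y v * χ₁ (t, y) +
            volDensity g x₀ y * fderiv ℝ χ₁ (t, y) (0, v)) +
        lam (densC g ν η x₀ (t, y)) * volDensity g x₀ y * rateC η F x₀ (t, y) *
          fderiv ℝ χ₂ (t, y) (1, velC η x₀ (t, y)) +
        massC g ν η x₀ (t, y) *
          (χ₁ (t, y) * (1 / 2) * (∑ i, ∑ j, fderiv ℝ (fun w => gram g x₀ w i j) y v *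
            velC η x₀ (t, y) i * velC η x₀ (t, y) j) +
          fderiv ℝ χ₁ (t, y) (1, velC η x₀ (t, y)) *
            ∑ i, ∑ j, gram g x₀ y i j * v i * velC η x₀ (t, y) j))) 0 := by
  set ρ := densC g ν η x₀ (t, y) with hρ
  set m := massC g ν η x₀ (t, y) with hm
  set V := velC η x₀ (t, y) with hV
  set R := rateC η F x₀ (t, y) with hR
  have hvol := volDensity_pos g hy
  have hρ0 : 0 < ρ := densC_pos _ _ _ _ _
  have hmv : m = ρ * volDensity g x₀ y := rfl
  have hw1 : HasDerivAt (fun s : ℝ => volDensity g x₀ (displace χ₁ v s t y))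
      (fderiv ℝ (volDensity g x₀) y v * χ₁ (t, y)) 0 := by
    have h1 : HasDerivAt (fun s : ℝ => displace χ₁ v s t y) (χ₁ (t, y) • v) 0 := by
      show HasDerivAt (fun s : ℝ => y + (s * χ₁ (t, y)) • v) _ 0
      simpa using ((((hasDerivAt_id (0 : ℝ)).mul_const (χ₁ (t, y))).smul_const v).const_add y)
    have h0 : displace χ₁ v 0 t y = y := by simp [displace]
    have h2 : HasFDerivAt (volDensity g x₀) (fderiv ℝ (volDensity g x₀) y)
        (displace χ₁ v 0 t y) := by
      rw [h0]
      exact (((contDiffOn_volDensity g x₀).contDiffAt ((isOpen_chart_target x₀).mem_nhds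
        hy)).differentiableAt (by simp)).hasFDerivAt
    have h3 := HasFDerivAt.comp_hasDerivAt (f := fun s : ℝ => displace χ₁ v s t y) 0 h2 h1
    rw [map_smul, smul_eq_mul, mul_comm] at h3
    exact h3
  have hw2 : HasDerivAt (fun s : ℝ => 1 + s * fderiv ℝ χ₁ (t, y) (0, v))
      (fderiv ℝ χ₁ (t, y) (0, v)) 0 := by
    simpa using ((hasDerivAt_id (0 : ℝ)).mul_const (fderiv ℝ χ₁ (t, y) (0, v))).const_add 1
  have hw := hw1.mul hw2
  set w : ℝ → ℝ := fun s => volDensity g x₀ (displace χ₁ v s t y) *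
    (1 + s * fderiv ℝ χ₁ (t, y) (0, v)) with hwdef
  have hw0 : w 0 = volDensity g x₀ y := by simp [hwdef, displace]
  have hwd : HasDerivAt w (fderiv ℝ (volDensity g x₀) y v * χ₁ (t, y) +
      volDensity g x₀ y * fderiv ℝ χ₁ (t, y) (0, v)) 0 := by
    refine hw.congr_deriv ?_
    simp [displace]
  set w' := fderiv ℝ (volDensity g x₀) y v * χ₁ (t, y) +
      volDensity g x₀ y * fderiv ℝ χ₁ (t, y) (0, v) with hw'
  have hmw : m / w 0 = ρ := by rw [hw0, hmv, mul_div_cancel_right₀ _ hvol.ne']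
  have hq := (hasDerivAt_const (0 : ℝ) m).div hwd (by rw [hw0]; exact hvol.ne')
  have hld : HasDerivAt lam (deriv lam ρ) (m / w 0) := by
    rw [hmw]
    exact ((hlam.contDiffAt (Ioi_mem_nhds hρ0)).differentiableAt (by simp)).hasDerivAt
  have hl := (hld.comp (0 : ℝ) hq).mul hwd
  have hr : HasDerivAt (fun s : ℝ => (R + s * fderiv ℝ χ₂ (t, y) (1, V)) ^ 2)
      (2 * R * fderiv ℝ χ₂ (t, y) (1, V)) 0 := by
    have h1 : HasDerivAt (fun s : ℝ => R + s * fderiv ℝ χ₂ (t, y) (1, V))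
        (fderiv ℝ χ₂ (t, y) (1, V)) 0 := by
      simpa using ((hasDerivAt_id (0 : ℝ)).mul_const (fderiv ℝ χ₂ (t, y) (1, V))).const_add R
    simpa using h1.fun_pow 2
  have hn := hasDerivAt_normSqC g hy V v (χ₁ (t, y)) (fderiv ℝ χ₁ (t, y) (1, V))
  have hall := (hl.mul hr).add (hn.const_mul m)
  refine (hall.congr_deriv ?_).congr_of_eventuallyEq (Eventually.of_forall fun s => ?_)
  · simp only [Pi.mul_apply, Pi.div_apply, Function.comp, hw0, phi, zero_mul, add_zero]
    rw [hmv]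
    field_simp
    ring
  · rfl

variable [IsManifold (𝓡 n) ∞ N]

theorem contDiffOn_pulledEnergy (g : Metric n M) (ν : VolumeForm n N) {lam : ℝ → ℝ}
    (hlam : ContDiffOn ℝ ∞ lam (Ioi 0)) (hJ : IsOpen J)
    (hη : ContMDiffOn (𝓘(ℝ, ℝ).prod (𝓡 n)) (𝓡 n) ∞ (fun z : ℝ × N => η z.1 z.2) (J ×ˢ univ))
    (hF : ContMDiffOn (𝓘(ℝ, ℝ).prod (𝓡 n)) 𝓘(ℝ, ℝ) ∞ (fun z : ℝ × N => F z.1 z.2) (J ×ˢ univ))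
    (h1 : ContDiff ℝ ∞ χ₁) (h2 : ContDiff ℝ ∞ χ₂) {S : Set ℝ}
    (hmaps : ∀ s ∈ S, ∀ t, MapsTo (displace χ₁ v s t) (extChartAt (𝓡 n) x₀).target
      (extChartAt (𝓡 n) x₀).target)
    (hpos : ∀ s ∈ S, ∀ z, 0 < 1 + s * fderiv ℝ χ₁ z (0, v)) :
    ContDiffOn ℝ ∞ (fun q : ℝ × ℝ × Model n => pulledEnergy g ν lam η F x₀ χ₁ χ₂ v q.1 q.2)
      (S ×ˢ J ×ˢ (extChartAt (𝓡 n) x₀).target) := by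
  set Q := S ×ˢ J ×ˢ (extChartAt (𝓡 n) x₀).target with hQ
  have hq2 : MapsTo (fun q : ℝ × ℝ × Model n => q.2) Q (J ×ˢ (extChartAt (𝓡 n) x₀).target) :=
    fun q hq => hq.2
  have hm : ContDiffOn ℝ ∞ (fun q : ℝ × ℝ × Model n => massC g ν η x₀ q.2) Q :=
    (contDiffOn_massC g ν hJ hη x₀).comp contDiffOn_snd hq2
  have hV : ContDiffOn ℝ ∞ (fun q : ℝ × ℝ × Model n => velC η x₀ q.2) Q :=
    (contDiffOn_velC hJ hη x₀).comp contDiffOn_snd hq2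
  have hR : ContDiffOn ℝ ∞ (fun q : ℝ × ℝ × Model n => rateC η F x₀ q.2) Q :=
    (contDiffOn_rateC hJ hη hF x₀).comp contDiffOn_snd hq2
  have hs : ContDiffOn ℝ ∞ (fun q : ℝ × ℝ × Model n => q.1) Q := contDiffOn_fst
  have hD : ∀ {χ : ℝ × Model n → ℝ}, ContDiff ℝ ∞ χ →
      ContDiffOn ℝ ∞ (fun q : ℝ × ℝ × Model n => fderiv ℝ χ q.2 (1, velC η x₀ q.2)) Q :=
    fun hχ => (contDiff_fderiv_apply_const hχ).comp_contDiffOn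
      (contDiffOn_snd.prodMk (contDiffOn_const.prodMk hV))
  have hDv : ContDiffOn ℝ ∞ (fun q : ℝ × ℝ × Model n => fderiv ℝ χ₁ q.2 (0, v)) Q :=
    (contDiff_fderiv_apply_const h1).comp_contDiffOn (contDiffOn_snd.prodMk contDiffOn_const)
  have hdisp : ContDiffOn ℝ ∞
      (fun q : ℝ × ℝ × Model n => displace χ₁ v q.1 q.2.1 q.2.2) Q := by
    have e1 : ContDiffOn ℝ ∞ (fun q : ℝ × ℝ × Model n => χ₁ (q.2.1, q.2.2)) Q :=
      h1.comp_contDiffOn contDiffOn_snd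
    exact (contDiff_snd.comp contDiff_snd).contDiffOn.add ((hs.mul e1).smul contDiffOn_const)
  have hdm : ∀ q ∈ Q, displace χ₁ v q.1 q.2.1 q.2.2 ∈ (extChartAt (𝓡 n) x₀).target :=
    fun q hq => hmaps q.1 hq.1 q.2.1 hq.2.2
  have hw : ContDiffOn ℝ ∞ (fun q : ℝ × ℝ × Model n =>
      volDensity g x₀ (displace χ₁ v q.1 q.2.1 q.2.2) * (1 + q.1 * fderiv ℝ χ₁ q.2 (0, v))) Q :=
    ((contDiffOn_volDensity g x₀).comp hdisp hdm).mul (contDiffOn_const.add (hs.mul hDv))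
  have hw0 : ∀ q ∈ Q, 0 < volDensity g x₀ (displace χ₁ v q.1 q.2.1 q.2.2) *
      (1 + q.1 * fderiv ℝ χ₁ q.2 (0, v)) := fun q hq =>
    mul_pos (volDensity_pos g (hdm q hq)) (hpos q.1 hq.1 q.2)
  have hl := hlam.comp (hm.div hw fun q hq => (hw0 q hq).ne') fun q hq =>
    div_pos (mul_pos (densC_pos g ν η x₀ q.2) (volDensity_pos g hq.2.2)) (hw0 q hq)
  have hA := (hl.mul hw).mul ((hR.add (hs.mul (hD h2))).pow 2)
  have hVs : ContDiffOn ℝ ∞ (fun q : ℝ × ℝ × Model n => velC η x₀ q.2 +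
      (q.1 * fderiv ℝ χ₁ q.2 (1, velC η x₀ q.2)) • v) Q :=
    hV.add ((hs.mul (hD h1)).smul contDiffOn_const)
  have hB := hm.mul (contDiffOn_normSqC_comp g hdisp hVs hdm)
  exact hA.add hB

end FirstVariation

end BarotropicFlow

/-! ### Criticality of the energy and the weak geodesic equation. -/

namespace BarotropicFlow

section CriticalPoints

open Filter Topology

variable {n : ℕ}
  {N : Type*} [TopologicalSpace N] [ChartedSpace (Model n) N]
  {M : Type*} [TopologicalSpace M] [ChartedSpace (Model n) M] [IsManifold (𝓡 n) ∞ M]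
  {η : ℝ → N ≃ₘ⟮𝓡 n, 𝓡 n⟯ M} {F : ℝ → C^∞⟮𝓡 n, N; 𝓘(ℝ, ℝ), ℝ⟯} {J : Set ℝ} {x₀ : M}
  {χ₁ χ₂ : ℝ × Model n → ℝ} {v : Model n}

open Classical in
-- The difference already vanishes off the closed set `K ⊆ U`, so cutting it off at `U` costs no
-- smoothness. The result is defined on the whole space, as needed for differentiating under the
-- integral sign.
theorem contDiffOn_ite_sub {Z : Type*} [NormedAddCommGroup Z] [NormedSpace ℝ Z] {P : ℝ → Z → ℝ}
    {S : Set ℝ} {U W K : Set Z} (hS : IsOpen S) (hS0 : 0 ∈ S) (hU : IsOpen U) (hW : IsOpen W)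
    (hK : IsClosed K) (hUW : U ⊆ W) (hKU : K ⊆ U)
    (hP : ContDiffOn ℝ ∞ (fun q : ℝ × Z => P q.1 q.2) (S ×ˢ W))
    (hPK : ∀ s, ∀ z ∉ K, P s z = P 0 z) :
    ContDiffOn ℝ ∞ (fun q : ℝ × Z => if q.2 ∈ U then P q.1 q.2 - P 0 q.2 else 0)
      (S ×ˢ univ) := by
  rintro ⟨s, z⟩ ⟨hs, -⟩
  refine ContDiffAt.contDiffWithinAt ?_
  have hQo : IsOpen (S ×ˢ W) := hS.prod hW
  by_cases hz : z ∈ U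
  · have e1 := hP.contDiffAt (hQo.mem_nhds (x := (s, z)) ⟨hs, hUW hz⟩)
    have e2 : ContDiffAt ℝ ∞ (fun q : ℝ × Z => P 0 q.2) (s, z) :=
      ContDiffAt.comp (s, z) (g := fun q : ℝ × Z => P q.1 q.2) (f := fun q : ℝ × Z => (0, q.2))
        (hP.contDiffAt (hQo.mem_nhds (x := (0, z)) ⟨hS0, hUW hz⟩))
        (contDiffAt_const.prodMk contDiffAt_snd)
    refine (e1.sub e2).congr_of_eventuallyEq ?_
    filter_upwards [(continuous_snd.tendsto (s, z)).eventually (hU.mem_nhds hz)] with q hq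
    exact if_pos hq
  · have hzK : z ∈ Kᶜ := fun h => hz (hKU h)
    refine (contDiffAt_const (c := (0 : ℝ))).congr_of_eventuallyEq ?_
    filter_upwards [(continuous_snd.tendsto (s, z)).eventually (hK.isOpen_compl.mem_nhds hzK)]
      with q hq
    rw [hPK q.1 q.2 hq, sub_self, ite_self]

open Classical in
/-- The change of the energy density under a chart variation. -/
noncomputable def energyChange (g : Metric n M) (ν : VolumeForm n N) (lam : ℝ → ℝ)
    (η : ℝ → N ≃ₘ⟮𝓡 n, 𝓡 n⟯ M) (F : ℝ → C^∞⟮𝓡 n, N; 𝓘(ℝ, ℝ), ℝ⟯) (x₀ : M)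
    (χ₁ χ₂ : ℝ × Model n → ℝ) (v : Model n) (U : Set (ℝ × Model n)) (s : ℝ) (z : ℝ × Model n) : ℝ :=
  if z ∈ U then pulledEnergy g ν lam η F x₀ χ₁ χ₂ v s z - pulledEnergy g ν lam η F x₀ χ₁ χ₂ v 0 z
  else 0

theorem energyChange_eq_zero (g : Metric n M) (ν : VolumeForm n N) (lam : ℝ → ℝ)
    (U : Set (ℝ × Model n)) (s : ℝ) {z : ℝ × Model n} (hz : z ∉ tsupport χ₁ ∪ tsupport χ₂) :
    energyChange g ν lam η F x₀ χ₁ χ₂ v U s z = 0 := by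
  have h := pulledEnergy_eq_off (η := η) (F := F) (x₀ := x₀) (v := v) g ν lam s
    (fun h => hz (Or.inl h)) (fun h => hz (Or.inr h))
  unfold energyChange
  split_ifs
  · rw [h, sub_self]
  · rfl

/-- The density of the first variation of the energy under a chart variation. -/
noncomputable def variationDensity (g : Metric n M) (ν : VolumeForm n N) (lam : ℝ → ℝ)
    (η : ℝ → N ≃ₘ⟮𝓡 n, 𝓡 n⟯ M) (F : ℝ → C^∞⟮𝓡 n, N; 𝓘(ℝ, ℝ), ℝ⟯) (x₀ : M)
    (χ₁ χ₂ : ℝ × Model n → ℝ) (v : Model n) (z : ℝ × Model n) : ℝ :=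
  phi lam (densC g ν η x₀ z) * rateC η F x₀ z ^ 2 *
      (fderiv ℝ (volDensity g x₀) z.2 v * χ₁ z + volDensity g x₀ z.2 * fderiv ℝ χ₁ z (0, v)) +
    lam (densC g ν η x₀ z) * volDensity g x₀ z.2 * rateC η F x₀ z *
      fderiv ℝ χ₂ z (1, velC η x₀ z) +
    massC g ν η x₀ z *
      (χ₁ z * (1 / 2) * (∑ i, ∑ j, fderiv ℝ (fun w => gram g x₀ w i j) z.2 v *
        velC η x₀ z i * velC η x₀ z j) +
      fderiv ℝ χ₁ z (1, velC η x₀ z) *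
        ∑ i, ∑ j, gram g x₀ z.2 i j * v i * velC η x₀ z j)

variable [IsManifold (𝓡 n) ∞ N]

theorem contDiffOn_energyChange (g : Metric n M) (ν : VolumeForm n N) {lam : ℝ → ℝ}
    (hlam : ContDiffOn ℝ ∞ lam (Ioi 0)) (hJ : IsOpen J)
    (hη : ContMDiffOn (𝓘(ℝ, ℝ).prod (𝓡 n)) (𝓡 n) ∞ (fun z : ℝ × N => η z.1 z.2) (J ×ˢ univ))
    (hF : ContMDiffOn (𝓘(ℝ, ℝ).prod (𝓡 n)) 𝓘(ℝ, ℝ) ∞ (fun z : ℝ × N => F z.1 z.2) (J ×ˢ univ))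
    (h1 : ContDiff ℝ ∞ χ₁) (h2 : ContDiff ℝ ∞ χ₂) {S : Set ℝ} (hS : IsOpen S) (hS0 : 0 ∈ S)
    (hmaps : ∀ s ∈ S, ∀ t, MapsTo (displace χ₁ v s t) (extChartAt (𝓡 n) x₀).target
      (extChartAt (𝓡 n) x₀).target)
    (hpos : ∀ s ∈ S, ∀ z, 0 < 1 + s * fderiv ℝ χ₁ z (0, v))
    {U : Set (ℝ × Model n)} (hU : IsOpen U) (hUJ : U ⊆ J ×ˢ (extChartAt (𝓡 n) x₀).target)
    (h1s : tsupport χ₁ ⊆ U) (h2s : tsupport χ₂ ⊆ U) :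
    ContDiffOn ℝ ∞ (fun q : ℝ × ℝ × Model n =>
      energyChange g ν lam η F x₀ χ₁ χ₂ v U q.1 q.2) (S ×ˢ univ) := by
  have hP := contDiffOn_pulledEnergy g ν hlam hJ hη hF h1 h2 hmaps hpos
  exact contDiffOn_ite_sub hS hS0 hU (hJ.prod (isOpen_chart_target x₀))
    ((isClosed_tsupport χ₁).union (isClosed_tsupport χ₂)) hUJ (union_subset h1s h2s) hP
    fun s z hz => pulledEnergy_eq_off g ν lam s (fun h => hz (Or.inl h)) (fun h => hz (Or.inr h))

variable [T2Space M] [CompactSpace M] [MeasurableSpace M] [BorelSpace M]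

/-- The energy of a chart variation, as an integral over the model space. -/
theorem IsChartVariation.energy_eq {s : ℝ} {Φ : ℝ → M ≃ₘ⟮𝓡 n, 𝓡 n⟯ M}
    {F' : ℝ → C^∞⟮𝓡 n, N; 𝓘(ℝ, ℝ), ℝ⟯} (h : IsChartVariation η F J x₀ χ₁ χ₂ v s Φ F')
    (g : Metric n M) (ν : VolumeForm n N) {lam : ℝ → ℝ} (hlam : ContDiffOn ℝ ∞ lam (Ioi 0))
    {a b : ℝ} (hab : a < b) (hJab : Icc a b ⊆ J)
    (hc : Continuous (energyChange g ν lam η F x₀ χ₁ χ₂ v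
      (Ioo a b ×ˢ (extChartAt (𝓡 n) x₀).target) s)) :
    energy g ν lam (fun τ => (η τ).trans (Φ τ)) F' a b = energy g ν lam η F a b +
      (1 / 2) * ∫ z, energyChange g ν lam η F x₀ χ₁ χ₂ v
        (Ioo a b ×ˢ (extChartAt (𝓡 n) x₀).target) s z := by
  set U := Ioo a b ×ˢ (extChartAt (𝓡 n) x₀).target with hU
  set D := energyChange g ν lam η F x₀ χ₁ χ₂ v U s with hD
  have hi : ∀ {η : ℝ → N ≃ₘ⟮𝓡 n, 𝓡 n⟯ M} {F : ℝ → C^∞⟮𝓡 n, N; 𝓘(ℝ, ℝ), ℝ⟯},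
      ContMDiffOn (𝓘(ℝ, ℝ).prod (𝓡 n)) (𝓡 n) ∞ (fun z : ℝ × N => η z.1 z.2) (J ×ˢ univ) →
      ContMDiffOn (𝓘(ℝ, ℝ).prod (𝓡 n)) 𝓘(ℝ, ℝ) ∞ (fun z : ℝ × N => F z.1 z.2) (J ×ˢ univ) →
      IntervalIntegrable (fun t => ∫ x, energyDensity g ν lam η F t x ∂(riemannianVolume g))
        volume a b := fun hη hF => by
    refine ((continuousOn_integral_energyDensity g ν hlam h.isOpen hη hF).mono ?_).intervalIntegrable
    rwa [uIcc_of_le hab.le]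
  have hDi : Integrable D :=
    hc.integrable_of_hasCompactSupport (HasCompactSupport.intro'
      (h.compact₁.isCompact.union h.compact₂.isCompact)
      ((isClosed_tsupport χ₁).union (isClosed_tsupport χ₂))
      fun z hz => energyChange_eq_zero g ν lam U s hz)
  -- By Fubini the space-time integral splits into time slices, each given by
  -- `integral_energyDensity_sub`. Extension by zero outside `U` allows integration over the whole
  -- space.
  have h1 : ∫ z, D z = ∫ t in a..b,
      ((∫ x, energyDensity g ν lam (fun τ => (η τ).trans (Φ τ)) F' t x ∂(riemannianVolume g)) -
        ∫ x, energyDensity g ν lam η F t x ∂(riemannianVolume g)) := by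
    rw [intervalIntegral.integral_of_le hab.le, integral_Ioc_eq_integral_Ioo,
      Measure.volume_eq_prod, integral_prod _ (by rwa [Measure.volume_eq_prod] at hDi)]
    rw [← setIntegral_eq_integral_of_forall_compl_eq_zero (s := Ioo a b)]
    · refine setIntegral_congr_fun measurableSet_Ioo fun t ht => ?_
      rw [h.integral_energyDensity_sub g ν hlam (hJab (Ioo_subset_Icc_self ht)),
        ← setIntegral_eq_integral_of_forall_compl_eq_zero (s := (extChartAt (𝓡 n) x₀).target)]
      · refine setIntegral_congr_fun (isOpen_chart_target x₀).measurableSet fun y hy => ?_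
        rw [hD, energyChange, if_pos (show (t, y) ∈ U from ⟨ht, hy⟩), pulledEnergy_zero g ν lam v hy]
      · exact fun y hy => if_neg fun h' => hy h'.2
    · intro t ht
      have : ∀ y, D (t, y) = 0 := fun y => if_neg fun h' => ht h'.1
      simp only [this, integral_zero]
  rw [h1, intervalIntegral.integral_sub (hi (η := fun τ => (η τ).trans (Φ τ)) h.smooth_fst
    h.smooth_snd) (hi h.base_fst h.base_snd)]
  simp only [energy, configMetric, energyDensity]
  ring

/-- The first variation of the energy vanishes along a geodesic. -/
theorem IsGeodesicOn.integral_eq_zero {g : Metric n M} {ν : VolumeForm n N} {lam : ℝ → ℝ}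
    (hgeo : IsGeodesicOn g ν lam η F J) (hJ : IsOpen J) (hlam : ContDiffOn ℝ ∞ lam (Ioi 0))
    {a b : ℝ} (hab : a < b) (hJab : Icc a b ⊆ J) (x₀ : M) (v : Model n)
    (h1 : ContDiff ℝ ∞ χ₁) (h1c : HasCompactSupport χ₁)
    (h1s : tsupport χ₁ ⊆ Ioo a b ×ˢ (extChartAt (𝓡 n) x₀).target)
    (h2 : ContDiff ℝ ∞ χ₂) (h2c : HasCompactSupport χ₂)
    (h2s : tsupport χ₂ ⊆ Ioo a b ×ˢ (extChartAt (𝓡 n) x₀).target) :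
    ∫ z, deriv (fun s => energyChange g ν lam η F x₀ χ₁ χ₂ v
      (Ioo a b ×ˢ (extChartAt (𝓡 n) x₀).target) s z) 0 = 0 := by
  obtain ⟨ε, hε, Φ, K, hvar, hΦ, hK⟩ :=
    exists_variation hgeo.smooth_fst hgeo.smooth_snd x₀ v h1 h1c h1s h2 h2c h2s
  set U := Ioo a b ×ˢ (extChartAt (𝓡 n) x₀).target with hU
  have hUJ : U ⊆ J ×ˢ (extChartAt (𝓡 n) x₀).target :=
    prod_mono (Ioo_subset_Icc_self.trans hJab) Subset.rfl
  have hcv : ∀ s ∈ Ioo (-ε) ε, IsChartVariation η F J x₀ χ₁ χ₂ v s (Φ s) (K s) := by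
    intro s hs
    have hmap : ContMDiff (𝓘(ℝ, ℝ).prod (𝓡 n)) (𝓘(ℝ, ℝ).prod (𝓘(ℝ, ℝ).prod (𝓡 n))) ∞
        (fun z : ℝ × N => (s, z.1, z.2)) :=
      contMDiff_const.prodMk (contMDiff_fst.prodMk contMDiff_snd)
    exact {
      isOpen := hJ
      base_fst := hgeo.smooth_fst
      base_snd := hgeo.smooth_snd
      smooth_fst := ContMDiffOn.comp
        (g := fun z : ℝ × ℝ × N => (η z.2.1).trans (Φ z.1 z.2.1) z.2.2)
        (f := fun z : ℝ × N => (s, z.1, z.2)) hvar.smooth_fst hmap.contMDiffOn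
        fun z hz => ⟨hs, hz.1, trivial⟩
      smooth_snd := ContMDiffOn.comp (g := fun z : ℝ × ℝ × N => K z.1 z.2.1 z.2.2)
        (f := fun z : ℝ × N => (s, z.1, z.2)) hvar.smooth_snd hmap.contMDiffOn
        fun z hz => ⟨hs, hz.1, trivial⟩
      smooth₁ := h1
      compact₁ := h1c
      subset₁ := h1s.trans hUJ
      smooth₂ := h2
      compact₂ := h2c
      subset₂ := h2s.trans hUJ
      jacobian_pos := fun t => (hΦ s hs t).1
      exists_equiv := fun t => (hΦ s hs t).2.1
      apply_fst := fun t => (hΦ s hs t).2.2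
      apply_snd := hK s }
  have hD := contDiffOn_energyChange g ν hlam hJ hgeo.smooth_fst hgeo.smooth_snd h1 h2 isOpen_Ioo
    (show (0 : ℝ) ∈ Ioo (-ε) ε from ⟨by linarith, hε⟩) (fun s hs t => (hcv s hs).mapsTo t)
    (fun s hs z => (hcv s hs).jacobian_pos z.1 z.2)
    (isOpen_Ioo.prod (isOpen_chart_target x₀)) hUJ h1s h2s
  have hder := hasDerivAt_integral_of_contDiffOn (μ := volume) hε
    (D := energyChange g ν lam η F x₀ χ₁ χ₂ v U)
    (h1c.isCompact.union h2c.isCompact) (hD.of_le (by simp))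
    fun s z hz => energyChange_eq_zero g ν lam U s hz
  have hcrit := hgeo.critical a b hab hJab ε hε _ K hvar
  have h3 : HasDerivAt (fun s => energy g ν lam (fun τ => (η τ).trans (Φ s τ)) (K s) a b)
      ((1 / 2) * ∫ z, deriv (fun s => energyChange g ν lam η F x₀ χ₁ χ₂ v U s z) 0) 0 := by
    -- The energy formula is available only for `|s| < ε`, which is enough for a derivative at `0`.
    refine ((hder.const_mul (1 / 2)).const_add (energy g ν lam η F a b)).congr_of_eventuallyEq ?_
    filter_upwards [Ioo_mem_nhds (show -ε < 0 by linarith) hε] with s hs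
    refine (hcv s hs).energy_eq g ν hlam hab hJab ?_
    exact hD.continuousOn.comp_continuous (f := fun z => (s, z)) (by fun_prop)
      fun z => ⟨hs, trivial⟩
  have h4 := hcrit.unique h3
  linarith

/-- The weak form of the geodesic equation in a chart. -/
theorem IsGeodesicOn.weak_form {g : Metric n M} {ν : VolumeForm n N} {lam : ℝ → ℝ}
    (hgeo : IsGeodesicOn g ν lam η F J) (hJ : IsOpen J) (hlam : ContDiffOn ℝ ∞ lam (Ioi 0))
    {a b : ℝ} (hab : a < b) (hJab : Icc a b ⊆ J) (x₀ : M) (v : Model n)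
    (h1 : ContDiff ℝ ∞ χ₁) (h1c : HasCompactSupport χ₁)
    (h1s : tsupport χ₁ ⊆ Ioo a b ×ˢ (extChartAt (𝓡 n) x₀).target)
    (h2 : ContDiff ℝ ∞ χ₂) (h2c : HasCompactSupport χ₂)
    (h2s : tsupport χ₂ ⊆ Ioo a b ×ˢ (extChartAt (𝓡 n) x₀).target) :
    ∫ z : ℝ × Model n, variationDensity g ν lam η F x₀ χ₁ χ₂ v z = 0 := by
  have h0 := hgeo.integral_eq_zero hJ hlam hab hJab x₀ v h1 h1c h1s h2 h2c h2s
  have h3 : ∀ z : ℝ × Model n, deriv (fun s => energyChange g ν lam η F x₀ χ₁ χ₂ v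
      (Ioo a b ×ˢ (extChartAt (𝓡 n) x₀).target) s z) 0 =
      2 * variationDensity g ν lam η F x₀ χ₁ χ₂ v z := by
    rintro ⟨t, y⟩
    -- Inside, the subtracted energy is constant in `s` and drops out; outside, the cutoffs and
    -- their derivatives vanish, so both sides are zero.
    by_cases hz : (t, y) ∈ Ioo a b ×ˢ (extChartAt (𝓡 n) x₀).target
    · simp only [energyChange, if_pos hz]
      exact ((hasDerivAt_pulledEnergy g ν hlam hz.2).sub_const _).deriv
    · simp only [energyChange, if_neg hz, deriv_const]
      have e1 : (t, y) ∉ tsupport χ₁ := fun h => hz (h1s h)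
      have e2 : (t, y) ∉ tsupport χ₂ := fun h => hz (h2s h)
      simp [variationDensity, image_eq_zero_of_notMem_tsupport e1, fderiv_of_notMem_tsupport (𝕜 := ℝ) e1,
        fderiv_of_notMem_tsupport (𝕜 := ℝ) e2]
  simp only [h3] at h0
  rw [integral_const_mul] at h0
  linarith

end CriticalPoints

end BarotropicFlow

/-! ### The geodesic equations in a chart. -/

namespace BarotropicFlow

section LocalEquations

open Filter Topology

variable {n : ℕ}
  {N : Type*} [TopologicalSpace N] [ChartedSpace (Model n) N]
  {M : Type*} [TopologicalSpace M] [ChartedSpace (Model n) M] [IsManifold (𝓡 n) ∞ M]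
  {η : ℝ → N ≃ₘ⟮𝓡 n, 𝓡 n⟯ M} {F : ℝ → C^∞⟮𝓡 n, N; 𝓘(ℝ, ℝ), ℝ⟯} {J : Set ℝ} {x₀ : M}

theorem contDiffOn_phi {lam : ℝ → ℝ} (hlam : ContDiffOn ℝ ∞ lam (Ioi 0)) :
    ContDiffOn ℝ ∞ (phi lam) (Ioi 0) :=
  contDiffOn_const.mul (hlam.sub (contDiffOn_id.mul (hlam.deriv_of_isOpen isOpen_Ioi (by simp))))

/-- The momentum density in the direction `v`, per unit mass. -/
noncomputable def momentumC (g : Metric n M) (η : ℝ → N ≃ₘ⟮𝓡 n, 𝓡 n⟯ M) (x₀ : M) (v : Model n)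
    (z : ℝ × Model n) : ℝ :=
  ∑ i, ∑ j, gram g x₀ z.2 i j * v i * velC η x₀ z j

/-- The quantity `λ(ρ) f`, in the chart at `x₀`. -/
noncomputable def chargeC (g : Metric n M) (ν : VolumeForm n N) (lam : ℝ → ℝ)
    (η : ℝ → N ≃ₘ⟮𝓡 n, 𝓡 n⟯ M) (F : ℝ → C^∞⟮𝓡 n, N; 𝓘(ℝ, ℝ), ℝ⟯) (x₀ : M)
    (z : ℝ × Model n) : ℝ :=
  lam (densC g ν η x₀ z) * rateC η F x₀ z

/-- The quantity `φ(ρ) f²`, in the chart at `x₀`. -/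
noncomputable def pressureC (g : Metric n M) (ν : VolumeForm n N) (lam : ℝ → ℝ)
    (η : ℝ → N ≃ₘ⟮𝓡 n, 𝓡 n⟯ M) (F : ℝ → C^∞⟮𝓡 n, N; 𝓘(ℝ, ℝ), ℝ⟯) (x₀ : M)
    (z : ℝ × Model n) : ℝ :=
  phi lam (densC g ν η x₀ z) * rateC η F x₀ z ^ 2

theorem contDiffOn_momentumC (g : Metric n M) (hJ : IsOpen J)
    (hη : ContMDiffOn (𝓘(ℝ, ℝ).prod (𝓡 n)) (𝓡 n) ∞ (fun z : ℝ × N => η z.1 z.2) (J ×ˢ univ))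
    (x₀ : M) (v : Model n) :
    ContDiffOn ℝ ∞ (momentumC g η x₀ v) (J ×ˢ (extChartAt (𝓡 n) x₀).target) := by
  refine ContDiffOn.sum fun i _ => ContDiffOn.sum fun j _ => ?_
  have h1 : ContDiffOn ℝ ∞ (fun z : ℝ × Model n => gram g x₀ z.2 i j)
      (J ×ˢ (extChartAt (𝓡 n) x₀).target) :=
    (contDiffOn_gram g x₀ i j).comp contDiffOn_snd fun _ hz => hz.2
  exact (h1.mul contDiffOn_const).mul
    ((EuclideanSpace.proj (𝕜 := ℝ) j).contDiff.comp_contDiffOn (contDiffOn_velC hJ hη x₀))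

theorem exists_Icc_subset_of_isOpen (hJ : IsOpen J) {t : ℝ} (ht : t ∈ J) :
    ∃ a b, t ∈ Ioo a b ∧ Icc a b ⊆ J := by
  obtain ⟨ε, hε, h⟩ := Metric.isOpen_iff.1 hJ t ht
  refine ⟨t - ε / 2, t + ε / 2, ⟨by linarith, by linarith⟩, fun s hs => h ?_⟩
  rw [Metric.mem_ball, Real.dist_eq, abs_lt]
  exact ⟨by linarith [hs.1], by linarith [hs.2]⟩

theorem isAddHaarMeasure_volume_prod : (volume : Measure (ℝ × Model n)).IsAddHaarMeasure := by
  rw [Measure.volume_eq_prod]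
  infer_instance

variable [IsManifold (𝓡 n) ∞ N]

theorem contDiffOn_chargeC (g : Metric n M) (ν : VolumeForm n N) {lam : ℝ → ℝ}
    (hlam : ContDiffOn ℝ ∞ lam (Ioi 0)) (hJ : IsOpen J)
    (hη : ContMDiffOn (𝓘(ℝ, ℝ).prod (𝓡 n)) (𝓡 n) ∞ (fun z : ℝ × N => η z.1 z.2) (J ×ˢ univ))
    (hF : ContMDiffOn (𝓘(ℝ, ℝ).prod (𝓡 n)) 𝓘(ℝ, ℝ) ∞ (fun z : ℝ × N => F z.1 z.2) (J ×ˢ univ))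
    (x₀ : M) :
    ContDiffOn ℝ ∞ (chargeC g ν lam η F x₀) (J ×ˢ (extChartAt (𝓡 n) x₀).target) := by
  have h1 := contDiffOn_densC g ν hJ hη x₀
  have h2 := contDiffOn_rateC hJ hη hF x₀
  have h3 := hlam.comp h1 fun z _ => densC_pos g ν η x₀ z
  exact h3.mul h2

theorem contDiffOn_pressureC (g : Metric n M) (ν : VolumeForm n N) {lam : ℝ → ℝ}
    (hlam : ContDiffOn ℝ ∞ lam (Ioi 0)) (hJ : IsOpen J)
    (hη : ContMDiffOn (𝓘(ℝ, ℝ).prod (𝓡 n)) (𝓡 n) ∞ (fun z : ℝ × N => η z.1 z.2) (J ×ˢ univ))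
    (hF : ContMDiffOn (𝓘(ℝ, ℝ).prod (𝓡 n)) 𝓘(ℝ, ℝ) ∞ (fun z : ℝ × N => F z.1 z.2) (J ×ˢ univ))
    (x₀ : M) :
    ContDiffOn ℝ ∞ (pressureC g ν lam η F x₀) (J ×ˢ (extChartAt (𝓡 n) x₀).target) := by
  have h1 := contDiffOn_densC g ν hJ hη x₀
  have h2 := contDiffOn_rateC hJ hη hF x₀
  have h3 := (contDiffOn_phi hlam).comp h1 fun z _ => densC_pos g ν η x₀ z
  exact h3.mul (h2.pow 2)

variable [T2Space M] [CompactSpace M] [MeasurableSpace M] [BorelSpace M]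

/-- Conservation of `λ(ρ) f` along a geodesic, in a chart. -/
theorem IsGeodesicOn.charge_equation {g : Metric n M} {ν : VolumeForm n N} {lam : ℝ → ℝ}
    (hgeo : IsGeodesicOn g ν lam η F J) (hJ : IsOpen J) (hlam : ContDiffOn ℝ ∞ lam (Ioi 0))
    (x₀ : M) {t : ℝ} (ht : t ∈ J) {y : Model n} (hy : y ∈ (extChartAt (𝓡 n) x₀).target) :
    fderiv ℝ (fun z : ℝ × Model n => volDensity g x₀ z.2 * chargeC g ν lam η F x₀ z) (t, y) (1, 0) +
      ∑ i, fderiv ℝ (fun z : ℝ × Model n => volDensity g x₀ z.2 * chargeC g ν lam η F x₀ z *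
        velC η x₀ z i) (t, y) (0, EuclideanSpace.single i 1) = 0 := by
  obtain ⟨a, b, htab, hab⟩ := exists_Icc_subset_of_isOpen hJ ht
  set U := Ioo a b ×ˢ (extChartAt (𝓡 n) x₀).target with hU
  have hUJ : U ⊆ J ×ˢ (extChartAt (𝓡 n) x₀).target :=
    prod_mono (Ioo_subset_Icc_self.trans hab) Subset.rfl
  have hUo : IsOpen U := isOpen_Ioo.prod (isOpen_chart_target x₀)
  set Q : ℝ × Model n → ℝ := fun z => volDensity g x₀ z.2 * chargeC g ν lam η F x₀ z with hQ
  have hQs : ContDiffOn ℝ ∞ Q U :=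
    ((contDiffOn_volDensity g x₀).comp contDiffOn_snd fun _ hz => hz.2).mul
      ((contDiffOn_chargeC g ν hlam hJ hgeo.smooth_fst hgeo.smooth_snd x₀).mono hUJ)
  have hVs : ∀ i, ContDiffOn ℝ ∞ (fun z => velC η x₀ z i) U := fun i =>
    (EuclideanSpace.proj (𝕜 := ℝ) i).contDiff.comp_contDiffOn
      ((contDiffOn_velC hJ hgeo.smooth_fst x₀).mono hUJ)
  have := isAddHaarMeasure_volume_prod (n := n)
  -- The index `none` stands for the time direction and `some i` for the `i`-th coordinate. Only the
  -- second component is varied (`χ₁ = 0`), so every term contains a derivative of the cutoff and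
  -- `A` is zero.
  have key := eq_sum_fderiv_of_forall_integral_eq_zero (μ := (volume : Measure (ℝ × Model n))) hUo
    (ι := Option (Fin n)) (A := fun _ => 0)
    (B := fun o => o.elim Q fun i z => Q z * velC η x₀ z i)
    (v := fun o => o.elim (1, 0) fun i => (0, EuclideanSpace.single i 1))
    continuousOn_const (by
      rintro (_ | i)
      · exact hQs.of_le (by simp)
      · exact (hQs.mul (hVs i)).of_le (by simp)) (by
      intro χ hχ hχc hχs
      have hw := hgeo.weak_form hJ hlam (htab.1.trans htab.2) hab x₀ 0
        (χ₁ := fun _ => 0) contDiff_const HasCompactSupport.zero (by simp [tsupport]) hχ hχc hχs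
      refine Eq.trans ?_ hw
      refine integral_congr_ae (Eventually.of_forall fun z => ?_)
      simp only [variationDensity, Fintype.sum_option, Option.elim_none, Option.elim_some, hQ,
        chargeC]
      have e1 := fderiv_apply_eq_sum (h := χ) (z := z) 1 (velC η x₀ z)
      simp
      rw [e1, mul_add, Finset.mul_sum]
      congr 1
      · ring
      · exact Finset.sum_congr rfl fun i _ => by ring) (t, y) ⟨htab, hy⟩
  simp only [Fintype.sum_option, Option.elim_none, Option.elim_some] at key
  exact key.symm

/-- The momentum equation of a geodesic, in a chart. -/
theorem IsGeodesicOn.momentum_equation {g : Metric n M} {ν : VolumeForm n N} {lam : ℝ → ℝ}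
    (hgeo : IsGeodesicOn g ν lam η F J) (hJ : IsOpen J) (hlam : ContDiffOn ℝ ∞ lam (Ioi 0))
    (x₀ : M) {t : ℝ} (ht : t ∈ J) {y : Model n} (hy : y ∈ (extChartAt (𝓡 n) x₀).target)
    (v : Model n) :
    densC g ν η x₀ (t, y) * ((1 / 2) * ∑ i, ∑ j, fderiv ℝ (fun w => gram g x₀ w i j) y v *
        velC η x₀ (t, y) i * velC η x₀ (t, y) j) =
      fderiv ℝ (pressureC g ν lam η F x₀) (t, y) (0, v) +
        densC g ν η x₀ (t, y) * fderiv ℝ (momentumC g η x₀ v) (t, y) (1, velC η x₀ (t, y)) := by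
  obtain ⟨a, b, htab, hab⟩ := exists_Icc_subset_of_isOpen hJ ht
  set U := Ioo a b ×ˢ (extChartAt (𝓡 n) x₀).target with hU
  have hUJ : U ⊆ J ×ˢ (extChartAt (𝓡 n) x₀).target :=
    prod_mono (Ioo_subset_Icc_self.trans hab) Subset.rfl
  have hUo : IsOpen U := isOpen_Ioo.prod (isOpen_chart_target x₀)
  set P := pressureC g ν lam η F x₀ with hP
  set m := massC g ν η x₀ with hm
  set L := momentumC g η x₀ v with hL
  have hPs : ContDiffOn ℝ ∞ P U :=
    (contDiffOn_pressureC g ν hlam hJ hgeo.smooth_fst hgeo.smooth_snd x₀).mono hUJ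
  have hms : ContDiffOn ℝ ∞ m U := (contDiffOn_massC g ν hJ hgeo.smooth_fst x₀).mono hUJ
  have hLs : ContDiffOn ℝ ∞ L U := (contDiffOn_momentumC g hJ hgeo.smooth_fst x₀ v).mono hUJ
  have hvs : ContDiffOn ℝ ∞ (fun z : ℝ × Model n => volDensity g x₀ z.2) U :=
    (contDiffOn_volDensity g x₀).comp contDiffOn_snd fun _ hz => hz.2
  have hVs : ∀ i, ContDiffOn ℝ ∞ (fun z => velC η x₀ z i) U := fun i =>
    (EuclideanSpace.proj (𝕜 := ℝ) i).contDiff.comp_contDiffOn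
      ((contDiffOn_velC hJ hgeo.smooth_fst x₀).mono hUJ)
  have hGs : ∀ i j, ContinuousOn (fun z : ℝ × Model n =>
      fderiv ℝ (fun w => gram g x₀ w i j) z.2 v) U := fun i j => by
    have h1 : ContinuousOn (fun w => fderiv ℝ (fun w => gram g x₀ w i j) w v)
        (extChartAt (𝓡 n) x₀).target :=
      ((contDiffOn_gram g x₀ i j).continuousOn_fderiv_of_isOpen (isOpen_chart_target x₀)
        (by simp)).clm_apply continuousOn_const
    exact h1.comp continuousOn_snd fun z hz => hz.2
  have hdv : ContinuousOn (fun z : ℝ × Model n => fderiv ℝ (volDensity g x₀) z.2 v) U := by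
    have h1 : ContinuousOn (fun w => fderiv ℝ (volDensity g x₀) w v)
        (extChartAt (𝓡 n) x₀).target :=
      ((contDiffOn_volDensity g x₀).continuousOn_fderiv_of_isOpen (isOpen_chart_target x₀)
        (by simp)).clm_apply continuousOn_const
    exact h1.comp continuousOn_snd fun z hz => hz.2
  set A : ℝ × Model n → ℝ := fun z => P z * fderiv ℝ (volDensity g x₀) z.2 v + m z * ((1 / 2) *
    ∑ i, ∑ j, fderiv ℝ (fun w => gram g x₀ w i j) z.2 v * velC η x₀ z i * velC η x₀ z j) with hA
  have hAc : ContinuousOn A U :=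
    (hPs.continuousOn.mul hdv).add (hms.continuousOn.mul (continuousOn_const.mul
      (continuousOn_finsetSum _ fun i _ => continuousOn_finsetSum _ fun j _ =>
        ((hGs i j).mul (hVs i).continuousOn).mul (hVs j).continuousOn)))
  have := isAddHaarMeasure_volume_prod (n := n)
  -- Now only the first component is varied. The outer `none` is the derivative of `χ` along `v`,
  -- from the change of volume; the remaining indices are the time and coordinate parts of its
  -- material derivative. `A` collects the terms in which `χ` itself appears.
  have key := eq_sum_fderiv_of_forall_integral_eq_zero (μ := (volume : Measure (ℝ × Model n))) hUo
    (ι := Option (Option (Fin n))) (A := A)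
    (B := fun o => o.elim (fun z => P z * volDensity g x₀ z.2) fun o =>
      o.elim (fun z => m z * L z) fun i z => m z * L z * velC η x₀ z i)
    (v := fun o => o.elim (0, v) fun o => o.elim (1, 0) fun i => (0, EuclideanSpace.single i 1))
    hAc (by
      rintro (_ | _ | i)
      · exact (hPs.mul hvs).of_le (by simp)
      · exact (hms.mul hLs).of_le (by simp)
      · exact ((hms.mul hLs).mul (hVs i)).of_le (by simp)) (by
      intro χ hχ hχc hχs
      have hw := hgeo.weak_form hJ hlam (htab.1.trans htab.2) hab x₀ v hχ hχc hχs
        (χ₂ := fun _ => 0) contDiff_const HasCompactSupport.zero (by simp [tsupport])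
      refine Eq.trans ?_ hw
      refine integral_congr_ae (Eventually.of_forall fun z => ?_)
      have e1 := fderiv_apply_eq_sum (h := χ) (z := z) 1 (velC η x₀ z)
      have e2 : ∑ i, fderiv ℝ χ z (0, EuclideanSpace.single i 1) * (m z * L z * velC η x₀ z i) =
          m z * L z * ∑ i, velC η x₀ z i * fderiv ℝ χ z (0, EuclideanSpace.single i 1) := by
        rw [Finset.mul_sum]
        exact Finset.sum_congr rfl fun i _ => by ring
      simp only [variationDensity, Fintype.sum_option, Option.elim_none, Option.elim_some]
      rw [e1, e2, fderiv_fun_const]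
      simp only [hA, hP, hm, hL, pressureC, momentumC, Pi.zero_apply,
        zero_apply]
      ring) (t, y) ⟨htab, hy⟩
  simp only [Fintype.sum_option, Option.elim_none, Option.elim_some] at key
  have hz : (t, y) ∈ U := ⟨htab, hy⟩
  have dP := ((hPs.contDiffAt (hUo.mem_nhds hz)).differentiableAt (by simp)).hasFDerivAt
  have dm := ((hms.contDiffAt (hUo.mem_nhds hz)).differentiableAt (by simp)).hasFDerivAt
  have dL := ((hLs.contDiffAt (hUo.mem_nhds hz)).differentiableAt (by simp)).hasFDerivAt
  have dV := fun i => (((hVs i).contDiffAt (hUo.mem_nhds hz)).differentiableAt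
    (by simp)).hasFDerivAt
  have dvol : HasFDerivAt (fun z : ℝ × Model n => volDensity g x₀ z.2)
      ((fderiv ℝ (volDensity g x₀) y).comp (ContinuousLinearMap.snd ℝ ℝ (Model n))) (t, y) :=
    HasFDerivAt.comp (t, y) (g := volDensity g x₀) (f := Prod.snd)
      (((contDiffOn_volDensity g x₀).contDiffAt ((isOpen_chart_target x₀).mem_nhds
        hy)).differentiableAt (by simp)).hasFDerivAt hasFDerivAt_snd
  have hcont := continuity_advective g ν hJ hgeo.smooth_fst x₀ ht hy
  rw [(dP.fun_mul dvol).fderiv, (dm.fun_mul dL).fderiv] at key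
  simp only [((dm.fun_mul dL).fun_mul (dV _)).fderiv] at key
  simp only [add_apply, smul_apply, smul_eq_mul,
    ContinuousLinearMap.comp_apply, ContinuousLinearMap.coe_snd', hA] at key
  rw [← hm, fderiv_apply_eq_sum] at hcont
  rw [fderiv_apply_eq_sum (h := L)]
  have hsum : ∑ i, (m (t, y) * L (t, y) * fderiv ℝ (fun z => velC η x₀ z i) (t, y)
        (0, EuclideanSpace.single i 1) + velC η x₀ (t, y) i *
        (m (t, y) * fderiv ℝ L (t, y) (0, EuclideanSpace.single i 1) +
          L (t, y) * fderiv ℝ m (t, y) (0, EuclideanSpace.single i 1))) =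
      m (t, y) * L (t, y) * (∑ i, fderiv ℝ (fun z => velC η x₀ z i) (t, y)
        (0, EuclideanSpace.single i 1)) +
      m (t, y) * (∑ i, velC η x₀ (t, y) i * fderiv ℝ L (t, y) (0, EuclideanSpace.single i 1)) +
      L (t, y) * (∑ i, velC η x₀ (t, y) i * fderiv ℝ m (t, y) (0, EuclideanSpace.single i 1)) := by
    simp only [Finset.mul_sum, ← Finset.sum_add_distrib]
    exact Finset.sum_congr rfl fun i _ => by ring
  rw [hsum] at key
  have hmv : m (t, y) = densC g ν η x₀ (t, y) * volDensity g x₀ y := rfl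
  have hvol := volDensity_pos g hy
  refine mul_left_cancel₀ hvol.ne' ?_
  -- The derivative of the volume density cancels between `A` and the term `P √det g`. The
  -- continuity equation removes the terms proportional to `L`, and `hmv` replaces `m` by `ρ √det
  -- g`, leaving the common factor `√det g`.
  linear_combination key + L (t, y) * hcont - ((1 / 2) * (∑ i, ∑ j,
    fderiv ℝ (fun w => gram g x₀ w i j) y v * velC η x₀ (t, y) i * velC η x₀ (t, y) j) -
    fderiv ℝ L (t, y) (1, 0) -
    ∑ i, velC η x₀ (t, y) i * fderiv ℝ L (t, y) (0, EuclideanSpace.single i 1)) * hmv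

end LocalEquations

end BarotropicFlow

/-! ### From coordinate equations to equations for vector fields and functions. -/

namespace BarotropicFlow

section EulerianEquations

open Filter Topology

variable {n : ℕ}
  {N : Type*} [TopologicalSpace N] [ChartedSpace (Model n) N]
  {M : Type*} [TopologicalSpace M] [ChartedSpace (Model n) M] [IsManifold (𝓡 n) ∞ M]
  {η : ℝ → N ≃ₘ⟮𝓡 n, 𝓡 n⟯ M} {F : ℝ → C^∞⟮𝓡 n, N; 𝓘(ℝ, ℝ), ℝ⟯} {J : Set ℝ} {x₀ : M}

theorem hasDerivAt_slice {E V : Type*} [NormedAddCommGroup E] [NormedSpace ℝ E]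
    [NormedAddCommGroup V] [NormedSpace ℝ V] {h : ℝ × E → V} {t : ℝ} {y : E}
    (hh : DifferentiableAt ℝ h (t, y)) :
    HasDerivAt (fun τ => h (τ, y)) (fderiv ℝ h (t, y) (1, 0)) t :=
  HasFDerivAt.comp_hasDerivAt (f := fun τ => (τ, y)) t hh.hasFDerivAt
    ((hasDerivAt_id t).prodMk (hasDerivAt_const t y))

theorem fderiv_slice {E V : Type*} [NormedAddCommGroup E] [NormedSpace ℝ E]
    [NormedAddCommGroup V] [NormedSpace ℝ V] {h : ℝ × E → V} {t : ℝ} {y : E}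
    (hh : DifferentiableAt ℝ h (t, y)) (w : E) :
    fderiv ℝ (fun z => h (t, z)) y w = fderiv ℝ h (t, y) (0, w) := by
  have h1 : HasFDerivAt (fun z => h (t, z)) ((fderiv ℝ h (t, y)).comp
      (ContinuousLinearMap.inr ℝ ℝ E)) y :=
    HasFDerivAt.comp y hh.hasFDerivAt (hasFDerivAt_prodMk_right t y)
  rw [h1.fderiv]
  rfl

/-- The conservation form and the advective form of a transport equation. -/
theorem conservation_eq_advective {R : ℝ × Model n → ℝ} {V : ℝ × Model n → Model n}
    {z : ℝ × Model n} (hR : DifferentiableAt ℝ R z)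
    (hV : ∀ i, DifferentiableAt ℝ (fun z => V z i) z) :
    fderiv ℝ R z (1, 0) + ∑ i, fderiv ℝ (fun z => R z * V z i) z (0, EuclideanSpace.single i 1) =
      fderiv ℝ R z (1, V z) +
        R z * ∑ i, fderiv ℝ (fun z => V z i) z (0, EuclideanSpace.single i 1) := by
  have h1 := fun i => (hR.hasFDerivAt.fun_mul (hV i).hasFDerivAt).fderiv
  simp only [h1, add_apply, smul_apply, smul_eq_mul]
  rw [fderiv_apply_eq_sum 1 (V z), Finset.sum_add_distrib, Finset.mul_sum]
  ring

/-- The weight `√det g` does not depend on time and can be divided out, which leaves the coordinate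
formula for the divergence. A general `r` is allowed because both `ρ` and `λ(ρ) f` are transported
in this way. -/
theorem hasDerivAt_neg_div (g : Metric n M) {x : M} {t : ℝ} {r : ℝ → M → ℝ}
    (hr : DifferentiableAt ℝ (fun z : ℝ × Model n => r z.1 ((extChartAt (𝓡 n) x).symm z.2))
      (t, extChartAt (𝓡 n) x x))
    (hV : ∀ i, DifferentiableAt ℝ (fun z => velC η x z i) (t, extChartAt (𝓡 n) x x))
    (h : fderiv ℝ (fun z : ℝ × Model n => volDensity g x z.2 *
        r z.1 ((extChartAt (𝓡 n) x).symm z.2)) (t, extChartAt (𝓡 n) x x) (1, 0) +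
      ∑ i, fderiv ℝ (fun z : ℝ × Model n => volDensity g x z.2 *
        r z.1 ((extChartAt (𝓡 n) x).symm z.2) * velC η x z i) (t, extChartAt (𝓡 n) x x)
        (0, EuclideanSpace.single i 1) = 0) :
    HasDerivAt (fun τ => r τ x) (-div g (fun y => r t y • eulerVelocity η t y) x) t := by
  set y := extChartAt (𝓡 n) x x with hy
  have hyt : y ∈ (extChartAt (𝓡 n) x).target := mem_extChartAt_target x
  have hyx : (extChartAt (𝓡 n) x).symm y = x := extChartAt_to_inv x
  have hvol := volDensity_pos g hyt
  have dvol : DifferentiableAt ℝ (fun z : ℝ × Model n => volDensity g x z.2) (t, y) :=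
    DifferentiableAt.comp (t, y) (g := volDensity g x) (f := Prod.snd)
      (((contDiffOn_volDensity g x).contDiffAt ((isOpen_chart_target x).mem_nhds
        hyt)).differentiableAt (by simp)) differentiableAt_snd
  have h1 := hasDerivAt_slice hr
  simp only [hyx] at h1
  have h2 := (hasDerivAt_slice (dvol.fun_mul hr)).unique
    ((h1.const_mul (volDensity g x y)).congr_of_eventuallyEq
      (Eventually.of_forall fun τ => by simp only [hyx]))
  refine h1.congr_deriv ?_
  have h3 : div g (fun y => r t y • eulerVelocity η t y) x = (1 / volDensity g x y) *
      ∑ i, fderiv ℝ (fun z : ℝ × Model n => volDensity g x z.2 *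
        r z.1 ((extChartAt (𝓡 n) x).symm z.2) * velC η x z i) (t, y)
        (0, EuclideanSpace.single i 1) := by
    simp only [div]
    congr 1
    refine Finset.sum_congr rfl fun i _ => ?_
    rw [← fderiv_slice ((dvol.fun_mul hr).fun_mul (hV i))]
    unfold pderiv
    congr 2
    funext z
    have h4 : fieldCoord x (fun y => r t y • eulerVelocity η t y) z =
        r t ((extChartAt (𝓡 n) x).symm z) • velC η x (t, z) := by
      simp only [fieldCoord, velC]
      exact map_smul _ _ _
    rw [h4]
    simp only [PiLp.smul_apply, smul_eq_mul, volDensity]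
    ring
  rw [h3]
  rw [h2] at h
  field_simp
  linarith

/-- Contraction with the symmetric `VⁱVʲ` merges the first two of the three derivatives in the
Christoffel symbol, which is the shape produced by the momentum equation. -/
theorem christoffel_sum (g : Metric n M) (x₀ : M) (k : Fin n) (y V : Model n) :
    ∑ i, ∑ j, christoffel g x₀ k i j y * V i * V j =
      ∑ l, (gram g x₀ y)⁻¹ k l * (∑ i, ∑ j, pderiv i (fun z => gram g x₀ z l j) y * V i * V j -
        (1 / 2) * ∑ i, ∑ j, pderiv l (fun z => gram g x₀ z i j) y * V i * V j) := by
  have hsym : ∀ i j l, pderiv i (fun z => gram g x₀ z j l) y =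
      pderiv i (fun z => gram g x₀ z l j) y := fun i j l => by
    congr 1
    funext z
    exact gram_symm g x₀ z j l
  have h1 : ∀ l, ∑ i, ∑ j, pderiv j (fun z => gram g x₀ z i l) y * V i * V j =
      ∑ i, ∑ j, pderiv i (fun z => gram g x₀ z l j) y * V i * V j := fun l => by
    rw [Finset.sum_comm]
    refine Finset.sum_congr rfl fun i _ => Finset.sum_congr rfl fun j _ => ?_
    rw [hsym i j l]
    ring
  have h2 : ∀ l, (∑ i, ∑ j, pderiv i (fun z => gram g x₀ z l j) y * V i * V j -
        (1 / 2) * ∑ i, ∑ j, pderiv l (fun z => gram g x₀ z i j) y * V i * V j) =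
      ∑ i, ∑ j, (1 / 2) * (pderiv i (fun z => gram g x₀ z j l) y +
        pderiv j (fun z => gram g x₀ z i l) y - pderiv l (fun z => gram g x₀ z i j) y) *
          V i * V j := fun l => by
    have h3 : ∑ i, ∑ j, (1 / 2) * (pderiv i (fun z => gram g x₀ z j l) y +
        pderiv j (fun z => gram g x₀ z i l) y - pderiv l (fun z => gram g x₀ z i j) y) *
          V i * V j = (1 / 2) * (∑ i, ∑ j, pderiv i (fun z => gram g x₀ z l j) y * V i * V j) +
        (1 / 2) * (∑ i, ∑ j, pderiv j (fun z => gram g x₀ z i l) y * V i * V j) -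
        (1 / 2) * (∑ i, ∑ j, pderiv l (fun z => gram g x₀ z i j) y * V i * V j) := by
      simp only [Finset.mul_sum, ← Finset.sum_add_distrib, ← Finset.sum_sub_distrib]
      refine Finset.sum_congr rfl fun i _ => Finset.sum_congr rfl fun j _ => ?_
      rw [hsym i j l]
      ring
    rw [h3, h1]
    ring
  simp only [h2]
  simp only [christoffel, Finset.mul_sum, Finset.sum_mul]
  symm
  rw [Finset.sum_comm]
  refine Finset.sum_congr rfl fun i _ => ?_
  rw [Finset.sum_comm]
  refine Finset.sum_congr rfl fun j _ => Finset.sum_congr rfl fun l _ => ?_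
  ring

/-- Raising the index in the equation of motion. -/
theorem eq_neg_covDeriv_sub_grad (g : Metric n M) {x : M} {u : ∀ x : M, TangentSpace (𝓡 n) x}
    {h : M → ℝ} {y V A : Model n} (hy : y = extChartAt (𝓡 n) x x) (hV : fieldCoord x u y = V) (c : ℝ)
    (hA : ∀ l, ∑ j, gram g x y l j *
        (A j + ∑ i, V i * pderiv i (fun z => fieldCoord x u z j) y) =
      (1 / 2) * (∑ i, ∑ j, pderiv l (fun z => gram g x z i j) y * V i * V j) -
      (∑ i, ∑ j, pderiv i (fun z => gram g x z l j) y * V i * V j) -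
      c * pderiv l (fun z => h ((extChartAt (𝓡 n) x).symm z)) y) :
    (A : TangentSpace (𝓡 n) x) = -covDeriv g u u x - c • grad g h x := by
  have hyt : y ∈ (extChartAt (𝓡 n) x).target := by rw [hy]; exact mem_extChartAt_target x
  have hdet : IsUnit (gram g x y).det := (gram_det_pos g hyt).ne'.isUnit
  set a : Fin n → ℝ := fun j => A j + ∑ i, V i * pderiv i (fun z => fieldCoord x u z j) y with ha
  set b : Fin n → ℝ := fun l =>
    (1 / 2) * (∑ i, ∑ j, pderiv l (fun z => gram g x z i j) y * V i * V j) -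
      (∑ i, ∑ j, pderiv i (fun z => gram g x z l j) y * V i * V j) -
      c * pderiv l (fun z => h ((extChartAt (𝓡 n) x).symm z)) y with hb
  have hab : (gram g x y).mulVec a = b := funext hA
  have hinv : a = (gram g x y)⁻¹.mulVec b := by
    rw [← hab, Matrix.mulVec_mulVec, Matrix.nonsing_inv_mul _ hdet, Matrix.one_mulVec]
  have key : ∀ k, A k = -((∑ i, V i * pderiv i (fun z => fieldCoord x u z k) y) +
      ∑ i, ∑ j, christoffel g x k i j y * V i * V j) -
      c * ∑ j, (gram g x y)⁻¹ k j * pderiv j (fun z => h ((extChartAt (𝓡 n) x).symm z)) y := by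
    intro k
    have h1 : a k = ∑ l, (gram g x y)⁻¹ k l * b l := congrFun hinv k
    have h2 : ∑ l, (gram g x y)⁻¹ k l * b l = -(∑ i, ∑ j, christoffel g x k i j y * V i * V j) -
        c * ∑ j, (gram g x y)⁻¹ k j * pderiv j (fun z => h ((extChartAt (𝓡 n) x).symm z)) y := by
      rw [christoffel_sum, Finset.mul_sum, ← Finset.sum_neg_distrib, ← Finset.sum_sub_distrib]
      refine Finset.sum_congr rfl fun l _ => ?_
      simp only [hb]
      ring
    rw [h2] at h1
    simp only [ha] at h1
    linarith
  subst hV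
  subst hy
  refine PiLp.ext fun k => ?_
  rw [key k]
  rfl

variable [IsManifold (𝓡 n) ∞ N]

/-- Conservation of mass. -/
theorem hasDerivAt_density (g : Metric n M) (ν : VolumeForm n N) (hJ : IsOpen J)
    (hη : ContMDiffOn (𝓘(ℝ, ℝ).prod (𝓡 n)) (𝓡 n) ∞ (fun z : ℝ × N => η z.1 z.2) (J ×ˢ univ))
    {t : ℝ} (ht : t ∈ J) (x : M) :
    HasDerivAt (fun τ => density g ν (η τ) x)
      (-div g (fun y => density g ν (η t) y • eulerVelocity η t y) x) t := by
  have hUo : IsOpen (J ×ˢ (extChartAt (𝓡 n) x).target) := hJ.prod (isOpen_chart_target x)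
  have hU : (t, extChartAt (𝓡 n) x x) ∈ J ×ˢ (extChartAt (𝓡 n) x).target :=
    ⟨ht, mem_extChartAt_target x⟩
  have dV : ∀ i, DifferentiableAt ℝ (fun z => velC η x z i) (t, extChartAt (𝓡 n) x x) := fun i =>
    (((EuclideanSpace.proj (𝕜 := ℝ) i).contDiff.comp_contDiffOn
      (contDiffOn_velC hJ hη x)).contDiffAt (hUo.mem_nhds hU)).differentiableAt (by simp)
  have dρ := ((contDiffOn_densC g ν hJ hη x).contDiffAt (hUo.mem_nhds hU)).differentiableAt (by simp)
  have dm := ((contDiffOn_massC g ν hJ hη x).contDiffAt (hUo.mem_nhds hU)).differentiableAt (by simp)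
  have h1 := conservation_eq_advective dm dV
  rw [continuity_advective g ν hJ hη x ht hU.2] at h1
  refine hasDerivAt_neg_div g (r := fun t x => density g ν (η t) x) dρ dV ?_
  have h2 : (fun z : ℝ × Model n => volDensity g x z.2 *
      density g ν (η z.1) ((extChartAt (𝓡 n) x).symm z.2)) = massC g ν η x :=
    funext fun z => mul_comm _ _
  have h3 : ∀ i, (fun z : ℝ × Model n => volDensity g x z.2 *
      density g ν (η z.1) ((extChartAt (𝓡 n) x).symm z.2) * velC η x z i) =
      fun z => massC g ν η x z * velC η x z i := fun i =>
    funext fun z => by rw [← h2]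
  simp only [h2, h3]
  exact h1

variable [T2Space M] [CompactSpace M] [MeasurableSpace M] [BorelSpace M]

/-- Conservation of `λ(ρ) f`. -/
theorem IsGeodesicOn.hasDerivAt_charge {g : Metric n M} {ν : VolumeForm n N} {lam : ℝ → ℝ}
    (hgeo : IsGeodesicOn g ν lam η F J) (hJ : IsOpen J) (hlam : ContDiffOn ℝ ∞ lam (Ioi 0))
    {t : ℝ} (ht : t ∈ J) (x : M) :
    HasDerivAt (fun τ => lam (density g ν (η τ) x) * eulerRate η F τ x)
      (-div g (fun y => (lam (density g ν (η t) y) * eulerRate η F t y) • eulerVelocity η t y) x)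
      t := by
  have hUo : IsOpen (J ×ˢ (extChartAt (𝓡 n) x).target) := hJ.prod (isOpen_chart_target x)
  have hU : (t, extChartAt (𝓡 n) x x) ∈ J ×ˢ (extChartAt (𝓡 n) x).target :=
    ⟨ht, mem_extChartAt_target x⟩
  have dV : ∀ i, DifferentiableAt ℝ (fun z => velC η x z i) (t, extChartAt (𝓡 n) x x) := fun i =>
    (((EuclideanSpace.proj (𝕜 := ℝ) i).contDiff.comp_contDiffOn
      (contDiffOn_velC hJ hgeo.smooth_fst x)).contDiffAt (hUo.mem_nhds hU)).differentiableAt (by simp)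
  have dq := ((contDiffOn_chargeC g ν hlam hJ hgeo.smooth_fst hgeo.smooth_snd x).contDiffAt
    (hUo.mem_nhds hU)).differentiableAt (by simp)
  exact hasDerivAt_neg_div g (r := fun t x => lam (density g ν (η t) x) * eulerRate η F t x) dq dV
    (hgeo.charge_equation hJ hlam x ht hU.2)

/-- The equation of motion. -/
theorem IsGeodesicOn.hasDerivAt_velocity {g : Metric n M} {ν : VolumeForm n N} {lam : ℝ → ℝ}
    (hgeo : IsGeodesicOn g ν lam η F J) (hJ : IsOpen J) (hlam : ContDiffOn ℝ ∞ lam (Ioi 0))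
    {t : ℝ} (ht : t ∈ J) (x : M) :
    HasDerivAt (fun τ => eulerVelocity η τ x)
      (-covDeriv g (eulerVelocity η t) (eulerVelocity η t) x - (1 / density g ν (η t) x) •
        grad g (fun y => phi lam (density g ν (η t) y) * eulerRate η F t y ^ 2) x) t := by
  set y := extChartAt (𝓡 n) x x with hy
  have hyt : y ∈ (extChartAt (𝓡 n) x).target := mem_extChartAt_target x
  have hyx : (extChartAt (𝓡 n) x).symm y = x := extChartAt_to_inv x
  have hUo : IsOpen (J ×ˢ (extChartAt (𝓡 n) x).target) := hJ.prod (isOpen_chart_target x)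
  have hU : (t, y) ∈ J ×ˢ (extChartAt (𝓡 n) x).target := ⟨ht, hyt⟩
  have dVV : DifferentiableAt ℝ (velC η x) (t, y) :=
    ((contDiffOn_velC hJ hgeo.smooth_fst x).contDiffAt (hUo.mem_nhds hU)).differentiableAt (by simp)
  have dV : ∀ i, DifferentiableAt ℝ (fun z => velC η x z i) (t, y) := fun i =>
    (EuclideanSpace.proj (𝕜 := ℝ) i).differentiableAt.comp (t, y) dVV
  have dP := ((contDiffOn_pressureC g ν hlam hJ hgeo.smooth_fst hgeo.smooth_snd x).contDiffAt
    (hUo.mem_nhds hU)).differentiableAt (by simp)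
  -- The tangent space at `x` is identified with the model space through the chart at `x`, so at its
  -- centre the components of a vector are the vector itself.
  have hvel : ∀ τ, velC η x (τ, y) = eulerVelocity η τ x := fun τ => by
    simp only [velC, hy]
    rw [fieldCoord_extChartAt (mem_extChartAt_source x), chartDeriv_self]
  have h1 := hasDerivAt_slice dVV
  simp only [hvel] at h1
  refine HasDerivAt.congr_deriv h1 ?_
  refine eq_neg_covDeriv_sub_grad g hy (V := velC η x (t, y)) rfl _ fun l => ?_
  have hproj : ∀ (i : Fin n) w, fderiv ℝ (velC η x) (t, y) w i =
      fderiv ℝ (fun z => velC η x z i) (t, y) w := fun i w => by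
    have e := HasFDerivAt.comp (t, y) (EuclideanSpace.proj (𝕜 := ℝ) i).hasFDerivAt dVV.hasFDerivAt
    exact (DFunLike.congr_fun e.fderiv w).symm
  have hpd : ∀ i j : Fin n, pderiv i (fun z => fieldCoord x (eulerVelocity η t) z j) y =
      fderiv ℝ (fun z => velC η x z j) (t, y) (0, EuclideanSpace.single i 1) := fun i j =>
    fderiv_slice (dV j) _
  have hpP : pderiv l (fun z => phi lam (density g ν (η t) ((extChartAt (𝓡 n) x).symm z)) *
      eulerRate η F t ((extChartAt (𝓡 n) x).symm z) ^ 2) y =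
      fderiv ℝ (pressureC g ν lam η F x) (t, y) (0, EuclideanSpace.single l 1) :=
    fderiv_slice dP _
  have dG : ∀ i j, HasFDerivAt (fun w => gram g x w i j) (fderiv ℝ (fun w => gram g x w i j) y) y :=
    fun i j => (((contDiffOn_gram g x i j).contDiffAt ((isOpen_chart_target x).mem_nhds
      hyt)).differentiableAt (by simp)).hasFDerivAt
  -- For `v` the `l`-th basis vector the momentum is the velocity with its index lowered; the
  -- inverse metric in `eq_neg_covDeriv_sub_grad` raises it again.
  have hmom : ∀ z, momentumC g η x (EuclideanSpace.single l 1) z =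
      ∑ j, gram g x z.2 l j * velC η x z j := fun z => by
    simp only [momentumC]
    rw [Finset.sum_eq_single l]
    · simp
    · intro i _ hi
      simp [hi]
    · simp
  have dGs : ∀ j, HasFDerivAt (fun z : ℝ × Model n => gram g x z.2 l j)
      ((fderiv ℝ (fun w => gram g x w l j) y).comp (ContinuousLinearMap.snd ℝ ℝ (Model n)))
      (t, y) := fun j =>
    HasFDerivAt.comp (t, y) (g := fun w => gram g x w l j) (f := Prod.snd) (dG l j) hasFDerivAt_snd
  have dmom : HasFDerivAt (momentumC g η x (EuclideanSpace.single l 1))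
      (∑ j, (gram g x y l j • fderiv ℝ (fun z => velC η x z j) (t, y) + velC η x (t, y) j •
        (fderiv ℝ (fun w => gram g x w l j) y).comp (ContinuousLinearMap.snd ℝ ℝ (Model n))))
      (t, y) := by
    have e := HasFDerivAt.fun_sum (u := Finset.univ) fun j _ => (dGs j).fun_mul (dV j).hasFDerivAt
    exact e.congr_of_eventuallyEq (Eventually.of_forall hmom)
  have hm := hgeo.momentum_equation hJ hlam x ht hyt (EuclideanSpace.single l 1)
  rw [dmom.fderiv] at hm
  simp only [sum_apply, add_apply, smul_apply, smul_eq_mul,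
    ContinuousLinearMap.comp_apply, ContinuousLinearMap.coe_snd'] at hm
  -- The metric coefficients do not depend on time, so along the flow they change only by transport;
  -- this supplies the term `∂ᵢ gₗⱼ VⁱVʲ` of the Christoffel contraction.
  have hgV : ∀ j, fderiv ℝ (fun w => gram g x w l j) y (velC η x (t, y)) =
      ∑ i, velC η x (t, y) i * pderiv i (fun w => gram g x w l j) y := fun j => by
    conv_lhs => rw [model_sum_single (velC η x (t, y)), map_sum]
    simp only [map_smul, smul_eq_mul, pderiv]
  have hρ : densC g ν η x (t, y) = density g ν (η t) x := by simp only [densC, hyx]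
  have hρ0 := density_pos g ν (η t) x
  have hS : ∑ j, velC η x (t, y) j * ∑ i, velC η x (t, y) i *
      pderiv i (fun w => gram g x w l j) y =
      ∑ i, ∑ j, pderiv i (fun z => gram g x z l j) y * velC η x (t, y) i * velC η x (t, y) j := by
    rw [Finset.sum_comm]
    simp only [Finset.mul_sum]
    refine Finset.sum_congr rfl fun i _ => Finset.sum_congr rfl fun j _ => ?_
    ring
  have hD : ∀ j, fderiv ℝ (fun z => velC η x z j) (t, y) (1, velC η x (t, y)) =
      fderiv ℝ (velC η x) (t, y) (1, 0) j + ∑ i, velC η x (t, y) i *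
        pderiv i (fun z => fieldCoord x (eulerVelocity η t) z j) y := fun j => by
    rw [fderiv_apply_eq_sum, one_mul, hproj]
    simp only [hpd]
  simp only [hgV, hD, hρ, Finset.sum_add_distrib, hS] at hm
  rw [hpP]
  field_simp
  simp only [pderiv] at hm ⊢
  linarith

end EulerianEquations

end BarotropicFlow

/-! ### Propagation of the initial condition along particle paths. -/

namespace BarotropicFlow

section DistinguishedDistribution

open Filter Topology

variable {n : ℕ}
  {N : Type*} [TopologicalSpace N] [ChartedSpace (Model n) N] [IsManifold (𝓡 n) ∞ N]
  {M : Type*} [TopologicalSpace M] [ChartedSpace (Model n) M] [IsManifold (𝓡 n) ∞ M]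
  [T2Space M] [CompactSpace M] [MeasurableSpace M] [BorelSpace M]
  {η : ℝ → N ≃ₘ⟮𝓡 n, 𝓡 n⟯ M} {F : ℝ → C^∞⟮𝓡 n, N; 𝓘(ℝ, ℝ), ℝ⟯} {J : Set ℝ}

/-- The quotient `λ(ρ) f / ρ` is constant along particle paths. -/
theorem IsGeodesicOn.hasDerivAt_charge_div_density {g : Metric n M} {ν : VolumeForm n N}
    {lam : ℝ → ℝ} (hgeo : IsGeodesicOn g ν lam η F J) (hJ : IsOpen J)
    (hlam : ContDiffOn ℝ ∞ lam (Ioi 0)) {t : ℝ} (ht : t ∈ J) (p : N) :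
    HasDerivAt (fun τ => lam (density g ν (η τ) (η τ p)) * eulerRate η F τ (η τ p) /
      density g ν (η τ) (η τ p)) 0 t := by
  set x := η t p with hx
  set y := extChartAt (𝓡 n) x x with hy
  have hyt : y ∈ (extChartAt (𝓡 n) x).target := mem_extChartAt_target x
  have hUo : IsOpen (J ×ˢ (extChartAt (𝓡 n) x).target) := hJ.prod (isOpen_chart_target x)
  have hU : (t, y) ∈ J ×ˢ (extChartAt (𝓡 n) x).target := ⟨ht, hyt⟩
  have dV : ∀ i, DifferentiableAt ℝ (fun z => velC η x z i) (t, y) := fun i =>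
    (((EuclideanSpace.proj (𝕜 := ℝ) i).contDiff.comp_contDiffOn
      (contDiffOn_velC hJ hgeo.smooth_fst x)).contDiffAt (hUo.mem_nhds hU)).differentiableAt (by simp)
  have hvs : ContDiffOn ℝ ∞ (fun z : ℝ × Model n => volDensity g x z.2)
      (J ×ˢ (extChartAt (𝓡 n) x).target) :=
    (contDiffOn_volDensity g x).comp contDiffOn_snd fun _ hz => hz.2
  set Q : ℝ × Model n → ℝ := fun z => volDensity g x z.2 * chargeC g ν lam η F x z with hQ
  set m := massC g ν η x with hm
  have dQ : DifferentiableAt ℝ Q (t, y) :=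
    ((hvs.mul (contDiffOn_chargeC g ν hlam hJ hgeo.smooth_fst hgeo.smooth_snd x)).contDiffAt
      (hUo.mem_nhds hU)).differentiableAt (by simp)
  have dm : DifferentiableAt ℝ m (t, y) :=
    ((contDiffOn_massC g ν hJ hgeo.smooth_fst x).contDiffAt (hUo.mem_nhds hU)).differentiableAt
      (by simp)
  have e1 := conservation_eq_advective dQ dV
  rw [hgeo.charge_equation hJ hlam x ht hyt] at e1
  have e2 := continuity_advective g ν hJ hgeo.smooth_fst x ht hyt
  rw [← hm] at e2
  have hpath : HasDerivAt (fun τ => (τ, extChartAt (𝓡 n) x (η τ p))) (1, velC η x (t, y)) t :=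
    (hasDerivAt_id t).prodMk
      (hasDerivAt_chart_curve hJ hgeo.smooth_fst ht p (mem_extChartAt_source x))
  have dQt := HasFDerivAt.comp_hasDerivAt t dQ.hasFDerivAt hpath
  have dmt := HasFDerivAt.comp_hasDerivAt t dm.hasFDerivAt hpath
  have hm0 : m (t, y) ≠ 0 := (mul_pos (densC_pos g ν η x (t, y)) (volDensity_pos g hyt)).ne'
  have hdiv := dQt.fun_div dmt hm0
  have hev : ∀ᶠ τ in 𝓝 t, η τ p ∈ (extChartAt (𝓡 n) x).source :=
    (contMDiffAt_path hJ hgeo.smooth_fst ht p).continuousAt.preimage_mem_nhds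
      ((isOpen_chart_source x).mem_nhds (mem_extChartAt_source x))
  refine (hdiv.congr_deriv ?_).congr_of_eventuallyEq ?_
  · rw [div_eq_zero_iff]
    left
    show fderiv ℝ Q (t, y) (1, velC η x (t, y)) * m (t, y) -
      Q (t, y) * fderiv ℝ m (t, y) (1, velC η x (t, y)) = 0
    -- Both `Q` and `m` satisfy `DR + R ∑ ∂ᵢVⁱ = 0`, with `D` the derivative along the path; the
    -- common divergence cancels in the numerator of the quotient rule.
    linear_combination (-m (t, y)) * e1 - Q (t, y) * e2
  · filter_upwards [hev] with τ hτ
    have hv := (volDensity_pos g ((extChartAt (𝓡 n) x).map_source hτ)).ne'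
    simp only [Function.comp, hQ, hm, massC, chargeC, densC, rateC,
      (extChartAt (𝓡 n) x).left_inv hτ]
    rw [mul_comm (volDensity g x _), mul_div_mul_right _ _ hv]

/-- The quotient is constant on the connected time interval for each particle and starts at `1`. The
argument is particle by particle and needs no uniqueness theorem for the Euler equations. -/
theorem IsGeodesicOn.charge_eq_density {g : Metric n M} {ν : VolumeForm n N} {lam : ℝ → ℝ} {T : ℝ}
    (hgeo : IsGeodesicOn g ν lam η F (Ioo (-T) T)) (hlam : ContDiffOn ℝ ∞ lam (Ioi 0))
    (hlam_pos : ∀ r, 0 < r → 0 < lam r) (hT : 0 < T)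
    (h0 : ∀ p, deriv (fun τ => F τ p) 0 =
      density g ν (η 0) (η 0 p) / lam (density g ν (η 0) (η 0 p)))
    {t : ℝ} (ht : t ∈ Ioo (-T) T) (x : M) :
    lam (density g ν (η t) x) * eulerRate η F t x = density g ν (η t) x := by
  obtain ⟨p, rfl⟩ : ∃ p, η t p = x := ⟨(η t).symm x, (η t).apply_symm_apply x⟩
  have hT0 : (0 : ℝ) ∈ Ioo (-T) T := ⟨by linarith, hT⟩
  have hd := fun τ (hτ : τ ∈ Ioo (-T) T) =>
    hgeo.hasDerivAt_charge_div_density isOpen_Ioo hlam hτ p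
  have hconst := isOpen_Ioo.is_const_of_deriv_eq_zero isPreconnected_Ioo
    (fun τ hτ => (hd τ hτ).differentiableAt.differentiableWithinAt)
    (fun τ hτ => (hd τ hτ).deriv) ht hT0
  have hρ := density_pos g ν (η t) (η t p)
  have hρ0 := density_pos g ν (η 0) (η 0 p)
  have hl0 := hlam_pos _ hρ0
  have h1 : eulerRate η F 0 (η 0 p) = density g ν (η 0) (η 0 p) /
      lam (density g ν (η 0) (η 0 p)) := by
    rw [← h0 p, eulerRate, Diffeomorph.symm_apply_apply]
  simp only [h1] at hconst
  rw [mul_div_cancel₀ _ hl0.ne', div_self hρ0.ne', div_eq_one_iff_eq hρ.ne'] at hconst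
  exact hconst

end DistinguishedDistribution

end BarotropicFlow

open BarotropicFlow in
theorem mainTheorem2 {n : ℕ}
    {N : Type*} [TopologicalSpace N] [ChartedSpace (Model n) N] [IsManifold (𝓡 n) ∞ N]
    {M : Type*} [TopologicalSpace M] [ChartedSpace (Model n) M] [IsManifold (𝓡 n) ∞ M]
    [T2Space M] [CompactSpace M] [MeasurableSpace M] [BorelSpace M]
    (g : Metric n M) (ν : VolumeForm n N)
    (lam : ℝ → ℝ) (hlam : ContDiffOn ℝ ∞ lam (Ioi 0)) (hlam_pos : ∀ r, 0 < r → 0 < lam r)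
    (T : ℝ) (hT : 0 < T)
    (η : ℝ → N ≃ₘ⟮𝓡 n, 𝓡 n⟯ M) (F : ℝ → C^∞⟮𝓡 n, N; 𝓘(ℝ, ℝ), ℝ⟯)
    (hgeo : IsGeodesicOn g ν lam η F (Ioo (-T) T))
    (ρ : ℝ → M → ℝ) (hρ : ρ = fun t => density g ν (η t))
    (u : ℝ → ∀ x : M, TangentSpace (𝓡 n) x) (hu : u = eulerVelocity η)
    (f : ℝ → M → ℝ) (hf : f = eulerRate η F)
    (q : ℝ → M → ℝ) (hq : q = fun t x => lam (ρ t x) * f t x) :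
    -- regularity of the Eulerian variables
    (ContMDiffOn (𝓘(ℝ, ℝ).prod (𝓡 n)) (𝓡 n).tangent ∞
        (fun z : ℝ × M => (⟨z.2, u z.1 z.2⟩ : TangentBundle (𝓡 n) M)) (Ioo (-T) T ×ˢ univ) ∧
      ContMDiffOn (𝓘(ℝ, ℝ).prod (𝓡 n)) 𝓘(ℝ, ℝ) ∞
        (fun z : ℝ × M => q z.1 z.2) (Ioo (-T) T ×ˢ univ) ∧
      ContMDiffOn (𝓘(ℝ, ℝ).prod (𝓡 n)) 𝓘(ℝ, ℝ) ∞
        (fun z : ℝ × M => ρ z.1 z.2) (Ioo (-T) T ×ˢ univ) ∧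
      ∀ t ∈ Ioo (-T) T, ∀ x, 0 < ρ t x) ∧
    -- the geodesic equation in Eulerian variables
    (∀ t ∈ Ioo (-T) T, ∀ x,
      HasDerivAt (fun τ => u τ x)
        (-covDeriv g (u t) (u t) x
          - (1 / ρ t x) • grad g (fun y => q t y ^ 2 * phi lam (ρ t y) / lam (ρ t y) ^ 2) x) t ∧
      HasDerivAt (fun τ => q τ x) (-div g (fun y => q t y • u t y) x) t) ∧
    -- the case of an initial velocity in the distinguished distribution
    (∀ u₀ : ∀ x : M, TangentSpace (𝓡 n) x,
      (∀ p, mfderiv 𝓘(ℝ, ℝ) (𝓡 n) (fun τ => η τ p) 0 (1 : ℝ) = u₀ (η 0 p)) →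
      (∀ p, deriv (fun τ => F τ p) 0 = ρ 0 (η 0 p) / lam (ρ 0 (η 0 p))) →
        u 0 = u₀ ∧
        ∀ t ∈ Ioo (-T) T, ∀ x,
          f t x = ρ t x / lam (ρ t x) ∧
          HasDerivAt (fun τ => u τ x)
            (-covDeriv g (u t) (u t) x
              - (1 / ρ t x) • grad g (fun y => pressure lam (ρ t y)) x) t ∧
          HasDerivAt (fun τ => ρ τ x) (-div g (fun y => ρ t y • u t y) x) t) := by
  have hJ : IsOpen (Ioo (-T) T) := isOpen_Ioo
  have hpos : ∀ t x, 0 < density g ν (η t) x := fun t x => density_pos g ν (η t) x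
  have hρs : ContMDiffOn (𝓘(ℝ, ℝ).prod (𝓡 n)) 𝓘(ℝ, ℝ) ∞
      (fun z : ℝ × M => density g ν (η z.1) z.2) (Ioo (-T) T ×ˢ univ) := fun z hz =>
    (contMDiffAt_density g ν hJ hgeo.smooth_fst hz.1 z.2).contMDiffWithinAt
  have hfs : ContMDiffOn (𝓘(ℝ, ℝ).prod (𝓡 n)) 𝓘(ℝ, ℝ) ∞
      (fun z : ℝ × M => eulerRate η F z.1 z.2) (Ioo (-T) T ×ˢ univ) := fun z hz =>
    (contMDiffAt_eulerRate hJ hgeo.smooth_fst hgeo.smooth_snd hz.1 z.2).contMDiffWithinAt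
  have hvel : ∀ t ∈ Ioo (-T) T, ∀ x, HasDerivAt (fun τ => eulerVelocity η τ x)
      (-covDeriv g (eulerVelocity η t) (eulerVelocity η t) x - (1 / density g ν (η t) x) •
        grad g (fun y => (lam (density g ν (η t) y) * eulerRate η F t y) ^ 2 *
          phi lam (density g ν (η t) y) / lam (density g ν (η t) y) ^ 2) x) t := by
    intro t ht x
    -- Expressed through `q = λ(ρ) f`, the pressure `φ(ρ) f²` reads `q² φ(ρ) / λ(ρ)²`; positivity of
    -- `λ` permits the cancellation.
    have h1 : (fun y => (lam (density g ν (η t) y) * eulerRate η F t y) ^ 2 *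
        phi lam (density g ν (η t) y) / lam (density g ν (η t) y) ^ 2) =
        fun y => phi lam (density g ν (η t) y) * eulerRate η F t y ^ 2 := by
      funext y
      have h2 := (hlam_pos _ (hpos t y)).ne'
      field_simp
    rw [h1]
    exact hgeo.hasDerivAt_velocity hJ hlam ht x
  subst hρ hu hf hq
  refine ⟨⟨?_, ?_, hρs, fun t _ x => hpos t x⟩, fun t ht x => ⟨hvel t ht x,
    hgeo.hasDerivAt_charge hJ hlam ht x⟩, fun u₀ hu₀ hf₀ => ⟨?_, fun t ht x => ?_⟩⟩
  · exact fun z hz => (contMDiffAt_eulerVelocity hJ hgeo.smooth_fst hz.1 z.2).contMDiffWithinAt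
  · have h1 : ContMDiffOn (𝓘(ℝ, ℝ).prod (𝓡 n)) 𝓘(ℝ, ℝ) ∞
        (fun z : ℝ × M => lam (density g ν (η z.1) z.2)) (Ioo (-T) T ×ˢ univ) :=
      ContMDiffOn.comp (g := lam) hlam.contMDiffOn hρs fun z _ => hpos z.1 z.2
    exact h1.mul hfs
  · funext x
    obtain ⟨p, rfl⟩ : ∃ p, η 0 p = x := ⟨(η 0).symm x, (η 0).apply_symm_apply x⟩
    rw [eulerVelocity_apply, hu₀ p]
  · have hq : ∀ y, lam (density g ν (η t) y) * eulerRate η F t y = density g ν (η t) y := fun y =>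
      hgeo.charge_eq_density hlam hlam_pos hT hf₀ ht y
    refine ⟨?_, ?_, hasDerivAt_density g ν hJ hgeo.smooth_fst ht x⟩
    · exact (eq_div_iff (hlam_pos _ (hpos t x)).ne').2 (by rw [mul_comm]; exact hq x)
    · have h := hvel t ht x
      -- Replacing `q` by `ρ` turns `q² φ(ρ) / λ(ρ)²` into the barotropic pressure by definition.
      simp only [hq] at h
      exact h
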